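/- **Setting.** Let $d\in\{2,3\}$, $r\ge 2$, and let $\mathcal T^h$ be a conforming simplicial mesh in $\mathbb R^d$ with closed elements $\tau$ and mesh diameter $h=\max_\tau \operatorname{diam}\tau$; $\Omega$ is the interior of $\bigcup\tau$ (a polygonal/polyhedral domain), $\Gamma=\partial\Omega$, $\Gamma_D\subseteq\Gamma$ is a (possibly empty) union of closed element facets and $\Gamma_I=\Gamma\setminus\Gamma_D$. Let $\mathcal V^h$ be the space of continuous functions on $\overline\Omega$ that are polynomials of degree $\le r-1$ on each element and vanish on $\Gamma_D$, with a real nodal basis $\{\phi_p\}_{p\in\mathcal I^h}$, $\phi_p(x_q)=\delta_{pq}$, whose nodes $x_p$ are the affine images, in the elements, of a fixed set of points of the reference simplex that is unisolvent for polynomials of degree $\le r-1$ (e.g. the Lagrange nodes), those on $\Gamma_D$ being left out. For $D\subseteq\Omega$, $G\subseteq\partial D$, put $$a_{D,G}(u,v)=\int_D\nabla u\cdot\overline{\nabla v}-(k^2+\mathrm i\varepsilon)\int_D u\overline v-\mathrm i\eta\int_G u\overline v ,$$ where $k>0$, $\varepsilon\in\mathbb R$, $|\varepsilon|\le k^2$,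 and either $\eta=\operatorname{sign}(\varepsilon)k$ or $\eta=\sqrt{k^2+\mathrm i\varepsilon}$ (the root with positive imaginary part). Let $A_\varepsilon=(a_{\Omega,\Gamma_I}(\phi_q,\phi_p))_{p,q}$, $S=(\int_\Omega\nabla\phi_p\cdot\nabla\phi_q)$, $M=(\int_\Omega\phi_p\phi_q)$, $D_k=S+k^2M$, $\langle \mathbf V,\mathbf W\rangle_{D_k}=\mathbf W^*D_k\mathbf V$. Let $\Omega_1,\dots,\Omega_N$ be an open cover of $\Omega$, each $\Omega_\ell$ being the interior of a non-empty union of elements, of characteristic length scale $H_\ell$ (i.e. diameter $\sim H_\ell$, surface area $\sim H_\ell^{d-1}$, volume $\sim H_\ell^d$), $H=\max_\ell H_\ell$. Let $0<\delta_\ell\lesssim H$, $\delta=\min_\ell\delta_\ell$, and assume that for some $b\in(0,1)$ the part of $\Omega_\ell$ that is overlapped by other subdomains contains all points of $\Omega_\ell$ at distance $\le b\delta_\ell$ from $\partial\Omega_\ell\setminus\Gamma$ and is contained in the set of points of $\Omega_\ell$ at distance $\le\delta_\ell$ from it. Let $\Lambda=\max_\ell\#\{\ell':\overline{\Omega_\ell}\cap\overline{\Omega_{\ell'}}\ne\emptyset\}$.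 Let $\chi_\ell:\overline\Omega\to[0,1]$ be continuous, affine on each element, zero outside $\overline{\Omega_\ell}$, with $\sum_\ell\chi_\ell=1$ on $\overline\Omega$ and $\|\nabla\chi_\ell\|_{\infty,\tau}\lesssim\delta_\ell^{-1}$. With $\mathcal I^h(\overline{\Omega_\ell})=\{p:x_p\in\overline{\Omega_\ell}\}$ let $A_{\varepsilon,\ell}=(a_{\Omega_\ell,\partial\Omega_\ell\setminus\Gamma_D}(\phi_q,\phi_p))_{p,q\in\mathcal I^h(\overline{\Omega_\ell})}$, $(R_\ell\mathbf V)_p=\chi_\ell(x_p)V_p$ for $p\in\mathcal I^h(\overline{\Omega_\ell})$, and $B_\varepsilon^{-1}=\sum_\ell R_\ell^\top A_{\varepsilon,\ell}^{-1}R_\ell$. The mesh is shape regular and $kh\lesssim1$. All constants hidden in $\lesssim$ and $\sim$, here and below, are bounded by a fixed $K\ge1$. **Corollary 3.13.** (i) Let $0<\alpha,\beta<1$. There is $C>0$, depending only on $d$, $r$, the reference nodes, $K$, $\alpha$ and $\beta$, and for each value of $\Lambda$ there is $k_0>0$ (depending in addition on $\Lambda$) such that, whenever $k\ge k_0$, $|\varepsilon|\sim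 k^{1+\beta}$, $\delta\sim H$ and $H\sim k^{-\alpha}$, all $A_{\varepsilon,\ell}$ are invertible and $$\min_{\mathbf 0\ne\mathbf V\in\mathbb C^n}\frac{|\langle\mathbf V,B_\varepsilon^{-1}A_\varepsilon\mathbf V\rangle_{D_k}|}{\|\mathbf V\|_{D_k}^2}\ \ge\ \frac1\Lambda-C\,k^{\alpha-\beta}.$$ (ii) For fixed $\delta>0$ and $\Lambda$ there are $C,k_0>0$, depending only on $d$, $r$, the reference nodes, $K$, $\delta$ and $\Lambda$, such that, whenever $|\varepsilon|=Ck$ and $k\ge k_0$, all $A_{\varepsilon,\ell}$ are invertible and $$\min_{\mathbf 0\ne\mathbf V\in\mathbb C^n}\frac{|\langle\mathbf V,B_\varepsilon^{-1}A_\varepsilon\mathbf V\rangle_{D_k}|}{\|\mathbf V\|_{D_k}^2}\ \ge\ \frac1{2\Lambda}.$$ -/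

import Mathlib

open MeasureTheory

noncomputable section

namespace Helmholtz

/-- The ambient space `ℝ^d` with its Euclidean norm. -/
abbrev E (d : ℕ) : Type := EuclideanSpace ℝ (Fin d)

/-- `a ∼ b` with hidden constant `K`. -/
def Comparable (K a b : ℝ) : Prop := a ≤ K * b ∧ b ≤ K * a

/-- On the set `s`, the function `v` is a polynomial of total degree at most `m`. -/
def IsPolyOn {d : ℕ} (m : ℕ) (v : E d → ℝ) (s : Set (E d)) : Prop :=
  ∃ p : MvPolynomial (Fin d) ℝ, p.totalDegree ≤ m ∧
    ∀ x ∈ s, v x = MvPolynomial.eval (fun j => x j) p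

/-- A finite set `X` of points of the reference simplex
`{x : x j ≥ 0, ∑ j, x j ≤ 1}` that is unisolvent for polynomials of total degree `≤ m`. The
equispaced (principal lattice) points give the standard Lagrange element. -/
def IsReferenceNodeSet {d : ℕ} (m : ℕ) (X : Finset (Fin d → ℝ)) : Prop :=
  (∀ x ∈ X, (∀ j, 0 ≤ x j) ∧ ∑ j, x j ≤ 1) ∧
  ∀ c : (Fin d → ℝ) → ℝ, ∃! p : MvPolynomial (Fin d) ℝ,
    p.totalDegree ≤ m ∧ ∀ x ∈ X, MvPolynomial.eval x p = c x

/-- The closed simplex spanned by the vertices. -/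
def cellOf {d : ℕ} (s : Affine.Simplex ℝ (E d) d) : Set (E d) :=
  convexHull ℝ (Set.range s.points)

/-- The closed facet opposite to vertex number `m`. -/
def facetOf {d : ℕ} (s : Affine.Simplex ℝ (E d) d) (m : Fin (d + 1)) : Set (E d) :=
  convexHull ℝ (s.points '' {m}ᶜ)

/-- The image of a reference point under the affine map that sends the reference simplex to the
simplex `s` (vertices in the given order). -/
def refPoint {d : ℕ} (s : Affine.Simplex ℝ (E d) d) (x : Fin d → ℝ) : E d :=
  s.points 0 + ∑ j, x j • (s.points j.succ - s.points 0)

/-- A conforming simplicial mesh, together with a set of boundary facets that make up the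
Dirichlet boundary (so that the Dirichlet boundary is closed and resolved by the mesh).
The domain is the interior of the union of the (closed) elements. -/
structure Mesh (d : ℕ) where
  numElem : ℕ
  elem : Fin numElem → Affine.Simplex ℝ (E d) d
  elem_injective : Function.Injective fun i => Set.range (elem i).points
  conforming : ∀ i j, cellOf (elem i) ∩ cellOf (elem j) =
    convexHull ℝ (Set.range (elem i).points ∩ Set.range (elem j).points)
  dirichletFacets : Finset (Fin numElem × Fin (d + 1))
  dirichletFacets_subset : ∀ f ∈ dirichletFacets,
    facetOf (elem f.1) f.2 ⊆ frontier (interior (⋃ i, cellOf (elem i)))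

namespace Mesh

variable {d : ℕ} (T : Mesh d)

/-- The closed element number `i`. -/
def cell (i : Fin T.numElem) : Set (E d) := cellOf (T.elem i)

/-- The domain `Ω`. -/
def Ω : Set (E d) := interior (⋃ i, T.cell i)

/-- The boundary `Γ` of `Ω`. -/
def Γ : Set (E d) := frontier T.Ω

/-- The Dirichlet part of the boundary. -/
def ΓD : Set (E d) := ⋃ f ∈ T.dirichletFacets, facetOf (T.elem f.1) f.2

/-- The impedance part of the boundary. -/
def ΓI : Set (E d) := T.Γ \ T.ΓD

/-- The mesh diameter `h`. -/
def h : ℝ := ⨆ i, Metric.diam (T.cell i)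

/-- Shape regularity with constant `K`: each element contains a ball of radius comparable to its
diameter. -/
def ShapeRegular (K : ℝ) : Prop :=
  ∀ i, ∃ (x : E d) (ρ : ℝ), Metric.closedBall x ρ ⊆ T.cell i ∧ Metric.diam (T.cell i) ≤ K * ρ

/-- Continuous functions on the closure of `Ω` that are polynomial of total degree `≤ m` on each
element (only the values on the closure of `Ω` are relevant). -/
def IsPiecewisePoly (m : ℕ) (v : E d → ℝ) : Prop :=
  ContinuousOn v (closure T.Ω) ∧ ∀ i, IsPolyOn m v (T.cell i)

open Classical in
/-- The nodes of the finite element space: the images of the reference nodes in all elements,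
without those on the Dirichlet boundary. -/
def nodes (X : Finset (Fin d → ℝ)) : Finset (E d) :=
  ((Finset.univ ×ˢ X).image fun q : Fin T.numElem × (Fin d → ℝ) =>
    refPoint (T.elem q.1) q.2).filter fun x => x ∉ T.ΓD

end Mesh

/-- The form `∫_D ∇u·∇v - (k² + iε) ∫_D u v - i η ∫_G u v` for real-valued functions `u`, `v`
(for which complex conjugation of `v` is void), `G` a part of the boundary of `D`. -/
def helmholtzForm {d : ℕ} (D G : Set (E d)) (k ε : ℝ) (η : ℂ) (u v : E d → ℝ) : ℂ :=
  ((∫ x in D, inner ℝ (gradient u x) (gradient v x) : ℝ) : ℂ)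
    - ((k : ℂ) ^ 2 + Complex.I * ε) * ((∫ x in D, u x * v x : ℝ) : ℂ)
    - Complex.I * η * ((∫ x in G, u x * v x ∂(μHE[d - 1]) : ℝ) : ℂ)

/-- `D` has characteristic length scale `L` (with hidden constant `K`). -/
def HasLengthScale {d : ℕ} (K : ℝ) (D : Set (E d)) (L : ℝ) : Prop :=
  Comparable K (Metric.diam D) L ∧
  Comparable K ((μHE[d - 1] : Measure (E d)).real (frontier D)) (L ^ (d - 1)) ∧
  Comparable K ((volume : Measure (E d)).real D) (L ^ d)

/-- The data of the method: a mesh with Dirichlet boundary, the finite element space of degree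
`r - 1` with its nodal basis, the overlapping subdomains with their length scales `Hl` and overlap
parameters `δl`, and the partition of unity. -/
structure Setup (d r : ℕ) (X : Finset (Fin d → ℝ)) where
  mesh : Mesh d
  /-- The nodal basis. -/
  φ : mesh.nodes X → E d → ℝ
  φ_poly : ∀ p, mesh.IsPiecewisePoly (r - 1) (φ p)
  φ_dirichlet : ∀ p, ∀ x ∈ mesh.ΓD, φ p x = 0
  φ_nodal : ∀ p q : mesh.nodes X, φ p q = if p = q then 1 else 0
  /-- The number of subdomains. -/
  N : ℕ
  /-- The elements that make up each subdomain. -/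
  sub : Fin N → Finset (Fin mesh.numElem)
  sub_nonempty : ∀ l, (sub l).Nonempty
  cover : mesh.Ω ⊆ ⋃ l, interior (⋃ i ∈ sub l, mesh.cell i)
  Hl : Fin N → ℝ
  Hl_pos : ∀ l, 0 < Hl l
  δl : Fin N → ℝ
  δl_pos : ∀ l, 0 < δl l
  /-- The partition of unity: continuous and piecewise linear. -/
  χ : Fin N → E d → ℝ
  χ_poly : ∀ l, mesh.IsPiecewisePoly 1 (χ l)
  χ_mem : ∀ l, ∀ x ∈ closure mesh.Ω, χ l x ∈ Set.Icc (0 : ℝ) 1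
  χ_support : ∀ l, ∀ x ∈ closure mesh.Ω, χ l x ≠ 0 →
    x ∈ closure (interior (⋃ i ∈ sub l, mesh.cell i))
  χ_sum : ∀ x ∈ closure mesh.Ω, ∑ l, χ l x = 1

namespace Setup

variable {d r : ℕ} {X : Finset (Fin d → ℝ)} (P : Setup d r X)

/-- The subdomain `Ω_ℓ`. -/
def Ωl (l : Fin P.N) : Set (E d) := interior (⋃ i ∈ P.sub l, P.mesh.cell i)

/-- The largest subdomain length scale. -/
def H : ℝ := ⨆ l, P.Hl l

/-- The smallest overlap parameter. -/
def δ : ℝ := ⨅ l, P.δl l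

open Classical in
/-- The maximal number `Λ` of subdomains whose closures meet the closure of a given one. -/
def Λ : ℕ :=
  Finset.univ.sup fun l : Fin P.N =>
    (Finset.univ.filter fun l' : Fin P.N =>
      (closure (P.Ωl l) ∩ closure (P.Ωl l')).Nonempty).card

/-- The part of `Ω_ℓ` that is not overlapped by any other subdomain. -/
def nonOverlapped (l : Fin P.N) : Set (E d) := P.Ωl l \ ⋃ l' ∈ ({l}ᶜ : Set (Fin P.N)), P.Ωl l'

/-- The points of `Ω_ℓ` at distance at most `μ` from the interior boundary of `Ω_ℓ`. -/
def nearBoundary (l : Fin P.N) (μ : ℝ) : Set (E d) :=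
  {x ∈ P.Ωl l | Metric.infEDist x (frontier (P.Ωl l) \ P.mesh.Γ) ≤ ENNReal.ofReal μ}

/-- The overlap condition, with constant `b`. -/
def OverlapCondition (b : ℝ) : Prop :=
  ∀ l, P.nearBoundary l (b * P.δl l) ⊆ P.Ωl l \ P.nonOverlapped l ∧
    P.Ωl l \ P.nonOverlapped l ⊆ P.nearBoundary l (P.δl l)

/-- The standing assumptions on mesh, subdomains, overlap and partition of unity, with a single
constant `K` for all the hidden constants. -/
def Regular (K : ℝ) : Prop :=
  P.mesh.ShapeRegular K ∧
  (∀ l, HasLengthScale K (P.Ωl l) (P.Hl l)) ∧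
  (∀ l, P.δl l ≤ K * P.H) ∧
  (∃ b : ℝ, 0 < b ∧ b < 1 ∧ P.OverlapCondition b) ∧
  (∀ l i, ∀ x ∈ interior (P.mesh.cell i), ‖gradient (P.χ l) x‖ ≤ K / P.δl l)

/-- The index set of the nodes. -/
abbrev Idx : Type := P.mesh.nodes X

open Classical in
/-- The index set of the nodes on the closure of `Ω_ℓ`. -/
abbrev LocIdx (l : Fin P.N) : Type :=
  {p : P.Idx // (p : E d) ∈ closure (P.Ωl l)}

open Classical in
instance (l : Fin P.N) : Fintype (P.LocIdx l) := Subtype.fintype _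

/-- The stiffness matrix. -/
def stiffness : Matrix P.Idx P.Idx ℝ := fun p q =>
  ∫ x in P.mesh.Ω, inner ℝ (gradient (P.φ p) x) (gradient (P.φ q) x)

/-- The domain mass matrix. -/
def mass : Matrix P.Idx P.Idx ℝ := fun p q => ∫ x in P.mesh.Ω, P.φ p x * P.φ q x

/-- `D_k = S + k² M`, the matrix of the Helmholtz energy inner product. -/
def Dk (k : ℝ) : Matrix P.Idx P.Idx ℂ := (P.stiffness + k ^ 2 • P.mass).map (fun t => (t : ℂ))

/-- The system matrix `A_ε`. -/
def A (k ε : ℝ) (η : ℂ) : Matrix P.Idx P.Idx ℂ := fun p q =>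
  helmholtzForm P.mesh.Ω P.mesh.ΓI k ε η (P.φ q) (P.φ p)

/-- The matrix `A_{ε,ℓ}` of the local impedance problem on `Ω_ℓ`. -/
def Aloc (k ε : ℝ) (η : ℂ) (l : Fin P.N) : Matrix (P.LocIdx l) (P.LocIdx l) ℂ := fun p q =>
  helmholtzForm (P.Ωl l) (frontier (P.Ωl l) \ P.mesh.ΓD) k ε η (P.φ q) (P.φ p)

open Classical in
/-- The weighted restriction matrix: `(R_ℓ V)_p = χ_ℓ(x_p) V_p`. -/
def R (l : Fin P.N) : Matrix (P.LocIdx l) P.Idx ℂ := fun p q =>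
  if (p : P.Idx) = q then (P.χ l (p : P.Idx) : ℂ) else 0

open Classical in
/-- The preconditioner `B_ε⁻¹ = ∑_ℓ R_ℓᵀ A_{ε,ℓ}⁻¹ R_ℓ`. -/
def Binv (k ε : ℝ) (η : ℂ) : Matrix P.Idx P.Idx ℂ :=
  ∑ l, (P.R l).transpose * (P.Aloc k ε η l)⁻¹ * P.R l

/-- `⟨V, W⟩_{D_k} = W^* D_k V`. -/
def innerDk (k : ℝ) (V W : P.Idx → ℂ) : ℂ := star W ⬝ᵥ (P.Dk k).mulVec V

/-- The norm induced by `D_k`. -/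
def normDk (k : ℝ) (V : P.Idx → ℂ) : ℝ := Real.sqrt (P.innerDk k V V).re

open Classical in
/-- All local matrices are invertible (so that the preconditioner is well defined), and the field
of values of `B_ε⁻¹ A_ε` in the `D_k` inner product has distance at least `c` from the origin. -/
def FieldOfValuesBound (k ε : ℝ) (η : ℂ) (c : ℝ) : Prop :=
  (∀ l, IsUnit (P.Aloc k ε η l)) ∧
  ∀ V : P.Idx → ℂ, V ≠ 0 →
    c ≤ ‖P.innerDk k V ((P.Binv k ε η * P.A k ε η).mulVec V)‖ / P.normDk k V ^ 2

end Setup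

/-- The two admissible impedance parameters for `ε ≠ 0`: `η = sign(ε) k`, or `η = √(k² + iε)`, the
square root with branch cut on the positive real axis, i.e. with positive imaginary part. -/
def ImpedanceChoice (k ε : ℝ) (η : ℂ) : Prop :=
  η = ((SignType.sign ε : ℝ) * k : ℝ) ∨ (η ^ 2 = (k : ℂ) ^ 2 + Complex.I * ε ∧ 0 < η.im)

/-- The standing assumptions for `K`, `k`, `ε`, `η`, including `k h ≲ 1`. -/
def Admissible {d r : ℕ} {X : Finset (Fin d → ℝ)} (P : Setup d r X) (K k ε : ℝ) (η : ℂ) : Prop :=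
  P.Regular K ∧ k * P.mesh.h ≤ K ∧ |ε| ≤ k ^ 2 ∧ ImpedanceChoice k ε η

end Helmholtz

end

/-!
As `χ_ℓ w` vanishes outside `Ω_ℓ`, the number `⟨V, B_ε⁻¹ A_ε V⟩_{D_k}` is the sum over `ℓ` of the
energy products of `V` with `χ_ℓ u_ℓ`, where `u_ℓ` solves `a_ℓ(u_ℓ, w) = a_ℓ(V, χ_ℓ w)` for all
local `w`. The absorption makes `a_ℓ` coercive in the energy norm with constant `|ε| / (8 k²)`.
Since `χ_ℓ` varies by `h / δ` on an element and `kh ≲ 1`, multiplication by `χ_ℓ` followed by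
interpolation is self-adjoint for `a_ℓ` up to an error `σ ∼ 1 / (kδ)`; this is checked on each
element, by equivalence of norms for polynomials. Hence `u_ℓ` differs from `χ_ℓ V` by the fraction
`θ ∼ k / (|ε| δ)` of the local energy of `V`, and the sum is `∑_ℓ ‖χ_ℓ V‖²` up to terms of relative
size `θ` and `Λ θ²`. The linear term carries no factor `Λ` because the error is also measured with
the weight `χ_ℓ`, in which `a_ℓ` is again coercive up to `σ`. As the `χ_ℓ` sum to one and at most
`Λ` of them are nonzero on an element, `∑_ℓ ‖χ_ℓ V‖² ≥ ‖V‖² / Λ` by Cauchy-Schwarz.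
-/

noncomputable section

namespace Helmholtz

/-! ### Polynomials of bounded degree -/

section Polynomials

open Metric

variable {d : ℕ}

/-- The function on `ℝ^d` given by a polynomial. -/
def polyFun (p : MvPolynomial (Fin d) ℝ) (x : E d) : ℝ :=
  MvPolynomial.eval (fun j => x j) p

lemma polyFun_zero : polyFun (0 : MvPolynomial (Fin d) ℝ) = 0 := by
  ext
  simp [polyFun]

lemma polyFun_add (p q : MvPolynomial (Fin d) ℝ) : polyFun (p + q) = polyFun p + polyFun q := by
  ext x
  simp [polyFun]

lemma polyFun_smul (a : ℝ) (p : MvPolynomial (Fin d) ℝ) : polyFun (a • p) = a • polyFun p := by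
  ext x
  simp [polyFun, MvPolynomial.smul_eval]

lemma polyFun_sum {ι : Type*} (s : Finset ι) (p : ι → MvPolynomial (Fin d) ℝ) (x : E d) :
    polyFun (∑ i ∈ s, p i) x = ∑ i ∈ s, polyFun (p i) x :=
  map_sum _ _ _

lemma contDiff_polyFun (p : MvPolynomial (Fin d) ℝ) : ContDiff ℝ 1 (polyFun p) := by
  have hp : AnalyticOnNhd ℝ (fun x : E d => MvPolynomial.aeval (fun j => x j) p) Set.univ :=
    AnalyticOnNhd.aeval_mvPolynomial
      (fun j => (EuclideanSpace.proj j : E d →L[ℝ] ℝ).analyticOnNhd Set.univ) p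
  exact hp.contDiff

lemma continuous_polyFun (p : MvPolynomial (Fin d) ℝ) : Continuous (polyFun p) :=
  (contDiff_polyFun p).continuous

lemma differentiable_polyFun (p : MvPolynomial (Fin d) ℝ) : Differentiable ℝ (polyFun p) :=
  (contDiff_polyFun p).differentiable one_ne_zero

lemma continuous_fderiv_polyFun (p : MvPolynomial (Fin d) ℝ) :
    Continuous (fderiv ℝ (polyFun p)) :=
  (contDiff_polyFun p).continuous_fderiv one_ne_zero

lemma norm_gradient (f : E d → ℝ) (x : E d) : ‖gradient f x‖ = ‖fderiv ℝ f x‖ :=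
  LinearIsometryEquiv.norm_map _ _

lemma continuous_gradient_polyFun (p : MvPolynomial (Fin d) ℝ) :
    Continuous (gradient (polyFun p)) :=
  (InnerProductSpace.toDual ℝ (E d)).symm.continuous.comp (continuous_fderiv_polyFun p)

lemma gradient_polyFun_zero (x : E d) : gradient (polyFun (0 : MvPolynomial (Fin d) ℝ)) x = 0 := by
  rw [polyFun_zero]
  exact gradient_const x 0

lemma integrableOn_polyFun_mul (f g : MvPolynomial (Fin d) ℝ) {s : Set (E d)}
    (hs : IsCompact s) : IntegrableOn (fun y => polyFun f y * polyFun g y) s :=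
  ((continuous_polyFun f).mul (continuous_polyFun g)).continuousOn.integrableOn_compact hs

lemma integrableOn_polyFun_sq (f : MvPolynomial (Fin d) ℝ) {s : Set (E d)}
    (hs : IsCompact s) : IntegrableOn (fun y => polyFun f y ^ 2) s :=
  ((continuous_polyFun f).pow 2).continuousOn.integrableOn_compact hs

lemma integrableOn_gradient_inner (f g : MvPolynomial (Fin d) ℝ) {s : Set (E d)}
    (hs : IsCompact s) :
    IntegrableOn (fun y => inner ℝ (gradient (polyFun f) y) (gradient (polyFun g) y)) s :=
  ((continuous_gradient_polyFun f).inner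
    (continuous_gradient_polyFun g)).continuousOn.integrableOn_compact hs

lemma totalDegree_aeval_le {R σ τ : Type*} [CommSemiring R] (l : σ → MvPolynomial τ R)
    (hl : ∀ j, (l j).totalDegree ≤ 1) (p : MvPolynomial σ R) :
    (MvPolynomial.aeval l p).totalDegree ≤ p.totalDegree := by
  rw [MvPolynomial.aeval_def, MvPolynomial.eval₂_eq]
  refine MvPolynomial.totalDegree_finsetSum_le fun i hi => ?_
  calc _ ≤ (∏ j ∈ i.support, l j ^ i j).totalDegree := by
        refine (MvPolynomial.totalDegree_mul _ _).trans ?_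
        rw [MvPolynomial.algebraMap_eq, MvPolynomial.totalDegree_C, zero_add]
    _ ≤ ∑ j ∈ i.support, (l j ^ i j).totalDegree := MvPolynomial.totalDegree_finsetProd _ _
    _ ≤ ∑ j ∈ i.support, i j := by
        refine Finset.sum_le_sum fun j _ => (MvPolynomial.totalDegree_pow _ _).trans ?_
        simpa using Nat.mul_le_mul_left (i j) (hl j)
    _ ≤ p.totalDegree := MvPolynomial.le_totalDegree hi

lemma exists_polyFun_comp_affine {n : ℕ} (p : MvPolynomial (Fin d) ℝ) (a : E d)
    (b : Fin n → E d) :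
    ∃ q : MvPolynomial (Fin n) ℝ, q.totalDegree ≤ p.totalDegree ∧
      ∀ x : E n, polyFun q x = polyFun p (a + ∑ j, x j • b j) := by
  let l : Fin d → MvPolynomial (Fin n) ℝ := fun i =>
    MvPolynomial.C (a i) + ∑ j, MvPolynomial.C (b j i) * MvPolynomial.X j
  refine ⟨MvPolynomial.aeval l p, totalDegree_aeval_le l (fun i => ?_) p, fun x => ?_⟩
  · refine (MvPolynomial.totalDegree_add _ _).trans (max_le (by simp) ?_)
    refine MvPolynomial.totalDegree_finsetSum_le fun j _ => ?_
    exact (MvPolynomial.totalDegree_mul _ _).trans (by simp)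
  · have h := MvPolynomial.comp_aeval_apply (f := l) (φ := MvPolynomial.aeval fun j => x j) p
    simp only [MvPolynomial.aeval_eq_eval] at h
    rw [polyFun, h, polyFun]
    congr 2
    ext i
    simp [l, mul_comm]

lemma exists_polyFun_comp_homothety (p : MvPolynomial (Fin d) ℝ) (a : E d) (ρ : ℝ) :
    ∃ q : MvPolynomial (Fin d) ℝ, q.totalDegree ≤ p.totalDegree ∧
      ∀ x : E d, polyFun q x = polyFun p (a + ρ • x) := by
  obtain ⟨q, hq, h⟩ := exists_polyFun_comp_affine p a fun j => ρ • EuclideanSpace.single j (1 : ℝ)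
  refine ⟨q, hq, fun x => ?_⟩
  rw [h]
  congr 2
  ext i
  simp [Finset.sum_apply, Pi.single_apply, mul_comm]

lemma eq_zero_of_polyFun_eq_zero {p : MvPolynomial (Fin d) ℝ} {s : Set (E d)}
    (hs : (interior s).Nonempty) (h : ∀ x ∈ s, polyFun p x = 0) : p = 0 := by
  obtain ⟨x₀, hx₀⟩ := hs
  have hopen : IsOpen (WithLp.toLp 2 ⁻¹' interior s : Set (Fin d → ℝ)) :=
    isOpen_interior.preimage (PiLp.continuous_toLp 2 _)
  obtain ⟨t, ht, hball⟩ := Metric.isOpen_iff.1 hopen x₀.ofLp hx₀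
  refine MvPolynomial.funext_set (fun i => ball (x₀ i) t) (fun i => ?_) fun x hx => ?_
  · rw [Real.ball_eq_Ioo]
    exact Set.Ioo_infinite (by linarith)
  · rw [← ball_pi _ ht] at hx
    simpa [polyFun] using h _ (interior_subset (hball hx))

/-! ### Inverse estimates -/

lemma exists_norm_le_of_injective {W F G : Type*} [AddCommGroup W] [Module ℝ W]
    [FiniteDimensional ℝ W] [NormedAddCommGroup F] [NormedSpace ℝ F] [SeminormedAddCommGroup G]
    [NormedSpace ℝ G] (f : W →ₗ[ℝ] F) (hf : Function.Injective f) (g : W →ₗ[ℝ] G) :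
    ∃ C : ℝ, 0 < C ∧ ∀ w, ‖g w‖ ≤ C * ‖f w‖ := by
  let e : W ≃ₗ[ℝ] LinearMap.range f := LinearEquiv.ofInjective f hf
  let T : LinearMap.range f →L[ℝ] G := LinearMap.toContinuousLinearMap (g ∘ₗ e.symm.toLinearMap)
  refine ⟨‖T‖ + 1, by positivity, fun w => ?_⟩
  have hT : T (e w) = g w := congrArg g (e.symm_apply_apply w)
  calc ‖g w‖ ≤ ‖T‖ * ‖f w‖ := hT ▸ T.le_opNorm (e w)
    _ ≤ (‖T‖ + 1) * ‖f w‖ := by gcongr; exact le_add_of_nonneg_right zero_le_one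

/-- Polynomials of total degree at most `m` in `d` variables. -/
abbrev PolyLE (d m : ℕ) : Type := MvPolynomial.restrictTotalDegree (Fin d) ℝ m

/-- A polynomial of degree at most `m` as an element of `PolyLE d m`. -/
def PolyLE.mk {m : ℕ} (p : MvPolynomial (Fin d) ℝ) (hp : p.totalDegree ≤ m) : PolyLE d m :=
  ⟨p, (MvPolynomial.mem_restrictTotalDegree _ _ _).2 hp⟩

/-- Restriction of polynomials to the closed ball of radius `R`, with the sup norm as target
norm. -/
def ballRestrict (d m : ℕ) (R : ℝ) : PolyLE d m →ₗ[ℝ] C(closedBall (0 : E d) R, ℝ) where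
  toFun p := ⟨fun x => polyFun p.1 x, (continuous_polyFun p.1).comp continuous_subtype_val⟩
  map_add' p q := by ext x; exact congrFun (polyFun_add p.1 q.1) x
  map_smul' a p := by ext x; exact congrFun (polyFun_smul a p.1) x

lemma ballRestrict_injective (d m : ℕ) : Function.Injective (ballRestrict d m 1) := by
  refine (injective_iff_map_eq_zero _).2 fun p hp => Subtype.ext ?_
  refine eq_zero_of_polyFun_eq_zero (s := closedBall 0 1)
    ⟨0, ball_subset_interior_closedBall (mem_ball_self one_pos)⟩ fun x hx => ?_
  exact congrArg (fun F : C(closedBall (0 : E d) 1, ℝ) => F ⟨x, hx⟩) hp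

lemma abs_polyFun_le_norm_ballRestrict {m : ℕ} {R : ℝ} (p : PolyLE d m) {x : E d}
    (hx : x ∈ closedBall (0 : E d) R) : |polyFun p.1 x| ≤ ‖ballRestrict d m R p‖ :=
  (ballRestrict d m R p).norm_coe_le_norm ⟨x, hx⟩

/-- Derivatives of polynomials on the closed ball of radius `R`. -/
def ballFDeriv (d m : ℕ) (R : ℝ) :
    PolyLE d m →ₗ[ℝ] C(closedBall (0 : E d) R, E d →L[ℝ] ℝ) where
  toFun p := ⟨fun x => fderiv ℝ (polyFun p.1) x,
    (continuous_fderiv_polyFun p.1).comp continuous_subtype_val⟩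
  map_add' p q := by
    ext1 x
    change fderiv ℝ (polyFun (p.1 + q.1)) x = fderiv ℝ (polyFun p.1) x + fderiv ℝ (polyFun q.1) x
    rw [polyFun_add, fderiv_add (differentiable_polyFun _ _) (differentiable_polyFun _ _)]
  map_smul' a p := by
    ext1 x
    change fderiv ℝ (polyFun (a • p.1)) x = a • fderiv ℝ (polyFun p.1) x
    rw [polyFun_smul, fderiv_const_smul (differentiable_polyFun _ _)]

lemma memLp_polyFun (p : MvPolynomial (Fin d) ℝ) (R : ℝ) :
    MemLp (polyFun p) 2 (volume.restrict (closedBall (0 : E d) R)) :=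
  (memLp_two_iff_integrable_sq (continuous_polyFun p).aestronglyMeasurable).2
    (integrableOn_polyFun_sq p (isCompact_closedBall _ _))

/-- Polynomials as square integrable functions on the closed unit ball. -/
def ballToL2 (d m : ℕ) :
    PolyLE d m →ₗ[ℝ] Lp ℝ 2 (volume.restrict (closedBall (0 : E d) 1)) where
  toFun p := (memLp_polyFun p.1 1).toLp _
  map_add' p q := by
    rw [← MemLp.toLp_add]
    exact MemLp.toLp_congr _ _ (.of_forall fun x => congrFun (polyFun_add p.1 q.1) x)
  map_smul' a p := by
    rw [RingHom.id_apply, ← MemLp.toLp_const_smul]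
    exact MemLp.toLp_congr _ _ (.of_forall fun x => congrFun (polyFun_smul a p.1) x)

lemma ballToL2_injective (d m : ℕ) : Function.Injective (ballToL2 d m) := by
  refine (injective_iff_map_eq_zero _).2 fun p hp => Subtype.ext ?_
  refine eq_zero_of_polyFun_eq_zero (s := ball 0 1) ?_ ?_
  · simp only [isOpen_ball.interior_eq, nonempty_ball, one_pos]
  have hae : polyFun p.1 =ᵐ[volume.restrict (closedBall 0 1)] 0 :=
    (memLp_polyFun p.1 1).coeFn_toLp.symm.trans ((Lp.eq_zero_iff_ae_eq_zero).1 hp)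
  exact Measure.eqOn_open_of_ae_eq
    (ae_mono (Measure.restrict_mono ball_subset_closedBall le_rfl) hae) isOpen_ball
    (continuous_polyFun p.1).continuousOn continuousOn_const

lemma norm_ballToL2_sq {m : ℕ} (p : PolyLE d m) :
    ‖ballToL2 d m p‖ ^ 2 = ∫ x in closedBall (0 : E d) 1, polyFun p.1 x ^ 2 := by
  rw [← real_inner_self_eq_norm_sq, L2.inner_def]
  refine integral_congr_ae ?_
  filter_upwards [(memLp_polyFun p.1 1).coeFn_toLp] with x hx
  rw [real_inner_self_eq_norm_sq, Real.norm_eq_abs, sq_abs]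
  exact congrArg (· ^ 2) hx

lemma smul_sub_mem_closedBall {x₀ x : E d} {ρ K : ℝ} (hρ : 0 < ρ)
    (hx : x ∈ closedBall x₀ (K * ρ)) : ρ⁻¹ • (x - x₀) ∈ closedBall (0 : E d) K := by
  rw [mem_closedBall_zero_iff, norm_smul, norm_inv, Real.norm_of_nonneg hρ.le,
    inv_mul_le_iff₀ hρ, mul_comm, ← dist_eq_norm]
  exact hx

lemma add_smul_inv_smul_sub (x₀ x : E d) {ρ : ℝ} (hρ : ρ ≠ 0) :
    x₀ + ρ • ρ⁻¹ • (x - x₀) = x := by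
  rw [smul_inv_smul₀ hρ, add_sub_cancel]

open scoped Pointwise in
lemma setIntegral_closedBall_comp_homothety {F : Type*} [NormedAddCommGroup F] [NormedSpace ℝ F]
    (f : E d → F) (x₀ : E d) {ρ : ℝ} (hρ : 0 < ρ) :
    ∫ y in closedBall (0 : E d) 1, f (x₀ + ρ • y) =
      (ρ ^ d)⁻¹ • ∫ x in closedBall x₀ ρ, f x := by
  have hball : ρ • closedBall (0 : E d) 1 = closedBall (0 : E d) ρ := by
    rw [smul_closedBall' hρ.ne', smul_zero, Real.norm_of_nonneg hρ.le, mul_one]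
  have htrans := (measurePreserving_add_left (volume : Measure (E d)) x₀).setIntegral_preimage_emb
    (MeasurableEquiv.addLeft x₀).measurableEmbedding f (closedBall x₀ ρ)
  rw [Measure.setIntegral_comp_smul_of_pos volume (fun x => f (x₀ + x)) _ hρ,
    finrank_euclideanSpace_fin, hball, ← htrans]
  congr 3
  ext y
  simp

lemma exists_abs_le_sqrt_integral_closedBall (d m : ℕ) (K : ℝ) :
    ∃ C : ℝ, 0 < C ∧ ∀ p : MvPolynomial (Fin d) ℝ, p.totalDegree ≤ m →
      ∀ (x₀ : E d) (ρ : ℝ), 0 < ρ → ∀ x ∈ closedBall x₀ (K * ρ),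
        |polyFun p x| ≤ C * √((ρ ^ d)⁻¹ * ∫ y in closedBall x₀ ρ, polyFun p y ^ 2) := by
  obtain ⟨C, hC, hbound⟩ :=
    exists_norm_le_of_injective _ (ballToL2_injective d m) (ballRestrict d m K)
  refine ⟨C, hC, fun p hp x₀ ρ hρ x hx => ?_⟩
  obtain ⟨q, hq, hqp⟩ := exists_polyFun_comp_homothety p x₀ ρ
  let Q : PolyLE d m := .mk q (hq.trans hp)
  calc |polyFun p x| = |polyFun q (ρ⁻¹ • (x - x₀))| := by
        rw [hqp, add_smul_inv_smul_sub _ _ hρ.ne']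
    _ ≤ ‖ballRestrict d m K Q‖ :=
        abs_polyFun_le_norm_ballRestrict Q (smul_sub_mem_closedBall hρ hx)
    _ ≤ C * ‖ballToL2 d m Q‖ := hbound Q
    _ = C * √(∫ y in closedBall (0 : E d) 1, polyFun p (x₀ + ρ • y) ^ 2) := by
        rw [← Real.sqrt_sq (norm_nonneg (ballToL2 d m Q)), norm_ballToL2_sq]
        simp only [Q, PolyLE.mk, hqp]
    _ = _ := by
        rw [setIntegral_closedBall_comp_homothety (fun y => polyFun p y ^ 2) x₀ hρ, smul_eq_mul]

lemma fderiv_polyFun_of_comp_homothety {p q : MvPolynomial (Fin d) ℝ} {a : E d} {ρ : ℝ}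
    (hqp : ∀ x : E d, polyFun q x = polyFun p (a + ρ • x)) (y : E d) :
    fderiv ℝ (polyFun q) y = ρ • fderiv ℝ (polyFun p) (a + ρ • y) := by
  have hinner : HasFDerivAt (fun z : E d => a + ρ • z) (ρ • ContinuousLinearMap.id ℝ (E d)) y :=
    ((hasFDerivAt_id y).const_smul ρ).const_add a
  have houter := (differentiable_polyFun p (a + ρ • y)).hasFDerivAt
  rw [show polyFun q = polyFun p ∘ fun z => a + ρ • z from funext hqp,
    (houter.comp y hinner).fderiv]
  ext z
  simp

lemma exists_norm_gradient_le_closedBall (d m : ℕ) (K : ℝ) :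
    ∃ C : ℝ, 0 < C ∧ ∀ p : MvPolynomial (Fin d) ℝ, p.totalDegree ≤ m →
      ∀ (x₀ : E d) (ρ : ℝ), 0 < ρ → ∀ A : ℝ, (∀ y ∈ closedBall x₀ ρ, |polyFun p y| ≤ A) →
        ∀ x ∈ closedBall x₀ (K * ρ), ‖gradient (polyFun p) x‖ ≤ C * (A / ρ) := by
  obtain ⟨C, hC, hbound⟩ :=
    exists_norm_le_of_injective (G := C(closedBall (0 : E d) K, E d →L[ℝ] ℝ)) _
      (ballRestrict_injective d m) (ballFDeriv d m K)
  refine ⟨C, hC, fun p hp x₀ ρ hρ A hA x hx => ?_⟩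
  obtain ⟨q, hq, hqp⟩ := exists_polyFun_comp_homothety p x₀ ρ
  let Q : PolyLE d m := .mk q (hq.trans hp)
  set y : E d := ρ⁻¹ • (x - x₀)
  have hsup : ‖ballRestrict d m 1 Q‖ ≤ A := by
    have hA0 : 0 ≤ A := (abs_nonneg _).trans (hA x₀ (mem_closedBall_self hρ.le))
    refine (ContinuousMap.norm_le _ hA0).2 fun z => ?_
    change |polyFun q z| ≤ A
    rw [hqp]
    refine hA _ ?_
    have := mem_closedBall_zero_iff.1 z.2
    rw [mem_closedBall_iff_norm, add_sub_cancel_left, norm_smul, Real.norm_of_nonneg hρ.le]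
    exact mul_le_of_le_one_right hρ.le this
  have hscaled : ρ * ‖fderiv ℝ (polyFun p) x‖ ≤ C * A :=
    calc ρ * ‖fderiv ℝ (polyFun p) x‖ = ‖fderiv ℝ (polyFun q) y‖ := by
          rw [fderiv_polyFun_of_comp_homothety hqp, add_smul_inv_smul_sub _ _ hρ.ne', norm_smul,
            Real.norm_of_nonneg hρ.le]
      _ ≤ ‖ballFDeriv d m K Q‖ :=
          (ballFDeriv d m K Q).norm_coe_le_norm ⟨y, smul_sub_mem_closedBall hρ hx⟩
      _ ≤ C * ‖ballRestrict d m 1 Q‖ := hbound Q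
      _ ≤ C * A := by gcongr
  rw [norm_gradient, ← mul_div_assoc, le_div_iff₀ hρ, mul_comm]
  exact hscaled

end Polynomials

/-! ### Simplices -/

section Simplices

open Metric

lemma exists_coord_of_mem_convexHull_range {V : Type*} [AddCommGroup V] [Module ℝ V] {n : ℕ}
    (p : Fin (n + 1) → V) {x : V} (hx : x ∈ convexHull ℝ (Set.range p)) :
    ∃ y ∈ closedBall (0 : E n) 1, p 0 + ∑ j, y j • (p j.succ - p 0) = x := by
  have himage : convexHull ℝ (Set.range p) =
      Fintype.linearCombination ℝ p '' stdSimplex ℝ (Fin (n + 1)) := by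
    rw [← convexHull_rangle_single_eq_stdSimplex, LinearMap.image_convexHull, ← Set.range_comp]
    congr 2
    ext i
    simp [Fintype.linearCombination_apply_single]
  rw [himage] at hx
  obtain ⟨w, ⟨hw0, hw1⟩, rfl⟩ := hx
  rw [Fin.sum_univ_succ] at hw1
  have hle : ∀ j : Fin n, w j.succ ≤ 1 := fun j => by
    have := Finset.single_le_sum (fun i _ => hw0 (Fin.succ i)) (Finset.mem_univ j)
    linarith [hw0 0]
  refine ⟨WithLp.toLp 2 fun j => w j.succ, ?_, ?_⟩
  · rw [mem_closedBall_zero_iff, ← sq_le_one_iff₀ (norm_nonneg _), EuclideanSpace.real_norm_sq_eq]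
    calc ∑ j : Fin n, w j.succ ^ 2 ≤ ∑ j : Fin n, w j.succ :=
          Finset.sum_le_sum fun j _ => pow_le_of_le_one (hw0 _) (hle j) two_ne_zero
      _ ≤ 1 := by linarith [hw0 0]
  · rw [Fintype.linearCombination_apply, Fin.sum_univ_succ, eq_sub_of_add_eq hw1]
    simp only [smul_sub, Finset.sum_sub_distrib, sub_smul, one_smul, Finset.sum_smul]
    abel

lemma euclideanHausdorffMeasure_image_le {Y Z : Type*} [MetricSpace Y] [MeasurableSpace Y]
    [BorelSpace Y] [MetricSpace Z] [MeasurableSpace Z] [BorelSpace Z] {L : NNReal} {g : Y → Z}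
    (hg : LipschitzWith L g) (n : ℕ) (s : Set Y) :
    μHE[n] (g '' s) ≤ (L : ENNReal) ^ n * μHE[n] s := by
  have hle := hg.hausdorffMeasure_image_le (d := n) n.cast_nonneg s
  rw [ENNReal.rpow_natCast] at hle
  simp only [Measure.euclideanHausdorffMeasure_def, Measure.smul_apply, ENNReal.smul_def,
    smul_eq_mul]
  rw [mul_left_comm]
  gcongr

lemma exists_hausdorff_convexHull_le (n : ℕ) (V : Type*) [NormedAddCommGroup V] [NormedSpace ℝ V]
    [MeasurableSpace V] [BorelSpace V] :
    ∃ C : ℝ, 0 < C ∧ ∀ (p : Fin (n + 1) → V) (D : ℝ), (∀ i j, dist (p i) (p j) ≤ D) →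
      μHE[n] (convexHull ℝ (Set.range p)) ≤ ENNReal.ofReal (C * D ^ n) := by
  set B : Set (E n) := closedBall 0 1
  have hB : volume B ≠ ⊤ := measure_closedBall_lt_top.ne
  refine ⟨n ^ n * (volume B).toReal + 1, by positivity, fun p D hp => ?_⟩
  have hD : 0 ≤ D := dist_nonneg.trans (hp 0 0)
  let g : E n → V := fun y => p 0 + ∑ j, y j • (p j.succ - p 0)
  have hg : LipschitzWith (n * D).toNNReal g := by
    refine LipschitzWith.of_dist_le_mul fun y z => ?_
    have hsub : g y - g z = ∑ j, (y j - z j) • (p j.succ - p 0) := by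
      simp only [g, sub_smul, Finset.sum_sub_distrib]; abel
    rw [Real.coe_toNNReal _ (by positivity), dist_eq_norm, dist_eq_norm, hsub]
    calc ‖∑ j, (y j - z j) • (p j.succ - p 0)‖ ≤ ∑ _j : Fin n, ‖y - z‖ * D := by
          refine norm_sum_le_of_le _ fun j _ => ?_
          rw [norm_smul, ← dist_eq_norm (p j.succ)]
          exact mul_le_mul (PiLp.norm_apply_le (y - z) j) (hp _ _) dist_nonneg (norm_nonneg _)
      _ = n * D * ‖y - z‖ := by
          rw [Finset.sum_const, Finset.card_fin, nsmul_eq_mul]; ring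
  have hsub : convexHull ℝ (Set.range p) ⊆ g '' B := fun x hx =>
    exists_coord_of_mem_convexHull_range p hx
  calc μHE[n] (convexHull ℝ (Set.range p))
      ≤ ((n * D).toNNReal : ENNReal) ^ n * μHE[n] B :=
        (measure_mono hsub).trans (euclideanHausdorffMeasure_image_le hg n B)
    _ = ENNReal.ofReal (n ^ n * (volume B).toReal * D ^ n) := by
        rw [EuclideanSpace.euclideanHausdorffMeasure_eq_volume, ← ENNReal.ofReal_toReal hB]
        change ENNReal.ofReal _ ^ n * _ = _
        rw [← ENNReal.ofReal_pow (by positivity), ← ENNReal.ofReal_mul (by positivity),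
          ENNReal.toReal_ofReal ENNReal.toReal_nonneg]
        congr 1; ring
    _ ≤ ENNReal.ofReal ((n ^ n * (volume B).toReal + 1) * D ^ n) := by
        gcongr
        linarith

variable {d : ℕ} (s : Affine.Simplex ℝ (E d) d)

lemma convex_cellOf : Convex ℝ (cellOf s) :=
  convex_convexHull ℝ _

lemma isCompact_cellOf : IsCompact (cellOf s) :=
  (Set.finite_range _).isCompact_convexHull ℝ

lemma isClosed_cellOf : IsClosed (cellOf s) :=
  (isCompact_cellOf s).isClosed

lemma isCompact_facetOf (m : Fin (d + 1)) : IsCompact (facetOf s m) :=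
  (Set.toFinite _).isCompact_convexHull ℝ

lemma point_mem_cellOf (m : Fin (d + 1)) : s.points m ∈ cellOf s :=
  subset_convexHull ℝ _ ⟨m, rfl⟩

lemma dist_le_diam_cellOf {x y : E d} (hx : x ∈ cellOf s) (hy : y ∈ cellOf s) :
    dist x y ≤ diam (cellOf s) :=
  dist_le_diam_of_mem (isCompact_cellOf s).isBounded hx hy

lemma affineSpan_points : affineSpan ℝ (Set.range s.points) = ⊤ := by
  rw [s.independent.affineSpan_eq_top_iff_card_eq_finrank_add_one]
  simp

lemma interior_cellOf_nonempty : (interior (cellOf s)).Nonempty :=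
  interior_convexHull_nonempty_iff_affineSpan_eq_top.2 (affineSpan_points s)

lemma closure_interior_cellOf : closure (interior (cellOf s)) = cellOf s := by
  rw [(convex_cellOf s).closure_interior_eq_closure_of_nonempty_interior
    (interior_cellOf_nonempty s), (isClosed_cellOf s).closure_eq]

lemma refPoint_mem_cellOf (x : Fin d → ℝ) (h0 : ∀ j, 0 ≤ x j) (h1 : ∑ j, x j ≤ 1) :
    refPoint s x ∈ cellOf s := by
  refine mem_convexHull_of_exists_fintype (Fin.cons (1 - ∑ j, x j) x) s.points ?_ ?_
    (fun i => ⟨i, rfl⟩) ?_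
  · refine Fin.cases ?_ fun j => ?_
    · simpa using h1
    · simpa using h0 j
  · simp [Fin.sum_univ_succ]
  · simp only [Fin.sum_univ_succ, Fin.cons_zero, Fin.cons_succ, refPoint, smul_sub,
      Finset.sum_sub_distrib, sub_smul, one_smul, Finset.sum_smul]
    abel

lemma frontier_cellOf_subset : frontier (cellOf s) ⊆ ⋃ m, facetOf s m := by
  let b : AffineBasis (Fin (d + 1)) ℝ (E d) := ⟨s.points, s.independent, affineSpan_points s⟩
  have hcell : cellOf s = convexHull ℝ (Set.range b) := rfl
  intro x hx
  rw [(isClosed_cellOf s).frontier_eq, hcell, b.interior_convexHull,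
    b.convexHull_eq_nonneg_coord] at hx
  obtain ⟨hnonneg, hnotpos⟩ := hx
  obtain ⟨m, hm⟩ := not_forall.1 hnotpos
  have hzero : b.coord m x = 0 := le_antisymm (not_lt.1 hm) (hnonneg m)
  have hsum := b.sum_coord_apply_eq_one x
  have hcomb := b.linear_combination_coord_eq_self x
  rw [Fintype.sum_eq_add_sum_compl m, hzero, zero_add] at hsum
  rw [Fintype.sum_eq_add_sum_compl m, hzero, zero_smul, zero_add] at hcomb
  rw [← hcomb]
  refine Set.mem_iUnion.2 ⟨m, (convex_convexHull ℝ _).sum_mem (fun i _ => hnonneg i) hsum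
    fun i hi => subset_convexHull ℝ _ ⟨i, by simpa using hi, rfl⟩⟩

lemma exists_facetOf_eq_convexHull_range (hd : 1 ≤ d) (m : Fin (d + 1)) :
    ∃ p : Fin (d - 1 + 1) → E d,
      (∀ j, p j ∈ cellOf s) ∧ facetOf s m = convexHull ℝ (Set.range p) := by
  obtain ⟨n, rfl⟩ := Nat.exists_eq_add_of_le' hd
  refine ⟨fun j => s.points (m.succAbove j), fun j => point_mem_cellOf s _, ?_⟩
  rw [facetOf, ← Fin.range_succAbove, ← Set.range_comp]
  rfl

lemma exists_hausdorff_frontier_cellOf_le (hd : 1 ≤ d) : ∃ C : ℝ, 0 < C ∧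
    ∀ s : Affine.Simplex ℝ (E d) d, μHE[d - 1] (frontier (cellOf s)) ≤
      ENNReal.ofReal (C * diam (cellOf s) ^ (d - 1)) := by
  obtain ⟨C, hC, hhull⟩ := exists_hausdorff_convexHull_le (d - 1) (E d)
  refine ⟨(d + 1) * C, by positivity, fun s => ?_⟩
  have hfacet : ∀ m, μHE[d - 1] (facetOf s m) ≤
      ENNReal.ofReal (C * diam (cellOf s) ^ (d - 1)) := fun m => by
    obtain ⟨p, hp, heq⟩ := exists_facetOf_eq_convexHull_range s hd m
    rw [heq]
    exact hhull p _ fun i j => dist_le_diam_cellOf s (hp i) (hp j)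
  calc μHE[d - 1] (frontier (cellOf s)) ≤ ∑ m, μHE[d - 1] (facetOf s m) :=
        (measure_mono (frontier_cellOf_subset s)).trans (measure_iUnion_fintype_le _ _)
    _ ≤ ∑ _m : Fin (d + 1), ENNReal.ofReal (C * diam (cellOf s) ^ (d - 1)) :=
        Finset.sum_le_sum fun m _ => hfacet m
    _ = ENNReal.ofReal ((d + 1) * C * diam (cellOf s) ^ (d - 1)) := by
        rw [Finset.sum_const, nsmul_eq_mul, Finset.card_fin, ← ENNReal.ofReal_natCast,
          ← ENNReal.ofReal_mul (Nat.cast_nonneg _), mul_assoc, Nat.cast_succ]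

lemma diam_cellOf_pos (hd : 1 ≤ d) : 0 < diam (cellOf s) := by
  have hne : (0 : Fin (d + 1)) ≠ Fin.last d := by
    rw [Ne, Fin.ext_iff, Fin.val_zero, Fin.val_last]; omega
  exact (dist_pos.2 (s.independent.injective.ne hne)).trans_le
    (dist_le_diam_cellOf s (point_mem_cellOf s _) (point_mem_cellOf s _))

lemma eq_range_points_of_affineSpan_eq_top {A : Set (E d)} (hA : A ⊆ Set.range s.points)
    (hspan : affineSpan ℝ A = ⊤) : A = Set.range s.points := by
  obtain ⟨B, rfl⟩ := Set.subset_range_iff_exists_image_eq.1 hA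
  refine hA.antisymm ?_
  rintro _ ⟨m, rfl⟩
  refine ⟨m, (s.independent.mem_affineSpan_iff m B).1 ?_, rfl⟩
  rw [hspan]
  trivial

lemma Mesh.disjoint_interior_cell (T : Mesh d) {i j : Fin T.numElem} (hij : i ≠ j) :
    Disjoint (interior (T.cell i)) (interior (T.cell j)) := by
  have hinter : T.cell i ∩ T.cell j = _ := T.conforming i j
  rw [Set.disjoint_iff_inter_eq_empty, ← interior_inter, hinter]
  by_contra hne
  have hspan := interior_convexHull_nonempty_iff_affineSpan_eq_top.1
    (Set.nonempty_iff_ne_empty.2 hne)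
  exact hij (T.elem_injective
    ((eq_range_points_of_affineSpan_eq_top _ Set.inter_subset_left hspan).symm.trans
      (eq_range_points_of_affineSpan_eq_top _ Set.inter_subset_right hspan)))

end Simplices

/-! ### Polynomials on a shape-regular element -/

section ElementEstimates

open Metric

variable {d m : ℕ}

lemma abs_polyFun_sub_le (s : Affine.Simplex ℝ (E d) d) {f : MvPolynomial (Fin d) ℝ} {B : ℝ}
    (hB : ∀ y ∈ interior (cellOf s), ‖gradient (polyFun f) y‖ ≤ B) {x y : E d}
    (hx : x ∈ cellOf s) (hy : y ∈ cellOf s) :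
    |polyFun f x - polyFun f y| ≤ B * diam (cellOf s) := by
  have hfderiv : ∀ z ∈ cellOf s, ‖fderiv ℝ (polyFun f) z‖ ≤ B := by
    have hclosed : IsClosed {z | ‖fderiv ℝ (polyFun f) z‖ ≤ B} :=
      isClosed_le (continuous_fderiv_polyFun f).norm continuous_const
    have hsub : interior (cellOf s) ⊆ {z | ‖fderiv ℝ (polyFun f) z‖ ≤ B} := fun z hz =>
      (norm_gradient _ _).symm.trans_le (hB z hz)
    have hclosure := hclosed.closure_subset_iff.2 hsub
    rwa [closure_interior_cellOf] at hclosure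
  calc |polyFun f x - polyFun f y| ≤ B * ‖x - y‖ :=
        (convex_cellOf s).norm_image_sub_le_of_norm_fderiv_le (𝕜 := ℝ)
          (fun z _ => differentiable_polyFun f z) hfderiv hy hx
    _ ≤ B * diam (cellOf s) := by
        rw [← dist_eq_norm]
        exact mul_le_mul_of_nonneg_left (dist_le_diam_cellOf s hx hy)
          ((norm_nonneg _).trans (hfderiv x hx))

/-- The values of a polynomial of degree at most `m` at the reference nodes. -/
def nodalEval (m : ℕ) (X : Finset (Fin d → ℝ)) : PolyLE d m →ₗ[ℝ] (X → ℝ) where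
  toFun p x := MvPolynomial.eval x.1 p.1
  map_add' p q := by ext; simp
  map_smul' a p := by ext; simp

lemma nodalEval_injective {X : Finset (Fin d → ℝ)} (hX : IsReferenceNodeSet m X) :
    Function.Injective (nodalEval m X) := by
  refine (injective_iff_map_eq_zero _).2 fun p hp => Subtype.ext ?_
  obtain ⟨_, _, hunique⟩ := hX.2 0
  have hp0 := hunique p.1 ⟨(MvPolynomial.mem_restrictTotalDegree _ _ _).1 p.2,
    fun x hx => congrFun hp ⟨x, hx⟩⟩
  have h0 := hunique 0 ⟨by simp, fun x _ => by simp⟩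
  exact hp0.trans h0.symm

lemma exists_abs_le_nodal {X : Finset (Fin d → ℝ)} (hX : IsReferenceNodeSet m X) :
    ∃ C : ℝ, 0 < C ∧ ∀ (s : Affine.Simplex ℝ (E d) d) (f : MvPolynomial (Fin d) ℝ),
      f.totalDegree ≤ m → ∀ A : ℝ, 0 ≤ A → (∀ ξ ∈ X, |polyFun f (refPoint s ξ)| ≤ A) →
        ∀ y ∈ cellOf s, |polyFun f y| ≤ C * A := by
  obtain ⟨C, hC, hbound⟩ := exists_norm_le_of_injective (G := C(closedBall (0 : E d) 1, ℝ)) _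
    (nodalEval_injective hX) (ballRestrict d m 1)
  refine ⟨C, hC, fun s f hf A hA hnodes y hy => ?_⟩
  obtain ⟨x, hx, rfl⟩ := exists_coord_of_mem_convexHull_range s.points hy
  obtain ⟨q, hq, hqf⟩ := exists_polyFun_comp_affine f (s.points 0)
    fun j : Fin d => s.points j.succ - s.points 0
  let Q : PolyLE d m := .mk q (hq.trans hf)
  have hQ : ‖nodalEval m X Q‖ ≤ A :=
    (pi_norm_le_iff_of_nonneg hA).2 fun ξ => (congrArg abs (hqf (WithLp.toLp 2 ξ.1))).trans_le
      (hnodes ξ.1 ξ.2)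
  calc |polyFun f (s.points 0 + ∑ j, x j • (s.points j.succ - s.points 0))| = |polyFun q x| := by
        rw [hqf]
    _ ≤ ‖ballRestrict d m 1 Q‖ := abs_polyFun_le_norm_ballRestrict Q hx
    _ ≤ C * ‖nodalEval m X Q‖ := hbound Q
    _ ≤ C * A := by gcongr

lemma eq_zero_of_nodal_eq_zero {X : Finset (Fin d → ℝ)} (hX : IsReferenceNodeSet m X)
    (s : Affine.Simplex ℝ (E d) d) {f : MvPolynomial (Fin d) ℝ} (hf : f.totalDegree ≤ m)
    (h : ∀ ξ ∈ X, polyFun f (refPoint s ξ) = 0) : f = 0 := by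
  obtain ⟨C, -, hC⟩ := exists_abs_le_nodal hX
  refine eq_zero_of_polyFun_eq_zero (interior_cellOf_nonempty s) fun y hy => ?_
  simpa using hC s f hf 0 le_rfl (fun ξ hξ => by simp [h ξ hξ]) y hy

/-- The element `s` contains a ball of radius `ρ` and has diameter at most `K * ρ`. -/
structure HasInball (K : ℝ) (s : Affine.Simplex ℝ (E d) d) (ρ : ℝ) : Prop where
  pos : 0 < ρ
  diam_le : diam (cellOf s) ≤ K * ρ
  exists_closedBall_subset : ∃ x₀, closedBall x₀ ρ ⊆ cellOf s

namespace HasInball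

variable {K ρ : ℝ} {s : Affine.Simplex ℝ (E d) d}

lemma exists_sandwich (h : HasInball K s ρ) :
    ∃ x₀, closedBall x₀ ρ ⊆ cellOf s ∧ cellOf s ⊆ closedBall x₀ (K * ρ) := by
  obtain ⟨x₀, hball⟩ := h.exists_closedBall_subset
  exact ⟨x₀, hball, fun y hy =>
    (dist_le_diam_cellOf s hy (hball (mem_closedBall_self h.pos.le))).trans h.diam_le⟩

lemma volume_cellOf_le (h : HasInball K s ρ) :
    volume.real (cellOf s) ≤ volume.real (ball (0 : E d) 1) * (K * ρ) ^ d := by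
  obtain ⟨x₀, -, hcell⟩ := h.exists_sandwich
  have hK : 0 ≤ K * ρ := diam_nonneg.trans h.diam_le
  calc volume.real (cellOf s) ≤ volume.real (closedBall x₀ (K * ρ)) :=
        measureReal_mono hcell measure_closedBall_lt_top.ne
    _ = volume.real (ball (0 : E d) 1) * (K * ρ) ^ d := by
        rw [measureReal_def, Measure.addHaar_closedBall _ _ hK, finrank_euclideanSpace_fin,
          ENNReal.toReal_mul, ENNReal.toReal_ofReal (by positivity), mul_comm, measureReal_def]

lemma setIntegral_cellOf_le (h : HasInball K s ρ) {u : E d → ℝ} {b : ℝ}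
    (hu : ∀ y ∈ cellOf s, |u y| ≤ (ρ ^ d)⁻¹ * b) :
    ∫ y in cellOf s, u y ≤ volume.real (ball (0 : E d) 1) * K ^ d * b := by
  obtain ⟨x, hx⟩ := (interior_cellOf_nonempty s).mono interior_subset
  have hρ := h.pos
  calc ∫ y in cellOf s, u y ≤ (ρ ^ d)⁻¹ * b * volume.real (cellOf s) :=
        (Real.le_norm_self _).trans (norm_setIntegral_le_of_norm_le_const
          (isCompact_cellOf s).measure_lt_top hu)
    _ ≤ (ρ ^ d)⁻¹ * b * (volume.real (ball (0 : E d) 1) * (K * ρ) ^ d) :=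
        mul_le_mul_of_nonneg_left h.volume_cellOf_le ((abs_nonneg _).trans (hu x hx))
    _ = volume.real (ball (0 : E d) 1) * K ^ d * b := by
        rw [mul_pow]; field_simp

end HasInball

lemma exists_abs_le_sqrt_integral_cellOf (d m : ℕ) (K : ℝ) :
    ∃ C : ℝ, 0 < C ∧ ∀ (s : Affine.Simplex ℝ (E d) d) (ρ : ℝ), HasInball K s ρ →
      ∀ f : MvPolynomial (Fin d) ℝ, f.totalDegree ≤ m → ∀ y ∈ cellOf s,
        |polyFun f y| ≤ C * √((ρ ^ d)⁻¹ * ∫ y in cellOf s, polyFun f y ^ 2) := by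
  obtain ⟨C, hC, hbound⟩ := exists_abs_le_sqrt_integral_closedBall d m K
  refine ⟨C, hC, fun s ρ hs f hf y hy => ?_⟩
  obtain ⟨x₀, hball, hcell⟩ := hs.exists_sandwich
  have hρ := hs.pos
  refine (hbound f hf x₀ ρ hρ y (hcell hy)).trans ?_
  gcongr C * √(_ * ?_)
  exact setIntegral_mono_set (integrableOn_polyFun_sq f (isCompact_cellOf s))
    (Filter.Eventually.of_forall fun _ => sq_nonneg _) hball.eventuallyLE

/-- At the nodes of `s`, the polynomial `f` is bounded by `θ` times the polynomial `g`. -/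
def NodallyLE (X : Finset (Fin d → ℝ)) (s : Affine.Simplex ℝ (E d) d) (θ : ℝ)
    (f g : MvPolynomial (Fin d) ℝ) : Prop :=
  ∀ ξ ∈ X, |polyFun f (refPoint s ξ)| ≤ θ * |polyFun g (refPoint s ξ)|

variable {X : Finset (Fin d → ℝ)}

lemma exists_abs_le_of_nodallyLE (hX : IsReferenceNodeSet m X) (K : ℝ) :
    ∃ C : ℝ, 0 < C ∧ ∀ (s : Affine.Simplex ℝ (E d) d) (ρ : ℝ), HasInball K s ρ →
      ∀ f g : MvPolynomial (Fin d) ℝ, f.totalDegree ≤ m → g.totalDegree ≤ m → ∀ θ : ℝ, 0 ≤ θ →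
        NodallyLE X s θ f g → ∀ y ∈ cellOf s,
          |polyFun f y| ≤ C * θ * √((ρ ^ d)⁻¹ * ∫ y in cellOf s, polyFun g y ^ 2) := by
  obtain ⟨C₁, hC₁, hinverse⟩ := exists_abs_le_sqrt_integral_cellOf d m K
  obtain ⟨C₂, hC₂, hnodal⟩ := exists_abs_le_nodal hX
  refine ⟨C₂ * C₁, by positivity, fun s ρ hs f g hf hg θ hθ hfg y hy => ?_⟩
  set Q : ℝ := √((ρ ^ d)⁻¹ * ∫ y in cellOf s, polyFun g y ^ 2)
  have hnodes : ∀ ξ ∈ X, |polyFun f (refPoint s ξ)| ≤ θ * (C₁ * Q) := fun ξ hξ =>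
    (hfg ξ hξ).trans (mul_le_mul_of_nonneg_left (hinverse s ρ hs g hg _
      (refPoint_mem_cellOf s ξ (hX.1 ξ hξ).1 (hX.1 ξ hξ).2)) hθ)
  calc |polyFun f y| ≤ C₂ * (θ * (C₁ * Q)) := hnodal s f hf _ (by positivity) hnodes y hy
    _ = C₂ * C₁ * θ * Q := by ring

lemma exists_integral_sq_le_of_nodallyLE (hX : IsReferenceNodeSet m X) {K : ℝ} (hK : 0 ≤ K) :
    ∃ C : ℝ, 0 < C ∧ ∀ (s : Affine.Simplex ℝ (E d) d) (ρ : ℝ), HasInball K s ρ →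
      ∀ f g : MvPolynomial (Fin d) ℝ, f.totalDegree ≤ m → g.totalDegree ≤ m → ∀ θ : ℝ, 0 ≤ θ →
        NodallyLE X s θ f g →
          ∫ y in cellOf s, polyFun f y ^ 2 ≤ C * θ ^ 2 * ∫ y in cellOf s, polyFun g y ^ 2 := by
  obtain ⟨C, hC, hbound⟩ := exists_abs_le_of_nodallyLE hX K
  set ω : ℝ := volume.real (ball (0 : E d) 1)
  refine ⟨(ω * K ^ d + 1) * C ^ 2, by positivity, fun s ρ hs f g hf hg θ hθ hfg => ?_⟩
  have hρ := hs.pos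
  set I : ℝ := ∫ y in cellOf s, polyFun g y ^ 2
  have : 0 ≤ I := integral_nonneg fun _ => sq_nonneg _
  have hpointwise : ∀ y ∈ cellOf s, |polyFun f y ^ 2| ≤ (ρ ^ d)⁻¹ * ((C * θ) ^ 2 * I) := by
    intro y hy
    calc |polyFun f y ^ 2| = |polyFun f y| ^ 2 := abs_pow _ _
      _ ≤ (C * θ * √((ρ ^ d)⁻¹ * I)) ^ 2 := by
          gcongr
          exact hbound s ρ hs f g hf hg θ hθ hfg y hy
      _ = (ρ ^ d)⁻¹ * ((C * θ) ^ 2 * I) := by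
          rw [mul_pow _ √_, Real.sq_sqrt (by positivity)]; ring
  calc ∫ y in cellOf s, polyFun f y ^ 2 ≤ ω * K ^ d * ((C * θ) ^ 2 * I) :=
        hs.setIntegral_cellOf_le hpointwise
    _ ≤ (ω * K ^ d + 1) * ((C * θ) ^ 2 * I) := by gcongr; linarith
    _ = (ω * K ^ d + 1) * C ^ 2 * θ ^ 2 * I := by ring

lemma exists_integral_gradient_sq_le_of_nodallyLE (hX : IsReferenceNodeSet m X) {K : ℝ}
    (hK : 0 ≤ K) :
    ∃ C : ℝ, 0 < C ∧ ∀ (s : Affine.Simplex ℝ (E d) d) (ρ : ℝ), HasInball K s ρ →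
      ∀ f g : MvPolynomial (Fin d) ℝ, f.totalDegree ≤ m → g.totalDegree ≤ m → ∀ θ : ℝ, 0 ≤ θ →
        NodallyLE X s θ f g → ∫ y in cellOf s, ‖gradient (polyFun f) y‖ ^ 2 ≤
          C * (θ / ρ) ^ 2 * ∫ y in cellOf s, polyFun g y ^ 2 := by
  obtain ⟨C₁, hC₁, hbound⟩ := exists_abs_le_of_nodallyLE hX K
  obtain ⟨C₂, hC₂, hgradient⟩ := exists_norm_gradient_le_closedBall d m K
  set ω : ℝ := volume.real (ball (0 : E d) 1)
  refine ⟨(ω * K ^ d + 1) * (C₂ * C₁) ^ 2, by positivity, fun s ρ hs f g hf hg θ hθ hfg => ?_⟩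
  have hρ := hs.pos
  obtain ⟨x₀, hball, hcell⟩ := hs.exists_sandwich
  set I : ℝ := ∫ y in cellOf s, polyFun g y ^ 2
  have : 0 ≤ I := integral_nonneg fun _ => sq_nonneg _
  set A : ℝ := C₁ * θ * √((ρ ^ d)⁻¹ * I)
  have hpointwise : ∀ y ∈ cellOf s,
      |‖gradient (polyFun f) y‖ ^ 2| ≤ (ρ ^ d)⁻¹ * ((C₂ * C₁ * (θ / ρ)) ^ 2 * I) := by
    intro y hy
    calc |‖gradient (polyFun f) y‖ ^ 2| = ‖gradient (polyFun f) y‖ ^ 2 :=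
          abs_of_nonneg (sq_nonneg _)
      _ ≤ (C₂ * (A / ρ)) ^ 2 := by
          gcongr
          exact hgradient f hf x₀ ρ hρ A
            (fun z hz => hbound s ρ hs f g hf hg θ hθ hfg z (hball hz)) y (hcell hy)
      _ = (C₂ * C₁ * (θ / ρ) * √((ρ ^ d)⁻¹ * I)) ^ 2 := by simp only [A]; ring
      _ = (ρ ^ d)⁻¹ * ((C₂ * C₁ * (θ / ρ)) ^ 2 * I) := by
          rw [mul_pow _ √_, Real.sq_sqrt (by positivity)]; ring
  calc ∫ y in cellOf s, ‖gradient (polyFun f) y‖ ^ 2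
      ≤ ω * K ^ d * ((C₂ * C₁ * (θ / ρ)) ^ 2 * I) := hs.setIntegral_cellOf_le hpointwise
    _ ≤ (ω * K ^ d + 1) * ((C₂ * C₁ * (θ / ρ)) ^ 2 * I) := by gcongr; linarith
    _ = (ω * K ^ d + 1) * (C₂ * C₁) ^ 2 * (θ / ρ) ^ 2 * I := by ring

lemma abs_setIntegral_le_sum {α ι : Type*} [MeasurableSpace α] {μ : Measure α} (F : Finset ι)
    {s : Set α} {t : ι → Set α} (hs : s ⊆ ⋃ i ∈ F, t i) {f : α → ℝ} {b v : ι → ℝ}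
    (hsm : MeasurableSet s) (htm : ∀ i ∈ F, MeasurableSet (t i)) (hb : ∀ i ∈ F, 0 ≤ b i)
    (hf : ∀ i ∈ F, ∀ x ∈ s ∩ t i, |f x| ≤ b i) (hv : ∀ i ∈ F, 0 ≤ v i)
    (hμ : ∀ i ∈ F, μ (t i) ≤ ENNReal.ofReal (v i)) :
    |∫ x in s, f x ∂μ| ≤ ∑ i ∈ F, b i * v i := by
  have hcover : s = ⋃ i ∈ F, s ∩ t i := by rw [← Set.inter_iUnion₂, Set.inter_eq_left.2 hs]
  have hpiece : ∀ i ∈ F, ∫⁻ x in s ∩ t i, ‖f x‖ₑ ∂μ ≤ ENNReal.ofReal (b i * v i) := fun i hi =>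
    calc ∫⁻ x in s ∩ t i, ‖f x‖ₑ ∂μ ≤ ∫⁻ _ in s ∩ t i, ENNReal.ofReal (b i) ∂μ :=
          setLIntegral_mono' (hsm.inter (htm i hi)) fun x hx => by
            rw [← ofReal_norm]
            exact ENNReal.ofReal_le_ofReal (hf i hi x hx)
      _ ≤ ENNReal.ofReal (b i) * ENNReal.ofReal (v i) := by
          rw [setLIntegral_const]
          gcongr
          exact (measure_mono Set.inter_subset_right).trans (hμ i hi)
      _ = ENNReal.ofReal (b i * v i) := (ENNReal.ofReal_mul (hb i hi)).symm
  have hbv : ∀ i ∈ F, 0 ≤ b i * v i := fun i hi => mul_nonneg (hb i hi) (hv i hi)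
  rw [← Real.norm_eq_abs, ← ENNReal.ofReal_le_ofReal_iff (Finset.sum_nonneg hbv), ofReal_norm,
    ENNReal.ofReal_sum_of_nonneg hbv]
  calc ‖∫ x in s, f x ∂μ‖ₑ ≤ ∫⁻ x in ⋃ i ∈ F, s ∩ t i, ‖f x‖ₑ ∂μ := by
        rw [← hcover]
        exact enorm_integral_le_lintegral_enorm _
    _ ≤ ∑ i ∈ F, ∫⁻ x in s ∩ t i, ‖f x‖ₑ ∂μ := by
        rw [← Finset.tsum_subtype F fun i => ∫⁻ x in s ∩ t i, ‖f x‖ₑ ∂μ,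
          ← Set.iUnion_subtype (· ∈ F) fun i => s ∩ t i]
        exact lintegral_iUnion_le _ _
    _ ≤ ∑ i ∈ F, ENNReal.ofReal (b i * v i) := Finset.sum_le_sum hpiece

end ElementEstimates

/-! ### The abstract Schwarz argument -/

section Schwarz

open LinearMap (BilinMap)

variable {V ι J : Type*} [AddCommGroup V] [Module ℝ V]

/-- What the Schwarz analysis needs to know about one subdomain: `n i` is the energy seminorm on
the element `i`, `F` is the set of elements of the subdomain, `T` is multiplication by the
partition-of-unity function (followed by interpolation), `c i` is a value of this function on the
element `i`, and `a` is the local form, with coercivity constant `γ`. The parameter `σ` bounds the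
oscillation of the partition-of-unity function relative to the wavelength. -/
structure IsWeightedLocalForm (n : ι → Seminorm ℝ V) (F : Finset ι) (T : V →ₗ[ℝ] V) (c : ι → ℝ)
    (a : BilinMap ℝ V ℂ) (σ γ : ℝ) : Prop where
  weight_nonneg : ∀ i, 0 ≤ c i
  weight_eq_zero : ∀ i ∉ F, c i = 0
  seminorm_sub_le : ∀ i v, n i (T v - c i • v) ≤ σ * n i v
  seminorm_eq_zero : ∀ i ∉ F, ∀ v, n i (T v) = 0
  commutator_le : ∀ v w, ‖a (T v) w - a v (T w)‖ ≤ σ * ∑ i ∈ F, n i v * n i w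
  coercive : ∀ v, γ * ∑ i ∈ F, n i v ^ 2 ≤ ‖a v v‖
  weighted_coercive : ∀ v, γ * ∑ i ∈ F, c i * n i v ^ 2 ≤ ‖a v (T v)‖ + σ * ∑ i ∈ F, n i v ^ 2

lemma two_mul_sum_mul_le (F : Finset ι) {w : ι → ℝ} (hw : ∀ i, 0 ≤ w i) (x y : ι → ℝ) (t : ℝ) :
    2 * t * ∑ i ∈ F, w i * (x i * y i) ≤
      t ^ 2 * ∑ i ∈ F, w i * x i ^ 2 + ∑ i ∈ F, w i * y i ^ 2 := by
  simp only [Finset.mul_sum, ← Finset.sum_add_distrib]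
  exact Finset.sum_le_sum fun i _ => by
    nlinarith [mul_nonneg (hw i) (sq_nonneg (t * x i - y i))]

namespace IsWeightedLocalForm

variable {n : ι → Seminorm ℝ V} {F : Finset ι} {T : V →ₗ[ℝ] V} {c : ι → ℝ} {a : BilinMap ℝ V ℂ}
  {σ γ : ℝ}

lemma seminorm_le (h : IsWeightedLocalForm n F T c a σ γ) (i : ι) (w : V) :
    n i (T w) ≤ (c i + σ) * n i w := by
  calc n i (T w) = n i (T w - c i • w + c i • w) := by rw [sub_add_cancel]
    _ ≤ n i (T w - c i • w) + n i (c i • w) := map_add_le_add _ _ _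
    _ ≤ σ * n i w + c i * n i w := by
        rw [map_smul_eq_mul, Real.norm_of_nonneg (h.weight_nonneg i)]
        gcongr
        exact h.seminorm_sub_le i w
    _ = (c i + σ) * n i w := by ring

lemma seminorm_comp_sub_le (h : IsWeightedLocalForm n F T c a σ γ) (hσ : 0 ≤ σ) (i : ι) (v : V) :
    n i (T (T v) - c i ^ 2 • v) ≤ (2 * c i * σ + σ ^ 2) * n i v := by
  have hc := h.weight_nonneg i
  calc n i (T (T v) - c i ^ 2 • v)
      = n i (T (T v) - c i • T v + c i • (T v - c i • v)) := by
        rw [smul_sub, smul_smul, pow_two, sub_add_sub_cancel]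
    _ ≤ n i (T (T v) - c i • T v) + c i * n i (T v - c i • v) := by
        grw [map_add_le_add, map_smul_eq_mul, Real.norm_of_nonneg hc]
    _ ≤ σ * ((c i + σ) * n i v) + c i * (σ * n i v) := by
        grw [h.seminorm_sub_le, h.seminorm_le, h.seminorm_sub_le]
    _ = (2 * c i * σ + σ ^ 2) * n i v := by ring

variable {v e : V}

lemma error_energy_le (h : IsWeightedLocalForm n F T c a σ γ) (hγ : 0 < γ)
    (he : ‖a e e‖ ≤ σ * ∑ i ∈ F, n i v * n i e) :
    ∑ i ∈ F, n i e ^ 2 ≤ σ / γ * ∑ i ∈ F, n i v * n i e := by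
  rw [div_mul_eq_mul_div, le_div_iff₀' hγ]
  exact (h.coercive e).trans he

lemma error_pairing_le (h : IsWeightedLocalForm n F T c a σ γ) (hσ : 0 < σ) (hγ : 0 < γ)
    (he : ‖a e e‖ ≤ σ * ∑ i ∈ F, n i v * n i e) :
    ∑ i ∈ F, n i v * n i e ≤ σ / γ * ∑ i ∈ F, n i v ^ 2 := by
  have ht : 0 < σ / γ := div_pos hσ hγ
  have hyoung := two_mul_sum_mul_le F (fun _ => zero_le_one) (fun i => n i v) (fun i => n i e)
    (σ / γ)
  simp only [one_mul] at hyoung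
  refine le_of_mul_le_mul_left ?_ ht
  linarith [h.error_energy_le hγ he]

lemma weighted_error_energy_le (h : IsWeightedLocalForm n F T c a σ γ) (hσ : 0 < σ) (hγ : 0 < γ)
    (heT : ‖a e (T e)‖ ≤ σ * ∑ i ∈ F, n i v * n i (T e)) :
    ∑ i ∈ F, c i * n i e ^ 2 ≤ σ / γ * (∑ i ∈ F, c i * (n i v * n i e) +
      σ * ∑ i ∈ F, n i v * n i e + ∑ i ∈ F, n i e ^ 2) := by
  have hpair : ∑ i ∈ F, n i v * n i (T e) ≤
      ∑ i ∈ F, c i * (n i v * n i e) + σ * ∑ i ∈ F, n i v * n i e := by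
    rw [Finset.mul_sum, ← Finset.sum_add_distrib]
    exact Finset.sum_le_sum fun i _ => by
      linarith [mul_le_mul_of_nonneg_left (h.seminorm_le i e) (apply_nonneg (n i) v)]
  rw [div_mul_eq_mul_div, le_div_iff₀' hγ]
  linarith [h.weighted_coercive e, mul_le_mul_of_nonneg_left hpair hσ.le]

lemma weighted_error_pairing_le (h : IsWeightedLocalForm n F T c a σ γ) (hσ : 0 < σ) (hγ : 0 < γ)
    (hγ1 : γ ≤ 1) (he : ‖a e e‖ ≤ σ * ∑ i ∈ F, n i v * n i e)
    (heT : ‖a e (T e)‖ ≤ σ * ∑ i ∈ F, n i v * n i (T e)) :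
    ∑ i ∈ F, (c i + σ) * (n i v * n i e) ≤ σ / γ * ∑ i ∈ F, c i * n i v ^ 2 +
      3 * (σ / γ) ^ 2 * ∑ i ∈ F, n i v ^ 2 := by
  set t := σ / γ
  set Y := ∑ i ∈ F, n i v ^ 2
  set M := ∑ i ∈ F, n i v * n i e
  have ht : 0 < t := div_pos hσ hγ
  have hσt : σ ≤ t := le_div_self hσ.le hγ hγ1
  have hM : M ≤ t * Y := h.error_pairing_le hσ hγ he
  have hM0 : 0 ≤ M := Finset.sum_nonneg fun i _ => mul_nonneg (apply_nonneg _ _) (apply_nonneg _ _)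
  have hσM : σ * M ≤ t ^ 2 * Y := by
    calc σ * M ≤ t * (t * Y) := mul_le_mul hσt hM hM0 ht.le
      _ = t ^ 2 * Y := by ring
  have hX : ∑ i ∈ F, n i e ^ 2 ≤ t ^ 2 * Y := by
    calc ∑ i ∈ F, n i e ^ 2 ≤ t * M := h.error_energy_le hγ he
      _ ≤ t * (t * Y) := by gcongr
      _ = t ^ 2 * Y := by ring
  have hweighted : ∑ i ∈ F, c i * (n i v * n i e) ≤
      t * ∑ i ∈ F, c i * n i v ^ 2 + 2 * t ^ 2 * Y := by
    refine le_of_mul_le_mul_left ?_ ht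
    have hyoung := two_mul_sum_mul_le F h.weight_nonneg (fun i => n i v) (fun i => n i e) t
    have hZ := h.weighted_error_energy_le hσ hγ heT
    linarith [mul_le_mul_of_nonneg_left (add_le_add hσM hX) ht.le]
  calc ∑ i ∈ F, (c i + σ) * (n i v * n i e)
      = ∑ i ∈ F, c i * (n i v * n i e) + σ * M := by
        rw [Finset.mul_sum, ← Finset.sum_add_distrib]
        exact Finset.sum_congr rfl fun i _ => add_mul _ _ _
    _ ≤ _ := by linarith

lemma le_re_inner (h : IsWeightedLocalForm n F T c a σ γ) (hσ : 0 ≤ σ) {i : ι}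
    {ip : V →ₗ[ℝ] ℂ} (hip : ∀ w, ‖ip w‖ ≤ n i v * n i w) (hself : ip v = ((n i v ^ 2 : ℝ) : ℂ))
    (u : V) :
    (c i ^ 2 - (2 * c i * σ + σ ^ 2)) * n i v ^ 2 - (c i + σ) * (n i v * n i (u - T v)) ≤
      (ip (T u)).re := by
  have hv : 0 ≤ n i v := apply_nonneg _ _
  have hdec : T u = c i ^ 2 • v + (T (T v) - c i ^ 2 • v) + T (u - T v) := by
    rw [map_sub]; abel
  have hre : ∀ w, -(n i v * n i w) ≤ (ip w).re := fun w =>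
    (neg_le_neg (hip w)).trans (neg_le_of_abs_le (Complex.abs_re_le_norm _))
  have hmain : (ip (c i ^ 2 • v)).re = c i ^ 2 * n i v ^ 2 := by
    rw [map_smul, hself, Complex.real_smul, ← Complex.ofReal_mul, Complex.ofReal_re]
  rw [hdec, map_add, map_add, Complex.add_re, Complex.add_re, hmain]
  linarith [hre (T (T v) - c i ^ 2 • v), hre (T (u - T v)),
    mul_le_mul_of_nonneg_left (h.seminorm_comp_sub_le hσ i v) hv,
    mul_le_mul_of_nonneg_left (h.seminorm_le i (u - T v)) hv]

lemma sum_le_re_inner [Fintype ι] (h : IsWeightedLocalForm n F T c a σ γ) (hσ : 0 < σ) (hγ : 0 < γ)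
    (hγ1 : γ ≤ 1) {ip : ι → V →ₗ[ℝ] ℂ} (hip : ∀ i w, ‖ip i w‖ ≤ n i v * n i w)
    (hself : ∀ i, ip i v = ((n i v ^ 2 : ℝ) : ℂ)) {L : Submodule ℝ V} (hTL : ∀ w, T w ∈ L) {u : V}
    (huL : u ∈ L) (hu : ∀ w ∈ L, a u w = a v (T w)) :
    ∑ i ∈ F, c i ^ 2 * n i v ^ 2 - (2 * σ + σ / γ) * ∑ i ∈ F, c i * n i v ^ 2 -
      (σ ^ 2 + 3 * (σ / γ) ^ 2) * ∑ i ∈ F, n i v ^ 2 ≤ (∑ i, ip i (T u)).re := by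
  have herror : ∀ w ∈ L, ‖a (u - T v) w‖ ≤ σ * ∑ i ∈ F, n i v * n i w := fun w hw => by
    rw [map_sub, LinearMap.sub_apply, hu w hw, norm_sub_rev]
    exact h.commutator_le v w
  have hpairing := h.weighted_error_pairing_le hσ hγ hγ1
    (herror _ (L.sub_mem huL (hTL v))) (herror _ (hTL (u - T v)))
  have hzero : ∀ i ∉ F, ip i (T u) = 0 := fun i hi => by
    simpa [h.seminorm_eq_zero i hi u] using hip i (T u)
  rw [← Finset.sum_subset (Finset.subset_univ F) fun i _ hi => hzero i hi, Complex.re_sum]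
  have hlower := Finset.sum_le_sum fun i (_ : i ∈ F) => h.le_re_inner hσ.le (hip i) (hself i) u
  have hsplit : ∑ i ∈ F, ((c i ^ 2 - (2 * c i * σ + σ ^ 2)) * n i v ^ 2 -
      (c i + σ) * (n i v * n i (u - T v))) =
      ∑ i ∈ F, c i ^ 2 * n i v ^ 2 - 2 * σ * ∑ i ∈ F, c i * n i v ^ 2 -
      σ ^ 2 * ∑ i ∈ F, n i v ^ 2 - ∑ i ∈ F, (c i + σ) * (n i v * n i (u - T v)) := by
    simp only [Finset.mul_sum, ← Finset.sum_sub_distrib]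
    exact Finset.sum_congr rfl fun i _ => by ring
  linarith

end IsWeightedLocalForm

section FiniteOverlap

variable [Fintype J] {sub : J → Finset ι} {Λ : ℕ}

lemma sum_sum_mem_comm [Fintype ι] [DecidableEq ι] (sub : J → Finset ι) (g : J → ι → ℝ) :
    ∑ l, ∑ i ∈ sub l, g l i = ∑ i, ∑ l with i ∈ sub l, g l i :=
  Finset.sum_comm' (by simp)

lemma sum_sum_le_of_card_le [Fintype ι] [DecidableEq ι]
    (hΛ : ∀ i, (Finset.univ.filter fun l => i ∈ sub l).card ≤ Λ) {x : ι → ℝ} (hx : ∀ i, 0 ≤ x i) :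
    ∑ l, ∑ i ∈ sub l, x i ≤ Λ * ∑ i, x i := by
  rw [sum_sum_mem_comm, Finset.mul_sum]
  refine Finset.sum_le_sum fun i _ => ?_
  rw [Finset.sum_const, nsmul_eq_mul]
  exact mul_le_mul_of_nonneg_right (by exact_mod_cast hΛ i) (hx i)

variable {c : J → ι → ℝ}

lemma sum_filter_mem_eq_one [DecidableEq ι] (hc : ∀ i, ∑ l, c l i = 1)
    (hc0 : ∀ l, ∀ i ∉ sub l, c l i = 0) (i : ι) : ∑ l with i ∈ sub l, c l i = 1 := by
  rw [← hc i]
  exact Finset.sum_subset (Finset.subset_univ _) fun l _ hl => hc0 l i (by simpa using hl)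

lemma sum_sum_weight_mul [Fintype ι] (hc : ∀ i, ∑ l, c l i = 1)
    (hc0 : ∀ l, ∀ i ∉ sub l, c l i = 0) (x : ι → ℝ) :
    ∑ l, ∑ i ∈ sub l, c l i * x i = ∑ i, x i := by
  classical
  rw [sum_sum_mem_comm]
  exact Finset.sum_congr rfl fun i _ => by
    rw [← Finset.sum_mul, sum_filter_mem_eq_one hc hc0, one_mul]

lemma one_div_mul_sum_le [Fintype ι] [DecidableEq ι]
    (hΛ : ∀ i, (Finset.univ.filter fun l => i ∈ sub l).card ≤ Λ)
    (hc : ∀ i, ∑ l, c l i = 1) (hc0 : ∀ l, ∀ i ∉ sub l, c l i = 0) {x : ι → ℝ}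
    (hx : ∀ i, 0 ≤ x i) : 1 / (Λ : ℝ) * ∑ i, x i ≤ ∑ l, ∑ i ∈ sub l, c l i ^ 2 * x i := by
  rw [sum_sum_mem_comm, Finset.mul_sum]
  refine Finset.sum_le_sum fun i _ => ?_
  rw [← Finset.sum_mul]
  refine mul_le_mul_of_nonneg_right (div_le_of_le_mul₀ Λ.cast_nonneg ?_ ?_) (hx i)
  · exact Finset.sum_nonneg fun _ _ => sq_nonneg _
  have hsq := sq_sum_le_card_mul_sum_sq (s := Finset.univ.filter fun l => i ∈ sub l)
    (f := fun l => c l i)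
  rw [sum_filter_mem_eq_one hc hc0, one_pow] at hsq
  grw [hsq, hΛ i, mul_comm]

theorem schwarz_lower_bound [Fintype ι] [DecidableEq ι] {n : ι → Seminorm ℝ V}
    {T : J → V →ₗ[ℝ] V} {a : J → BilinMap ℝ V ℂ} {σ γ : ℝ} (hσ : 0 < σ) (hγ : 0 < γ) (hγ1 : γ ≤ 1)
    (h : ∀ l, IsWeightedLocalForm n (sub l) (T l) (c l) (a l) σ γ)
    (hΛ : ∀ i, (Finset.univ.filter fun l => i ∈ sub l).card ≤ Λ) (hc : ∀ i, ∑ l, c l i = 1)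
    {v : V} {ip : ι → V →ₗ[ℝ] ℂ} (hip : ∀ i w, ‖ip i w‖ ≤ n i v * n i w)
    (hself : ∀ i, ip i v = ((n i v ^ 2 : ℝ) : ℂ)) {L : J → Submodule ℝ V}
    (hTL : ∀ l w, T l w ∈ L l) {u : J → V} (huL : ∀ l, u l ∈ L l)
    (hu : ∀ l, ∀ w ∈ L l, a l (u l) w = a l v (T l w)) :
    (1 / (Λ : ℝ) - 3 * (σ / γ) - 4 * Λ * (σ / γ) ^ 2) * ∑ i, n i v ^ 2 ≤
      ‖∑ l, ∑ i, ip i (T l (u l))‖ := by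
  have hc0 : ∀ l, ∀ i ∉ sub l, c l i = 0 := fun l => (h l).weight_eq_zero
  refine le_trans ?_ (Complex.re_le_norm _)
  rw [Complex.re_sum]
  have hlocal := Finset.sum_le_sum fun l (_ : l ∈ Finset.univ) =>
    (h l).sum_le_re_inner hσ hγ hγ1 hip hself (hTL l) (huL l) (hu l)
  simp only [Finset.sum_sub_distrib, ← Finset.mul_sum, sum_sum_weight_mul hc hc0] at hlocal
  refine le_trans ?_ hlocal
  set t := σ / γ
  set N := ∑ i, n i v ^ 2
  have : 0 ≤ N := Finset.sum_nonneg fun _ _ => sq_nonneg _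
  have hσt : σ ≤ t := le_div_self hσ.le hγ hγ1
  have hfirst : (2 * σ + t) * N ≤ 3 * t * N := by gcongr; linarith
  have hsecond : (σ ^ 2 + 3 * t ^ 2) * ∑ l, ∑ i ∈ sub l, n i v ^ 2 ≤ 4 * t ^ 2 * (Λ * N) := by
    have hsq : σ ^ 2 ≤ t ^ 2 := by gcongr
    gcongr
    · linarith
    · exact sum_sum_le_of_card_le hΛ fun _ => sq_nonneg _
  linarith [one_div_mul_sum_le hΛ hc hc0 fun i => sq_nonneg (n i v)]

end FiniteOverlap

end Schwarz

/-! ### Sesquilinear forms of real matrices -/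

section Forms

open LinearMap (BilinMap)
open Complex (re im)

variable {n : Type*} [Fintype n]

open Matrix in
/-- The bilinear form of a real matrix; as for the Galerkin matrices, the second argument is the
test vector. -/
def rform (M : Matrix n n ℝ) (x y : n → ℝ) : ℝ := y ⬝ᵥ M *ᵥ x

open Matrix in
/-- The sesquilinear form of a real matrix on complex vectors. Only its linearity over the reals
is recorded, so that it need not be distinguished which of the arguments is conjugated. -/
def cform (M : Matrix n n ℝ) : BilinMap ℝ (n → ℂ) ℂ :=
  LinearMap.mk₂ ℝ (fun V W => star W ⬝ᵥ M.map Complex.ofReal *ᵥ V)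
    (fun _ _ _ => by simp [mulVec_add]) (fun _ _ _ => by simp [mulVec_smul])
    (fun _ _ _ => by simp) (fun _ _ _ => by simp)

lemma rform_eq_sum (M : Matrix n n ℝ) (x y : n → ℝ) :
    rform M x y = ∑ p, ∑ q, y p * (M p q * x q) := by
  simp [rform, dotProduct, Matrix.mulVec, Finset.mul_sum]

lemma cform_eq_sum (M : Matrix n n ℝ) (V W : n → ℂ) :
    cform M V W = ∑ p, ∑ q, star (W p) * (M p q * V q) := by
  simp [cform, dotProduct, Matrix.mulVec, Finset.mul_sum]

lemma rform_add_mat (M M' : Matrix n n ℝ) (x y : n → ℝ) :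
    rform (M + M') x y = rform M x y + rform M' x y := by
  simp [rform, Matrix.add_mulVec]

lemma rform_smul_mat (t : ℝ) (M : Matrix n n ℝ) (x y : n → ℝ) :
    rform (t • M) x y = t * rform M x y := by
  simp [rform, Matrix.smul_mulVec]

lemma cform_eq_re_add_im (M : Matrix n n ℝ) (V W : n → ℂ) :
    cform M V W = (rform M (re ∘ V) (re ∘ W) + rform M (im ∘ V) (im ∘ W) : ℝ) +
      (rform M (im ∘ V) (re ∘ W) - rform M (re ∘ V) (im ∘ W) : ℝ) * Complex.I := by
  simp only [cform_eq_sum, rform_eq_sum, ← Finset.sum_add_distrib, ← Finset.sum_sub_distrib,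
    Complex.ofReal_sum, Finset.sum_mul]
  refine Finset.sum_congr rfl fun p _ => Finset.sum_congr rfl fun q _ => ?_
  apply Complex.ext
  · simp
  · simp; ring

lemma rform_symm {M : Matrix n n ℝ} (hM : M.PosSemidef) (x y : n → ℝ) :
    rform M x y = rform M y x := by
  have hMt : M.transpose = M := by simpa using hM.isHermitian.eq
  rw [rform, Matrix.dotProduct_mulVec, ← Matrix.mulVec_transpose, hMt, dotProduct_comm, rform]

lemma rform_nonneg {M : Matrix n n ℝ} (hM : M.PosSemidef) (x : n → ℝ) : 0 ≤ rform M x x := by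
  simpa [rform] using hM.dotProduct_mulVec_nonneg x

lemma cform_self_eq_rform {M : Matrix n n ℝ} (hM : M.PosSemidef) (V : n → ℂ) :
    cform M V V = (rform M (re ∘ V) (re ∘ V) + rform M (im ∘ V) (im ∘ V) : ℝ) := by
  rw [cform_eq_re_add_im, rform_symm hM (im ∘ V) (re ∘ V), sub_self, Complex.ofReal_zero, zero_mul,
    add_zero]

lemma star_cform {M : Matrix n n ℝ} (hM : M.PosSemidef) (V W : n → ℂ) :
    star (cform M V W) = cform M W V := by
  rw [cform_eq_re_add_im, cform_eq_re_add_im, rform_symm hM (re ∘ W), rform_symm hM (im ∘ W),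
    rform_symm hM (im ∘ W), rform_symm hM (re ∘ W)]
  apply Complex.ext <;> simp

open scoped ComplexOrder in
lemma posSemidef_map_ofReal {n : Type*} [Finite n] {M : Matrix n n ℝ} (hM : M.PosSemidef) :
    (M.map Complex.ofReal).PosSemidef := by
  have := Fintype.ofFinite n
  refine Matrix.PosSemidef.of_dotProduct_mulVec_nonneg ?_ fun V => ?_
  · exact hM.isHermitian.map _ fun _ => (Complex.conj_ofReal _).symm
  · change 0 ≤ cform M V V
    rw [cform_self_eq_rform hM]
    exact_mod_cast add_nonneg (rform_nonneg hM _) (rform_nonneg hM _)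

section Seminorm

variable {M : Matrix n n ℝ} (hM : M.PosSemidef)

/-- The seminorm of a positive semidefinite real matrix on complex vectors. -/
def formSeminorm : Seminorm ℝ (n → ℂ) :=
  letI := (M.map Complex.ofReal).toSeminormedAddCommGroup (posSemidef_map_ofReal hM)
  letI := (M.map Complex.ofReal).toInnerProductSpace (posSemidef_map_ofReal hM)
  (normSeminorm ℂ (n → ℂ)).restrictScalars ℝ

lemma norm_cform_le (V W : n → ℂ) :
    ‖cform M V W‖ ≤ formSeminorm hM V * formSeminorm hM W := by
  let := (M.map Complex.ofReal).toSeminormedAddCommGroup (posSemidef_map_ofReal hM)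
  let := (M.map Complex.ofReal).toInnerProductSpace (posSemidef_map_ofReal hM)
  have hinner : inner ℂ W V = cform M V W := dotProduct_comm _ _
  rw [← hinner, mul_comm]
  exact norm_inner_le_norm W V

lemma cform_self_eq_sq (V : n → ℂ) : cform M V V = ((formSeminorm hM V ^ 2 : ℝ) : ℂ) := by
  let := (M.map Complex.ofReal).toSeminormedAddCommGroup (posSemidef_map_ofReal hM)
  let := (M.map Complex.ofReal).toInnerProductSpace (posSemidef_map_ofReal hM)
  have hinner : inner ℂ V V = cform M V V := dotProduct_comm _ _
  rw [← hinner, inner_self_eq_norm_sq_to_K, Complex.ofReal_pow]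
  rfl

lemma formSeminorm_sq (V : n → ℂ) :
    formSeminorm hM V ^ 2 = rform M (re ∘ V) (re ∘ V) + rform M (im ∘ V) (im ∘ V) := by
  exact_mod_cast (cform_self_eq_sq hM V).symm.trans (cform_self_eq_rform hM V)

lemma sqrt_rform_re_le (V : n → ℂ) : √(rform M (re ∘ V) (re ∘ V)) ≤ formSeminorm hM V := by
  rw [Real.sqrt_le_left (apply_nonneg _ _), formSeminorm_sq]
  exact le_add_of_nonneg_right (rform_nonneg hM _)

lemma sqrt_rform_im_le (V : n → ℂ) : √(rform M (im ∘ V) (im ∘ V)) ≤ formSeminorm hM V := by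
  rw [Real.sqrt_le_left (apply_nonneg _ _), formSeminorm_sq]
  exact le_add_of_nonneg_left (rform_nonneg hM _)

end Seminorm

/-- Multiplication of a vector by real weights. -/
def weightMap (t : n → ℝ) : (n → ℂ) →ₗ[ℝ] (n → ℂ) :=
  LinearMap.pi fun p => t p • LinearMap.proj p

lemma re_comp_weightMap {n : Type*} (t : n → ℝ) (V : n → ℂ) : re ∘ weightMap t V = t * re ∘ V := by
  ext p; simp [weightMap]

lemma im_comp_weightMap {n : Type*} (t : n → ℝ) (V : n → ℂ) : im ∘ weightMap t V = t * im ∘ V := by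
  ext p; simp [weightMap]

lemma formSeminorm_weightMap_sub_le {M : Matrix n n ℝ} (hM : M.PosSemidef) {t : n → ℝ} {c s : ℝ}
    (hs : 0 ≤ s)
    (h : ∀ x : n → ℝ, rform M (fun p => (t p - c) * x p) (fun p => (t p - c) * x p) ≤
      s ^ 2 * rform M x x) (V : n → ℂ) :
    formSeminorm hM (weightMap t V - c • V) ≤ s * formSeminorm hM V := by
  refine le_of_sq_le_sq ?_ (mul_nonneg hs (apply_nonneg _ _))
  have hre : re ∘ (weightMap t V - c • V) = fun p => (t p - c) * (re ∘ V) p := by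
    ext p; simp [weightMap, sub_mul]
  have him : im ∘ (weightMap t V - c • V) = fun p => (t p - c) * (im ∘ V) p := by
    ext p; simp [weightMap, sub_mul]
  rw [mul_pow, formSeminorm_sq, formSeminorm_sq, mul_add, hre, him]
  exact add_le_add (h _) (h _)

lemma norm_cform_weightMap_sub_le {ι : Type*} (F : Finset ι) {M : ι → Matrix n n ℝ}
    (hM : ∀ i, (M i).PosSemidef) {G G' : Matrix n n ℝ} {t : n → ℝ} {τ : ℝ} (hτ : 0 ≤ τ)
    (h : ∀ x y : n → ℝ, |rform G x (t * y) - rform G' x y| ≤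
      τ * ∑ i ∈ F, √(rform (M i) x x) * √(rform (M i) y y)) (V W : n → ℂ) :
    ‖cform G V (weightMap t W) - cform G' V W‖ ≤
      4 * τ * ∑ i ∈ F, formSeminorm (hM i) V * formSeminorm (hM i) W := by
  set S := ∑ i ∈ F, formSeminorm (hM i) V * formSeminorm (hM i) W
  let B : (n → ℝ) → (n → ℝ) → ℝ := fun x y => rform G x (t * y) - rform G' x y
  have hB : ∀ {x y : n → ℝ}, (∀ i, √(rform (M i) x x) ≤ formSeminorm (hM i) V) →
      (∀ i, √(rform (M i) y y) ≤ formSeminorm (hM i) W) → ‖(B x y : ℂ)‖ ≤ τ * S := fun hx hy => by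
    rw [Complex.norm_real]
    exact (h _ _).trans (mul_le_mul_of_nonneg_left (Finset.sum_le_sum fun i _ =>
      mul_le_mul (hx i) (hy i) (Real.sqrt_nonneg _) (apply_nonneg _ _)) hτ)
  have hVr := fun i => sqrt_rform_re_le (hM i) V
  have hVi := fun i => sqrt_rform_im_le (hM i) V
  have hWr := fun i => sqrt_rform_re_le (hM i) W
  have hWi := fun i => sqrt_rform_im_le (hM i) W
  have hsplit : cform G V (weightMap t W) - cform G' V W =
      B (re ∘ V) (re ∘ W) + B (im ∘ V) (im ∘ W) +
        (B (im ∘ V) (re ∘ W) - B (re ∘ V) (im ∘ W)) * Complex.I := by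
    simp only [cform_eq_re_add_im, re_comp_weightMap, im_comp_weightMap, B]
    push_cast
    ring
  rw [hsplit]
  grw [norm_add_le, norm_add_le, norm_mul, Complex.norm_I, mul_one, norm_sub_le, hB hVr hWr,
    hB hVi hWi, hB hVi hWr, hB hVr hWi]
  linarith

end Forms

/-! ### Coercivity of the Helmholtz form -/

section Multiplier

variable {k ε : ℝ} {η : ℂ}

lemma norm_impedance_le (hk : 0 < k) (hεk : |ε| ≤ k ^ 2) (hη : ImpedanceChoice k ε η) :
    ‖η‖ ≤ 2 * k := by
  rcases hη with h | ⟨h, -⟩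
  · have hsign : |((SignType.sign ε : SignType) : ℝ)| ≤ 1 := by
      rcases lt_trichotomy ε 0 with h | h | h <;> simp [h]
    rw [h, Complex.norm_real, Real.norm_eq_abs, abs_mul, abs_of_pos hk]
    nlinarith
  · have hsq : ‖η‖ ^ 2 ≤ 2 * k ^ 2 := by
      rw [← norm_pow, h]
      grw [norm_add_le]
      simp only [norm_pow, norm_mul, Complex.norm_I, Complex.norm_real, Real.norm_eq_abs, sq_abs,
        one_mul]
      linarith
    nlinarith [norm_nonneg η]

/-- After multiplication by `Θ`, the form `∫ ∇u·∇v̄ - z ∫ u v̄ - i η ∫_Γ u v̄` has real part at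
least `γ (‖∇u‖² + k² ‖u‖²)` on the diagonal. -/
structure IsCoercivityMultiplier (k : ℝ) (z η Θ : ℂ) (γ : ℝ) : Prop where
  norm_le_one : ‖Θ‖ ≤ 1
  le_re : γ ≤ Θ.re
  mul_sq_le_re : γ * k ^ 2 ≤ (-(Θ * z)).re
  re_nonneg : 0 ≤ (-(Θ * (Complex.I * η))).re

lemma isCoercivityMultiplier_sign (hk : 0 < k) (hε : ε ≠ 0) (hεk : |ε| ≤ k ^ 2) :
    IsCoercivityMultiplier k ⟨k ^ 2, ε⟩ ((SignType.sign ε : ℝ) * k : ℝ)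
      ⟨|ε| / (4 * k ^ 2), (SignType.sign ε : ℝ) / 2⟩ (|ε| / (8 * k ^ 2)) := by
  set σ : ℝ := (SignType.sign ε : ℝ)
  have hσε : σ * ε = |ε| := sign_mul_self ε
  have hσ : |σ| = 1 := by
    rcases lt_or_gt_of_ne hε with h | h <;> simp [σ, h]
  have hε0 : 0 < |ε| := abs_pos.2 hε
  have hre : |ε| / (4 * k ^ 2) ≤ 1 / 4 := by
    rw [div_le_iff₀ (by positivity)]; linarith
  refine ⟨?_, ?_, ?_, ?_⟩
  · refine (Complex.norm_le_abs_re_add_abs_im _).trans ?_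
    simp only [abs_div, abs_two, hσ, abs_of_pos (show 0 < |ε| / (4 * k ^ 2) by positivity)]
    linarith
  · change _ ≤ |ε| / (4 * k ^ 2)
    gcongr
    norm_num
  · calc |ε| / (8 * k ^ 2) * k ^ 2 = -(|ε| / (4 * k ^ 2) * k ^ 2 - |ε| / 2) + -(|ε| / 8) := by
          field_simp; ring
      _ ≤ -(|ε| / (4 * k ^ 2) * k ^ 2 - |ε| / 2) := by linarith
      _ = _ := by rw [Complex.neg_re, Complex.mul_re, ← hσε]; ring
  · have hσσ : σ * σ = 1 := by rw [← abs_mul_abs_self, hσ, one_mul]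
    have heq : (-(⟨|ε| / (4 * k ^ 2), σ / 2⟩ * (Complex.I * ((σ * k : ℝ) : ℂ)))).re =
        σ * σ * k / 2 := by
      simp only [Complex.neg_re, Complex.mul_re, Complex.I_re, Complex.I_im, Complex.ofReal_re,
        Complex.ofReal_im, Complex.mul_im]
      ring
    rw [heq, hσσ]
    positivity

lemma isCoercivityMultiplier_sqrt (hk : 0 < k) (hη : η ^ 2 = ⟨k ^ 2, ε⟩) (him : 0 < η.im)
    (hηk : ‖η‖ ≤ 2 * k) :
    IsCoercivityMultiplier k ⟨k ^ 2, ε⟩ η (Complex.I * star η / (2 * k : ℝ))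
      (|ε| / (8 * k ^ 2)) := by
  have hre : η.re * η.re - η.im * η.im = k ^ 2 := by
    simpa [pow_two] using congrArg Complex.re hη
  have hε : 2 * η.re * η.im = ε := by
    have := congrArg Complex.im hη
    rw [pow_two, Complex.mul_im] at this
    linarith
  have hη_re : |η.re| ≤ 2 * k := (Complex.abs_re_le_norm η).trans hηk
  have hε_le : |ε| ≤ 4 * k * η.im := by
    rw [← hε, abs_mul, abs_mul, abs_of_pos him, abs_two]
    nlinarith
  have hγ : |ε| / (8 * k ^ 2) ≤ η.im / (2 * k) := by
    rw [div_le_div_iff₀ (by positivity) (by positivity)]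
    nlinarith
  refine ⟨?_, ?_, ?_, ?_⟩
  · rw [norm_div, norm_mul, Complex.norm_I, norm_star, one_mul, Complex.norm_real,
      Real.norm_of_nonneg (by positivity)]
    exact div_le_one_of_le₀ hηk (by positivity)
  · rw [Complex.div_ofReal_re]
    simpa using hγ
  · have heq : (-(Complex.I * star η / (2 * k : ℝ) * ⟨k ^ 2, ε⟩)).re =
        η.im / (2 * k) * (2 * (η.re * η.re) - k ^ 2) := by
      rw [← neg_mul, Complex.mul_re, Complex.neg_re, Complex.neg_im, Complex.div_ofReal_re,
        Complex.div_ofReal_im, ← hε]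
      simp
      ring
    rw [heq]
    refine mul_le_mul hγ ?_ (by positivity) (by positivity)
    nlinarith [mul_self_nonneg η.im]
  · have heq : (-(Complex.I * star η / (2 * k : ℝ) * (Complex.I * η))).re =
        Complex.normSq η / (2 * k) := by
      rw [show -(Complex.I * star η / (2 * k : ℝ) * (Complex.I * η)) =
        -(Complex.I * Complex.I) * (star η * η) / (2 * k : ℝ) by ring, Complex.I_mul_I, neg_neg,
        one_mul, Complex.div_ofReal_re, ← starRingEnd_apply, ← Complex.normSq_eq_conj_mul_self,
        Complex.ofReal_re]
    rw [heq]
    exact div_nonneg (Complex.normSq_nonneg η) (by positivity)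

lemma exists_isCoercivityMultiplier (hk : 0 < k) (hε : ε ≠ 0) (hεk : |ε| ≤ k ^ 2)
    (hη : ImpedanceChoice k ε η) :
    ∃ Θ : ℂ, IsCoercivityMultiplier k (k ^ 2 + Complex.I * ε) η Θ (|ε| / (8 * k ^ 2)) := by
  have hz : (k : ℂ) ^ 2 + Complex.I * ε = ⟨k ^ 2, ε⟩ := by
    apply Complex.ext <;> simp [pow_two]
  have hηk := norm_impedance_le hk hεk hη
  rw [hz]
  rcases hη with rfl | ⟨hsq, him⟩
  · exact ⟨_, isCoercivityMultiplier_sign hk hε hεk⟩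
  · exact ⟨_, isCoercivityMultiplier_sqrt hk (hsq.trans hz) him hηk⟩

end Multiplier

section LocalForm

open LinearMap (BilinMap)

variable {n : Type*} [Fintype n]

section Element

variable {S M : Matrix n n ℝ} (hS : S.PosSemidef) (hM : M.PosSemidef) {k : ℝ} {z : ℂ}

/-- The energy seminorm `(‖∇u‖² + k² ‖u‖²)^(1/2)` for a stiffness matrix `S` and a mass
matrix `M`. -/
def energySeminorm (k : ℝ) : Seminorm ℝ (n → ℂ) :=
  formSeminorm (hS.add (hM.smul (sq_nonneg k)))

/-- The form `∫ ∇u·∇v̄ - z ∫ u v̄` for a stiffness matrix `S` and a mass matrix `M`. -/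
def volumeForm (S M : Matrix n n ℝ) (z : ℂ) : BilinMap ℝ (n → ℂ) ℂ := cform S - z • cform M

lemma volumeForm_apply (S M : Matrix n n ℝ) (z : ℂ) (V W : n → ℂ) :
    volumeForm S M z V W = cform S V W - z * cform M V W := rfl

lemma energySeminorm_sq (V : n → ℂ) :
    energySeminorm hS hM k V ^ 2 = formSeminorm hS V ^ 2 + k ^ 2 * formSeminorm hM V ^ 2 := by
  simp only [energySeminorm, formSeminorm_sq, rform_add_mat, rform_smul_mat]
  ring

lemma formSeminorm_stiffness_le (V : n → ℂ) : formSeminorm hS V ≤ energySeminorm hS hM k V := by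
  refine le_of_sq_le_sq ?_ (apply_nonneg _ _)
  rw [energySeminorm_sq]
  exact le_add_of_nonneg_right (by positivity)

lemma mul_formSeminorm_mass_le (V : n → ℂ) :
    k * formSeminorm hM V ≤ energySeminorm hS hM k V := by
  refine le_of_sq_le_sq ?_ (apply_nonneg _ _)
  rw [energySeminorm_sq, mul_pow]
  exact le_add_of_nonneg_left (by positivity)

lemma formSeminorm_mass_mul_le (hk : 0 < k) (V W : n → ℂ) :
    formSeminorm hM V * formSeminorm hM W ≤
      (k ^ 2)⁻¹ * (energySeminorm hS hM k V * energySeminorm hS hM k W) := by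
  rw [← div_eq_inv_mul, le_div_iff₀ (by positivity)]
  have := mul_le_mul (mul_formSeminorm_mass_le (k := k) hS hM V)
    (mul_formSeminorm_mass_le (k := k) hS hM W) (by positivity) (by positivity)
  linarith

lemma norm_volumeForm_le (hk : 0 < k) (hz : ‖z‖ ≤ 2 * k ^ 2) (V W : n → ℂ) :
    ‖volumeForm S M z V W‖ ≤ 3 * (energySeminorm hS hM k V * energySeminorm hS hM k W) := by
  set A := energySeminorm hS hM k V * energySeminorm hS hM k W
  have hstiff : ‖cform S V W‖ ≤ A :=
    (norm_cform_le hS V W).trans (mul_le_mul (formSeminorm_stiffness_le hS hM V)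
      (formSeminorm_stiffness_le hS hM W) (apply_nonneg _ _) (apply_nonneg _ _))
  have hmass : ‖cform M V W‖ ≤ (k ^ 2)⁻¹ * A :=
    (norm_cform_le hM V W).trans (formSeminorm_mass_mul_le hS hM hk V W)
  rw [volumeForm_apply]
  calc ‖cform S V W - z * cform M V W‖ ≤ ‖cform S V W‖ + ‖z‖ * ‖cform M V W‖ := by
        grw [norm_sub_le, norm_mul]
    _ ≤ A + 2 * k ^ 2 * ((k ^ 2)⁻¹ * A) := by gcongr
    _ = 3 * A := by field_simp; ring

variable {T : (n → ℂ) →ₗ[ℝ] n → ℂ} {c s : ℝ}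

lemma norm_volumeForm_comm_le (hk : 0 < k) (hz : ‖z‖ ≤ 2 * k ^ 2)
    (hT : ∀ V, energySeminorm hS hM k (T V - c • V) ≤ s * energySeminorm hS hM k V)
    (V W : n → ℂ) :
    ‖volumeForm S M z (T V) W - volumeForm S M z V (T W)‖ ≤
      6 * s * (energySeminorm hS hM k V * energySeminorm hS hM k W) := by
  have hsplit : volumeForm S M z (T V) W - volumeForm S M z V (T W) =
      volumeForm S M z (T V - c • V) W - volumeForm S M z V (T W - c • W) := by
    simp only [map_sub, map_smul, LinearMap.sub_apply, LinearMap.smul_apply]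
    ring
  rw [hsplit]
  grw [norm_sub_le, norm_volumeForm_le hS hM hk hz, norm_volumeForm_le hS hM hk hz, hT V, hT W]
  linarith

variable {η Θ : ℂ} {γ : ℝ}

lemma volumeForm_coercive (hΘ : IsCoercivityMultiplier k z η Θ γ) (V : n → ℂ) :
    γ * energySeminorm hS hM k V ^ 2 ≤ (Θ * volumeForm S M z V V).re := by
  rw [volumeForm_apply, cform_self_eq_sq hS, cform_self_eq_sq hM, energySeminorm_sq]
  set a := formSeminorm hS V ^ 2
  set b := formSeminorm hM V ^ 2
  have hdistrib : Θ * ((a : ℂ) - z * (b : ℂ)) = Θ * (a : ℂ) + -(Θ * z) * (b : ℂ) := by ring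
  rw [hdistrib, Complex.add_re, Complex.re_mul_ofReal, Complex.re_mul_ofReal, mul_add, ← mul_assoc]
  exact add_le_add (mul_le_mul_of_nonneg_right hΘ.le_re (sq_nonneg _))
    (mul_le_mul_of_nonneg_right hΘ.mul_sq_le_re (sq_nonneg _))

lemma volumeForm_weighted_coercive (hk : 0 < k) (hz : ‖z‖ ≤ 2 * k ^ 2)
    (hΘ : IsCoercivityMultiplier k z η Θ γ) (hc : 0 ≤ c)
    (hT : ∀ V, energySeminorm hS hM k (T V - c • V) ≤ s * energySeminorm hS hM k V)
    (V : n → ℂ) :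
    γ * (c * energySeminorm hS hM k V ^ 2) - 3 * s * energySeminorm hS hM k V ^ 2 ≤
      (Θ * volumeForm S M z V (T V)).re := by
  have hsplit : Θ * volumeForm S M z V (T V) =
      Θ * volumeForm S M z V V * (c : ℂ) + Θ * volumeForm S M z V (T V - c • V) := by
    simp only [map_sub, map_smul, Complex.real_smul]
    ring
  have herror : ‖Θ * volumeForm S M z V (T V - c • V)‖ ≤ 3 * s * energySeminorm hS hM k V ^ 2 := by
    grw [norm_mul, hΘ.norm_le_one, one_mul, norm_volumeForm_le hS hM hk hz, hT V]
    linarith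
  rw [hsplit, Complex.add_re, Complex.re_mul_ofReal]
  linarith [neg_le_of_abs_le ((Complex.abs_re_le_norm _).trans herror),
    mul_le_mul_of_nonneg_right (volumeForm_coercive hS hM hΘ V) hc]

end Element

section Subdomain

variable {ι : Type*} {S M : ι → Matrix n n ℝ} (hS : ∀ i, (S i).PosSemidef)
  (hM : ∀ i, (M i).PosSemidef) {G G' : Matrix n n ℝ} {k : ℝ} {z η Θ : ℂ} {F : Finset ι} {γ : ℝ}

/-- The Helmholtz form assembled from elementwise stiffness and mass matrices and a boundary mass
matrix. -/
def localForm (F : Finset ι) (S M : ι → Matrix n n ℝ) (G : Matrix n n ℝ) (z η : ℂ) :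
    BilinMap ℝ (n → ℂ) ℂ :=
  ∑ i ∈ F, volumeForm (S i) (M i) z - (Complex.I * η) • cform G

lemma localForm_apply (F : Finset ι) (S M : ι → Matrix n n ℝ) (G : Matrix n n ℝ) (z η : ℂ)
    (V W : n → ℂ) : localForm F S M G z η V W =
      ∑ i ∈ F, volumeForm (S i) (M i) z V W - Complex.I * η * cform G V W := by
  simp [localForm, LinearMap.sum_apply]

lemma localForm_coercive (hG : G.PosSemidef) (hΘ : IsCoercivityMultiplier k z η Θ γ)
    (V : n → ℂ) :
    γ * ∑ i ∈ F, energySeminorm (hS i) (hM i) k V ^ 2 ≤ ‖localForm F S M G z η V V‖ := by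
  have hsplit : Θ * localForm F S M G z η V V = ∑ i ∈ F, Θ * volumeForm (S i) (M i) z V V +
      -(Θ * (Complex.I * η)) * ((formSeminorm hG V ^ 2 : ℝ) : ℂ) := by
    rw [localForm_apply, cform_self_eq_sq hG, ← Finset.mul_sum]
    ring
  calc γ * ∑ i ∈ F, energySeminorm (hS i) (hM i) k V ^ 2
      ≤ ∑ i ∈ F, (Θ * volumeForm (S i) (M i) z V V).re +
        (-(Θ * (Complex.I * η))).re * formSeminorm hG V ^ 2 := by
        rw [Finset.mul_sum]
        exact le_add_of_le_of_nonneg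
          (Finset.sum_le_sum fun i _ => volumeForm_coercive (hS i) (hM i) hΘ V)
          (mul_nonneg hΘ.re_nonneg (sq_nonneg _))
    _ = (Θ * localForm F S M G z η V V).re := by
        rw [hsplit, Complex.add_re, Complex.re_mul_ofReal, Complex.re_sum]
    _ ≤ ‖localForm F S M G z η V V‖ := by
        grw [Complex.re_le_norm, norm_mul, hΘ.norm_le_one, one_mul]

variable {t : n → ℝ} {τ : ℝ}

lemma norm_boundary_error_le (hk : 0 < k) (hη : ‖η‖ ≤ 2 * k) (hτ : 0 ≤ τ)
    (hB : ∀ x y : n → ℝ, |rform G x (t * y) - rform G' x y| ≤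
      τ * ∑ i ∈ F, √(rform (M i) x x) * √(rform (M i) y y)) (V W : n → ℂ) :
    ‖η‖ * ‖cform G V (weightMap t W) - cform G' V W‖ ≤
      8 * τ / k * ∑ i ∈ F, energySeminorm (hS i) (hM i) k V * energySeminorm (hS i) (hM i) k W := by
  set A := ∑ i ∈ F, energySeminorm (hS i) (hM i) k V * energySeminorm (hS i) (hM i) k W
  have hmass : ∑ i ∈ F, formSeminorm (hM i) V * formSeminorm (hM i) W ≤ (k ^ 2)⁻¹ * A := by
    rw [Finset.mul_sum]
    exact Finset.sum_le_sum fun i _ => formSeminorm_mass_mul_le (hS i) (hM i) hk V W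
  calc ‖η‖ * ‖cform G V (weightMap t W) - cform G' V W‖
      ≤ 2 * k * (4 * τ * ((k ^ 2)⁻¹ * A)) := by
        grw [hη, norm_cform_weightMap_sub_le F hM hτ hB V W, hmass]
    _ = 8 * τ / k * A := by field_simp; ring

lemma norm_boundary_comm_le (hG : G.PosSemidef) (hG' : G'.PosSemidef) (hk : 0 < k)
    (hη : ‖η‖ ≤ 2 * k) (hτ : 0 ≤ τ)
    (hB : ∀ x y : n → ℝ, |rform G x (t * y) - rform G' x y| ≤
      τ * ∑ i ∈ F, √(rform (M i) x x) * √(rform (M i) y y)) (V W : n → ℂ) :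
    ‖η‖ * ‖cform G (weightMap t V) W - cform G V (weightMap t W)‖ ≤ 16 * τ / k *
      ∑ i ∈ F, energySeminorm (hS i) (hM i) k V * energySeminorm (hS i) (hM i) k W := by
  have hsplit : cform G (weightMap t V) W - cform G V (weightMap t W) =
      star (cform G W (weightMap t V) - cform G' W V) -
        (cform G V (weightMap t W) - cform G' V W) := by
    rw [star_sub, star_cform hG, star_cform hG']
    ring
  have hVW := norm_boundary_error_le hS hM hk hη hτ hB V W
  have hWV := norm_boundary_error_le hS hM hk hη hτ hB W V
  simp only [mul_comm (energySeminorm _ _ k W)] at hWV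
  rw [hsplit]
  grw [norm_sub_le, norm_star, mul_add, hVW, hWV]
  exact le_of_eq (by ring)

lemma boundary_weighted_nonneg (hG' : G'.PosSemidef) (hk : 0 < k) (hη : ‖η‖ ≤ 2 * k)
    (hΘ : IsCoercivityMultiplier k z η Θ γ) (hτ : 0 ≤ τ)
    (hB : ∀ x y : n → ℝ, |rform G x (t * y) - rform G' x y| ≤
      τ * ∑ i ∈ F, √(rform (M i) x x) * √(rform (M i) y y)) (V : n → ℂ) :
    -(8 * τ / k * ∑ i ∈ F, energySeminorm (hS i) (hM i) k V ^ 2) ≤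
      (-(Θ * (Complex.I * η)) * cform G V (weightMap t V)).re := by
  have hsplit : -(Θ * (Complex.I * η)) * cform G V (weightMap t V) =
      -(Θ * (Complex.I * η)) * ((formSeminorm hG' V ^ 2 : ℝ) : ℂ) +
      -(Θ * (Complex.I * (η * (cform G V (weightMap t V) - cform G' V V)))) := by
    rw [← cform_self_eq_sq hG']
    ring
  have herror : ‖-(Θ * (Complex.I * (η * (cform G V (weightMap t V) - cform G' V V))))‖ ≤
      8 * τ / k * ∑ i ∈ F, energySeminorm (hS i) (hM i) k V ^ 2 := by
    simp only [pow_two]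
    grw [norm_neg, norm_mul, norm_mul, Complex.norm_I, one_mul, norm_mul, hΘ.norm_le_one, one_mul,
      norm_boundary_error_le hS hM hk hη hτ hB V V]
  rw [hsplit, Complex.add_re, Complex.re_mul_ofReal]
  linarith [neg_le_of_abs_le ((Complex.abs_re_le_norm _).trans herror),
    mul_nonneg hΘ.re_nonneg (sq_nonneg (formSeminorm hG' V))]

variable {c : ι → ℝ} {s : ℝ}

lemma norm_localForm_comm_le (hG : G.PosSemidef) (hG' : G'.PosSemidef) (hk : 0 < k)
    (hz : ‖z‖ ≤ 2 * k ^ 2) (hη : ‖η‖ ≤ 2 * k) (hτ : 0 ≤ τ)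
    (hT : ∀ i V, energySeminorm (hS i) (hM i) k (weightMap t V - c i • V) ≤
      s * energySeminorm (hS i) (hM i) k V)
    (hB : ∀ x y : n → ℝ, |rform G x (t * y) - rform G' x y| ≤
      τ * ∑ i ∈ F, √(rform (M i) x x) * √(rform (M i) y y)) (V W : n → ℂ) :
    ‖localForm F S M G z η (weightMap t V) W - localForm F S M G z η V (weightMap t W)‖ ≤
      (6 * s + 16 * τ / k) *
        ∑ i ∈ F, energySeminorm (hS i) (hM i) k V * energySeminorm (hS i) (hM i) k W := by
  have hsplit : localForm F S M G z η (weightMap t V) W - localForm F S M G z η V (weightMap t W) =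
      ∑ i ∈ F, (volumeForm (S i) (M i) z (weightMap t V) W -
        volumeForm (S i) (M i) z V (weightMap t W)) -
      Complex.I * (η * (cform G (weightMap t V) W - cform G V (weightMap t W))) := by
    simp only [localForm_apply, Finset.sum_sub_distrib]
    ring
  rw [hsplit, add_mul, Finset.mul_sum]
  grw [norm_sub_le, norm_sum_le, norm_mul, Complex.norm_I, one_mul, norm_mul,
    norm_boundary_comm_le hS hM hG hG' hk hη hτ hB V W]
  gcongr with i
  exact norm_volumeForm_comm_le (hS i) (hM i) hk hz (hT i) V W

lemma localForm_weighted_coercive (hG' : G'.PosSemidef) (hk : 0 < k) (hz : ‖z‖ ≤ 2 * k ^ 2)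
    (hη : ‖η‖ ≤ 2 * k) (hΘ : IsCoercivityMultiplier k z η Θ γ) (hτ : 0 ≤ τ)
    (hT : ∀ i V, energySeminorm (hS i) (hM i) k (weightMap t V - c i • V) ≤
      s * energySeminorm (hS i) (hM i) k V)
    (hB : ∀ x y : n → ℝ, |rform G x (t * y) - rform G' x y| ≤
      τ * ∑ i ∈ F, √(rform (M i) x x) * √(rform (M i) y y))
    (hc : ∀ i, 0 ≤ c i) (V : n → ℂ) :
    γ * ∑ i ∈ F, c i * energySeminorm (hS i) (hM i) k V ^ 2 ≤
      ‖localForm F S M G z η V (weightMap t V)‖ +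
        (3 * s + 8 * τ / k) * ∑ i ∈ F, energySeminorm (hS i) (hM i) k V ^ 2 := by
  have hsplit : (Θ * localForm F S M G z η V (weightMap t V)).re =
      ∑ i ∈ F, (Θ * volumeForm (S i) (M i) z V (weightMap t V)).re +
        (-(Θ * (Complex.I * η)) * cform G V (weightMap t V)).re := by
    rw [← Complex.re_sum, ← Complex.add_re, localForm_apply, ← Finset.mul_sum]
    congr 1
    ring
  have hre : (Θ * localForm F S M G z η V (weightMap t V)).re ≤
      ‖localForm F S M G z η V (weightMap t V)‖ := by
    grw [Complex.re_le_norm, norm_mul, hΘ.norm_le_one, one_mul]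
  have hvol := Finset.sum_le_sum fun i (_ : i ∈ F) =>
    volumeForm_weighted_coercive (hS i) (hM i) hk hz hΘ (hc i) (hT i) V
  rw [Finset.sum_sub_distrib, ← Finset.mul_sum, ← Finset.mul_sum] at hvol
  linarith [boundary_weighted_nonneg hS hM hG' hk hη hΘ hτ hB V]

theorem isWeightedLocalForm_localForm (hG : G.PosSemidef) (hG' : G'.PosSemidef) (hk : 0 < k)
    (hz : ‖z‖ ≤ 2 * k ^ 2) (hη : ‖η‖ ≤ 2 * k) (hΘ : IsCoercivityMultiplier k z η Θ γ)
    (hτ : 0 ≤ τ) (hs : 0 ≤ s)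
    (hT : ∀ i V, energySeminorm (hS i) (hM i) k (weightMap t V - c i • V) ≤
      s * energySeminorm (hS i) (hM i) k V)
    (hB : ∀ x y : n → ℝ, |rform G x (t * y) - rform G' x y| ≤
      τ * ∑ i ∈ F, √(rform (M i) x x) * √(rform (M i) y y))
    (hc : ∀ i, 0 ≤ c i) (hc0 : ∀ i ∉ F, c i = 0)
    (hT0 : ∀ i ∉ F, ∀ V, energySeminorm (hS i) (hM i) k (weightMap t V) = 0) :
    IsWeightedLocalForm (fun i => energySeminorm (hS i) (hM i) k) F (weightMap t) c
      (localForm F S M G z η) (6 * s + 16 * τ / k) γ where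
  weight_nonneg := hc
  weight_eq_zero := hc0
  seminorm_eq_zero := hT0
  commutator_le := norm_localForm_comm_le hS hM hG hG' hk hz hη hτ hT hB
  coercive := localForm_coercive hS hM hG hΘ
  seminorm_sub_le i V := by
    grw [hT i V]
    refine mul_le_mul_of_nonneg_right ?_ (apply_nonneg _ _)
    linarith [show 0 ≤ 16 * τ / k by positivity]
  weighted_coercive V := by
    grw [localForm_weighted_coercive hS hM hG' hk hz hη hΘ hτ hT hB hc V]
    have : 8 * τ / k ≤ 16 * τ / k := by gcongr; norm_num
    gcongr; linarith

end Subdomain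

end LocalForm

/-! ### Meshes and finite element functions -/

namespace Mesh

variable {d : ℕ} (T : Mesh d)

lemma isCompact_cell (i : Fin T.numElem) : IsCompact (T.cell i) := isCompact_cellOf _

lemma frontier_cell_eq (i : Fin T.numElem) :
    frontier (T.cell i) = T.cell i \ interior (T.cell i) :=
  (T.isCompact_cell i).isClosed.frontier_eq

lemma Ω_eq : T.Ω = interior (⋃ i ∈ (Finset.univ : Finset (Fin T.numElem)), T.cell i) := by
  simp [Ω]

lemma isOpen_Ω : IsOpen T.Ω := isOpen_interior

lemma isClosed_ΓD : IsClosed T.ΓD :=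
  T.dirichletFacets.finite_toSet.isClosed_biUnion fun _ _ => (isCompact_facetOf _ _).isClosed

lemma measurableSet_ΓI : MeasurableSet T.ΓI :=
  isClosed_frontier.measurableSet.diff T.isClosed_ΓD.measurableSet

lemma eq_of_mem_interior_of_mem {i j : Fin T.numElem} {y : E d} (hi : y ∈ interior (T.cell i))
    (hj : y ∈ T.cell j) : i = j := by
  by_contra hij
  rw [cell, ← closure_interior_cellOf] at hj
  obtain ⟨z, hz, hz'⟩ := mem_closure_iff.1 hj _ isOpen_interior hi
  exact (T.disjoint_interior_cell hij).notMem_of_mem_left hz hz'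

section Union

variable (F : Finset (Fin T.numElem))

lemma isClosed_biUnion_cell : IsClosed (⋃ i ∈ F, T.cell i) :=
  F.finite_toSet.isClosed_biUnion fun i _ => (T.isCompact_cell i).isClosed

lemma closure_interior_biUnion_cell_subset :
    closure (interior (⋃ i ∈ F, T.cell i)) ⊆ ⋃ i ∈ F, T.cell i :=
  (T.isClosed_biUnion_cell F).closure_subset_iff.2 interior_subset

variable {F}

lemma interior_cell_subset {i : Fin T.numElem} (hi : i ∈ F) :
    interior (T.cell i) ⊆ interior (⋃ i ∈ F, T.cell i) :=
  interior_mono (Set.subset_biUnion_of_mem (u := fun i => T.cell i) hi)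

lemma cell_subset_closure {i : Fin T.numElem} (hi : i ∈ F) :
    T.cell i ⊆ closure (interior (⋃ i ∈ F, T.cell i)) := by
  simpa only [cell, closure_interior_cellOf] using closure_mono (T.interior_cell_subset hi)

variable (F)

lemma frontier_interior_biUnion_cell_subset :
    frontier (interior (⋃ i ∈ F, T.cell i)) ⊆ ⋃ i ∈ F, frontier (T.cell i) := by
  rintro y ⟨hy, hy'⟩
  obtain ⟨i, hi, hyi⟩ := Set.mem_iUnion₂.1 (T.closure_interior_biUnion_cell_subset F hy)
  rw [interior_interior] at hy'
  refine Set.mem_iUnion₂.2 ⟨i, hi, ?_⟩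
  rw [frontier_cell_eq]
  exact ⟨hyi, fun h => hy' (T.interior_cell_subset hi h)⟩

lemma interior_biUnion_cell_ae_eq :
    interior (⋃ i ∈ F, T.cell i) =ᵐ[volume] ⋃ i ∈ F, interior (T.cell i) := by
  have hsub : (⋃ i ∈ F, interior (T.cell i)) ⊆ interior (⋃ i ∈ F, T.cell i) :=
    Set.iUnion₂_subset fun i hi => T.interior_cell_subset hi
  refine Filter.EventuallyLE.antisymm (ae_le_set.2 (measure_mono_null ?_ (measure_iUnion_null
    fun i => (convex_cellOf (T.elem i)).addHaar_frontier volume))) hsub.eventuallyLE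
  rintro y ⟨hy, hy'⟩
  obtain ⟨i, hi, hyi⟩ := Set.mem_iUnion₂.1 (interior_subset hy)
  refine Set.mem_iUnion.2 ⟨i, ?_⟩
  rw [← cell, frontier_cell_eq]
  exact ⟨hyi, fun h => hy' (Set.mem_iUnion₂.2 ⟨i, hi, h⟩)⟩

lemma setIntegral_interior_biUnion_cell {f : E d → ℝ} {g : Fin T.numElem → E d → ℝ}
    (hfg : ∀ i, ∀ y ∈ interior (T.cell i), f y = g i y)
    (hg : ∀ i, IntegrableOn (g i) (T.cell i)) :
    ∫ y in interior (⋃ i ∈ F, T.cell i), f y = ∑ i ∈ F, ∫ y in T.cell i, g i y := by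
  have hm (i) : MeasurableSet (interior (T.cell i)) := isOpen_interior.measurableSet
  rw [setIntegral_congr_set (T.interior_biUnion_cell_ae_eq F), integral_biUnion_finset F
    (fun i _ => hm i) (fun i _ j _ hij => T.disjoint_interior_cell hij) fun i _ =>
      ((hg i).mono_set interior_subset).congr_fun (fun y hy => (hfg i y hy).symm) (hm i)]
  refine Finset.sum_congr rfl fun i _ => ?_
  rw [setIntegral_congr_fun (hm i) (hfg i)]
  exact setIntegral_congr_set
    (interior_ae_eq_of_null_frontier ((convex_cellOf (T.elem i)).addHaar_frontier volume))

end Union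

lemma cell_subset_closure_Ω (i : Fin T.numElem) : T.cell i ⊆ closure T.Ω := by
  rw [Ω_eq]
  exact T.cell_subset_closure (Finset.mem_univ i)

lemma closure_Ω_subset : closure T.Ω ⊆ ⋃ i, T.cell i := by
  simpa only [Ω_eq, Finset.mem_univ, Set.iUnion_true] using
    T.closure_interior_biUnion_cell_subset Finset.univ

lemma isCompact_closure_Ω : IsCompact (closure T.Ω) :=
  (isCompact_iUnion T.isCompact_cell).of_isClosed_subset isClosed_closure T.closure_Ω_subset

end Mesh

namespace Setup

variable {d r : ℕ} {X : Finset (Fin d → ℝ)} (P : Setup d r X)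

lemma cell_subset_closure_Ωl {l : Fin P.N} {i : Fin P.mesh.numElem} (hi : i ∈ P.sub l) :
    P.mesh.cell i ⊆ closure (P.Ωl l) :=
  P.mesh.cell_subset_closure hi

lemma closure_Ωl_subset (l : Fin P.N) : closure (P.Ωl l) ⊆ ⋃ i ∈ P.sub l, P.mesh.cell i :=
  P.mesh.closure_interior_biUnion_cell_subset _

lemma Ωl_subset (l : Fin P.N) : P.Ωl l ⊆ P.mesh.Ω :=
  interior_mono (Set.iUnion₂_subset fun i _ => Set.subset_iUnion P.mesh.cell i)

lemma isOpen_Ωl (l : Fin P.N) : IsOpen (P.Ωl l) := isOpen_interior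

lemma exists_cell_of_notMem_Ωl {l : Fin P.N} {y : E d} (hy : y ∈ P.mesh.Ω) (hyl : y ∉ P.Ωl l) :
    ∃ i ∉ P.sub l, y ∈ P.mesh.cell i := by
  by_contra! hne
  have hnot : y ∉ ⋃ i ∈ (P.sub l)ᶜ, P.mesh.cell i := fun h => by
    obtain ⟨i, hi, hyi⟩ := Set.mem_iUnion₂.1 h
    exact hne i (Finset.mem_compl.1 hi) hyi
  refine hyl (mem_interior.2 ⟨P.mesh.Ω ∩ (⋃ i ∈ (P.sub l)ᶜ, P.mesh.cell i)ᶜ, ?_,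
    P.mesh.isOpen_Ω.inter (P.mesh.isClosed_biUnion_cell _).isOpen_compl, hy, hnot⟩)
  rintro z ⟨hz, hz'⟩
  obtain ⟨i, hi⟩ := Set.mem_iUnion.1 (interior_subset hz)
  by_cases hil : i ∈ P.sub l
  · exact Set.mem_iUnion₂.2 ⟨i, hil, hi⟩
  · exact absurd (Set.mem_iUnion₂.2 ⟨i, Finset.mem_compl.2 hil, hi⟩) hz'

section PartitionOfUnity

/-- The polynomial that represents the partition of unity function `χ_ℓ` on an element. -/
def χPoly (l : Fin P.N) (i : Fin P.mesh.numElem) : MvPolynomial (Fin d) ℝ :=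
  ((P.χ_poly l).2 i).choose

lemma χ_eq (l : Fin P.N) (i : Fin P.mesh.numElem) {y : E d} (hy : y ∈ P.mesh.cell i) :
    P.χ l y = polyFun (P.χPoly l i) y :=
  ((P.χ_poly l).2 i).choose_spec.2 y hy

lemma χ_eq_zero {l : Fin P.N} {i : Fin P.mesh.numElem} (hi : i ∉ P.sub l) {y : E d}
    (hy : y ∈ P.mesh.cell i) : P.χ l y = 0 := by
  have hint : Set.EqOn (polyFun (P.χPoly l i)) (fun _ => 0) (interior (P.mesh.cell i)) := by
    intro x hx
    have hxi := interior_subset hx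
    rw [← P.χ_eq l i hxi]
    by_contra hne
    obtain ⟨j, hj, hxj⟩ := Set.mem_iUnion₂.1 (P.closure_Ωl_subset l
      (P.χ_support l x (P.mesh.cell_subset_closure_Ω i hxi) hne))
    exact hi (P.mesh.eq_of_mem_interior_of_mem hx hxj ▸ hj)
  have hcl := hint.closure (continuous_polyFun _) continuous_const
  rw [Mesh.cell, closure_interior_cellOf] at hcl
  rw [P.χ_eq l i hy]
  exact hcl hy

lemma abs_χ_sub_le {l : Fin P.N} {i : Fin P.mesh.numElem} {B : ℝ}
    (h : ∀ x ∈ interior (P.mesh.cell i), ‖gradient (P.χ l) x‖ ≤ B) {x y : E d}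
    (hx : x ∈ P.mesh.cell i) (hy : y ∈ P.mesh.cell i) :
    |P.χ l x - P.χ l y| ≤ B * Metric.diam (P.mesh.cell i) := by
  rw [P.χ_eq l i hx, P.χ_eq l i hy]
  refine abs_polyFun_sub_le (P.mesh.elem i) (fun z hz => ?_) hx hy
  have heq : P.χ l =ᶠ[nhds z] polyFun (P.χPoly l i) := by
    filter_upwards [isOpen_interior.mem_nhds hz] with w hw
    exact P.χ_eq l i (interior_subset hw)
  rw [norm_gradient, ← heq.fderiv_eq, ← norm_gradient]
  exact h z hz

end PartitionOfUnity

/-- The finite element function `∑ x_p φ_p` with real coefficients `x`. -/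
def feFun (x : P.Idx → ℝ) (y : E d) : ℝ := ∑ p, x p * P.φ p y

/-- The polynomial that represents the basis function `φ_p` on an element. -/
def φPoly (i : Fin P.mesh.numElem) (p : P.Idx) : MvPolynomial (Fin d) ℝ :=
  ((P.φ_poly p).2 i).choose

/-- The polynomial that represents the finite element function with coefficients `x` on an
element. -/
def fePoly (i : Fin P.mesh.numElem) (x : P.Idx → ℝ) : MvPolynomial (Fin d) ℝ :=
  ∑ p, x p • P.φPoly i p

section FiniteElementFunctions

lemma totalDegree_φPoly (i : Fin P.mesh.numElem) (p : P.Idx) :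
    (P.φPoly i p).totalDegree ≤ r - 1 :=
  ((P.φ_poly p).2 i).choose_spec.1

lemma φ_eq (i : Fin P.mesh.numElem) (p : P.Idx) {y : E d} (hy : y ∈ P.mesh.cell i) :
    P.φ p y = polyFun (P.φPoly i p) y :=
  ((P.φ_poly p).2 i).choose_spec.2 y hy

lemma gradient_φ_eq (i : Fin P.mesh.numElem) (p : P.Idx) {y : E d}
    (hy : y ∈ interior (P.mesh.cell i)) :
    gradient (P.φ p) y = gradient (polyFun (P.φPoly i p)) y := by
  have heq : P.φ p =ᶠ[nhds y] polyFun (P.φPoly i p) := by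
    filter_upwards [isOpen_interior.mem_nhds hy] with w hw
    exact P.φ_eq i p (interior_subset hw)
  simp only [gradient, heq.fderiv_eq]

lemma totalDegree_fePoly (i : Fin P.mesh.numElem) (x : P.Idx → ℝ) :
    (P.fePoly i x).totalDegree ≤ r - 1 :=
  MvPolynomial.totalDegree_finsetSum_le fun p _ =>
    (MvPolynomial.totalDegree_smul_le _ _).trans (P.totalDegree_φPoly i p)

lemma polyFun_fePoly (i : Fin P.mesh.numElem) (x : P.Idx → ℝ) (y : E d) :
    polyFun (P.fePoly i x) y = ∑ p, x p * polyFun (P.φPoly i p) y := by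
  simp [fePoly, polyFun_sum, polyFun_smul]

lemma gradient_fePoly (i : Fin P.mesh.numElem) (x : P.Idx → ℝ) (y : E d) :
    gradient (polyFun (P.fePoly i x)) y = ∑ p, x p • gradient (polyFun (P.φPoly i p)) y := by
  have hdiff (p) : DifferentiableAt ℝ (polyFun (P.φPoly i p)) y :=
    (differentiable_polyFun _).differentiableAt
  have hfd : fderiv ℝ (polyFun (P.fePoly i x)) y =
      ∑ p, x p • fderiv ℝ (polyFun (P.φPoly i p)) y := by
    rw [funext (P.polyFun_fePoly i x), fderiv_fun_sum fun p _ => (hdiff p).const_mul _]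
    exact Finset.sum_congr rfl fun p _ => fderiv_const_mul (hdiff p) _
  simp only [gradient, hfd, map_sum, map_smul]

lemma feFun_eq (i : Fin P.mesh.numElem) (x : P.Idx → ℝ) {y : E d} (hy : y ∈ P.mesh.cell i) :
    P.feFun x y = polyFun (P.fePoly i x) y := by
  rw [polyFun_fePoly, feFun]
  exact Finset.sum_congr rfl fun p _ => by rw [P.φ_eq i p hy]

lemma feFun_node (x : P.Idx → ℝ) (p : P.Idx) : P.feFun x p = x p := by
  simp [feFun, P.φ_nodal]

lemma feFun_dirichlet (x : P.Idx → ℝ) {y : E d} (hy : y ∈ P.mesh.ΓD) : P.feFun x y = 0 := by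
  simp [feFun, P.φ_dirichlet _ y hy]

lemma refPoint_mem_nodes (i : Fin P.mesh.numElem) {ξ : Fin d → ℝ} (hξ : ξ ∈ X)
    (h : refPoint (P.mesh.elem i) ξ ∉ P.mesh.ΓD) :
    refPoint (P.mesh.elem i) ξ ∈ P.mesh.nodes X := by
  classical
  simp only [Mesh.nodes, Finset.mem_filter, Finset.mem_image, Finset.mem_product]
  exact ⟨⟨(i, ξ), ⟨Finset.mem_univ _, hξ⟩, rfl⟩, h⟩

lemma feFun_weight_refPoint (i : Fin P.mesh.numElem) {ξ : Fin d → ℝ} (hξ : ξ ∈ X) (w : E d → ℝ)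
    (x : P.Idx → ℝ) :
    P.feFun (fun p => w p * x p) (refPoint (P.mesh.elem i) ξ) =
      w (refPoint (P.mesh.elem i) ξ) * P.feFun x (refPoint (P.mesh.elem i) ξ) := by
  by_cases h : refPoint (P.mesh.elem i) ξ ∈ P.mesh.ΓD
  · rw [P.feFun_dirichlet _ h, P.feFun_dirichlet _ h, mul_zero]
  · let p : P.Idx := ⟨_, P.refPoint_mem_nodes i hξ h⟩
    rw [P.feFun_node (fun p => w p * x p) p, P.feFun_node x p]

section Unisolvence

variable {P} (hX : IsReferenceNodeSet (r - 1) X)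
include hX

lemma exists_cell_of_node (p : P.Idx) : ∃ i, (p : E d) ∈ P.mesh.cell i := by
  classical
  have hp := p.2
  simp only [Mesh.nodes, Finset.mem_filter, Finset.mem_image, Finset.mem_product] at hp
  obtain ⟨⟨⟨i, ξ⟩, ⟨-, hξ⟩, h⟩, -⟩ := hp
  exact ⟨i, h ▸ refPoint_mem_cellOf _ ξ (hX.1 ξ hξ).1 (hX.1 ξ hξ).2⟩

lemma φPoly_eq_zero {i : Fin P.mesh.numElem} {p : P.Idx} (hp : (p : E d) ∉ P.mesh.cell i) :
    P.φPoly i p = 0 := by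
  refine eq_zero_of_nodal_eq_zero hX (P.mesh.elem i) (P.totalDegree_φPoly i p) fun ξ hξ => ?_
  have hmem : refPoint (P.mesh.elem i) ξ ∈ P.mesh.cell i :=
    refPoint_mem_cellOf _ ξ (hX.1 ξ hξ).1 (hX.1 ξ hξ).2
  rw [← P.φ_eq i p hmem]
  by_cases hD : refPoint (P.mesh.elem i) ξ ∈ P.mesh.ΓD
  · exact P.φ_dirichlet p _ hD
  · refine (P.φ_nodal p ⟨_, P.refPoint_mem_nodes i hξ hD⟩).trans (if_neg ?_)
    rintro rfl
    exact hp hmem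

lemma φPoly_eq_zero_of_χ_ne_zero {l : Fin P.N} {p : P.Idx} (hp : P.χ l p ≠ 0)
    {i : Fin P.mesh.numElem} (hi : i ∉ P.sub l) : P.φPoly i p = 0 :=
  φPoly_eq_zero hX fun h => hp (P.χ_eq_zero hi h)

lemma fePoly_weight_eq_zero {l : Fin P.N} {i : Fin P.mesh.numElem} (hi : i ∉ P.sub l)
    (x : P.Idx → ℝ) : P.fePoly i (fun p => P.χ l p * x p) = 0 := by
  refine Finset.sum_eq_zero fun p _ => ?_
  by_cases hp : P.χ l p = 0
  · simp [hp]
  · simp [φPoly_eq_zero_of_χ_ne_zero hX hp hi]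

end Unisolvence

end FiniteElementFunctions

end Setup

/-! ### Element and boundary matrices -/

lemma rform_integral {n α : Type*} [Fintype n] [MeasurableSpace α] {μ : Measure α}
    {b : n → n → α → ℝ} {M : Matrix n n ℝ} (hM : ∀ p q, M p q = ∫ y, b p q y ∂μ)
    (hb : ∀ p q, Integrable (b p q) μ) (x x' : n → ℝ) :
    rform M x x' = ∫ y, ∑ p, ∑ q, x' p * (b p q y * x q) ∂μ := by
  have hint (p q) : Integrable (fun y => x' p * (b p q y * x q)) μ :=
    ((hb p q).mul_const _).const_mul _
  rw [rform_eq_sum, integral_finsetSum _ fun p _ => integrable_finsetSum _ fun q _ => hint p q]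
  refine Finset.sum_congr rfl fun p _ => ?_
  rw [integral_finsetSum _ fun q _ => hint p q]
  simp only [hM, integral_const_mul, integral_mul_const]

lemma posSemidef_of_rform_nonneg {n : Type*} [Fintype n] {M : Matrix n n ℝ}
    (h : ∀ p q, M p q = M q p) (h0 : ∀ x, 0 ≤ rform M x x) : M.PosSemidef := by
  refine Matrix.PosSemidef.of_dotProduct_mulVec_nonneg ?_ h0
  ext p q
  exact h q p

namespace Setup

variable {d r : ℕ} {X : Finset (Fin d → ℝ)} (P : Setup d r X)

/-- The stiffness matrix of an element. -/
def elemStiffness (i : Fin P.mesh.numElem) : Matrix P.Idx P.Idx ℝ := fun p q =>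
  ∫ y in P.mesh.cell i,
    inner ℝ (gradient (polyFun (P.φPoly i p)) y) (gradient (polyFun (P.φPoly i q)) y)

/-- The mass matrix of an element. -/
def elemMass (i : Fin P.mesh.numElem) : Matrix P.Idx P.Idx ℝ := fun p q =>
  ∫ y in P.mesh.cell i, polyFun (P.φPoly i p) y * polyFun (P.φPoly i q) y

/-- The part of the boundary of `Ω_ℓ` on which the local problem has an impedance condition. -/
def locBdry (l : Fin P.N) : Set (E d) := frontier (P.Ωl l) \ P.mesh.ΓD

/-- The boundary mass matrix of the local problem on `Ω_ℓ` with the weight `w`. -/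
def bdryMass (l : Fin P.N) (w : E d → ℝ) : Matrix P.Idx P.Idx ℝ := fun p q =>
  ∫ y in P.locBdry l, w y * (P.φ p y * P.φ q y) ∂(μHE[d - 1])

section ElementMatrices

variable (i : Fin P.mesh.numElem)

lemma rform_elemStiffness (x x' : P.Idx → ℝ) :
    rform (P.elemStiffness i) x x' = ∫ y in P.mesh.cell i,
      inner ℝ (gradient (polyFun (P.fePoly i x')) y) (gradient (polyFun (P.fePoly i x)) y) := by
  refine (rform_integral (fun _ _ => rfl) (fun p q => integrableOn_gradient_inner _ _
    (P.mesh.isCompact_cell i)) x x').trans (integral_congr_ae (.of_forall fun y => ?_))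
  simp only [gradient_fePoly, sum_inner]
  refine Finset.sum_congr rfl fun p _ => (inner_sum _ _ _).trans ?_ |>.symm
  exact Finset.sum_congr rfl fun q _ => by rw [real_inner_smul_left, real_inner_smul_right]; ring

lemma rform_elemMass (x x' : P.Idx → ℝ) :
    rform (P.elemMass i) x x' = ∫ y in P.mesh.cell i,
      polyFun (P.fePoly i x') y * polyFun (P.fePoly i x) y := by
  refine (rform_integral (fun _ _ => rfl) (fun p q => integrableOn_polyFun_mul _ _
    (P.mesh.isCompact_cell i)) x x').trans (integral_congr_ae (.of_forall fun y => ?_))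
  simp only [polyFun_fePoly, Finset.sum_mul_sum]
  exact Finset.sum_congr rfl fun p _ => Finset.sum_congr rfl fun q _ => by ring

lemma posSemidef_elemStiffness : (P.elemStiffness i).PosSemidef := by
  refine posSemidef_of_rform_nonneg (fun p q => ?_) fun x => ?_
  · simp only [elemStiffness, real_inner_comm]
  · rw [rform_elemStiffness]
    exact integral_nonneg fun y => real_inner_self_nonneg

lemma posSemidef_elemMass : (P.elemMass i).PosSemidef := by
  refine posSemidef_of_rform_nonneg (fun p q => ?_) fun x => ?_
  · simp only [elemMass, mul_comm]
  · rw [rform_elemMass]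
    exact integral_nonneg fun y => mul_self_nonneg _

lemma integral_gradient_eq_sum (F : Finset (Fin P.mesh.numElem)) (p q : P.Idx) :
    ∫ y in interior (⋃ i ∈ F, P.mesh.cell i), inner ℝ (gradient (P.φ p) y) (gradient (P.φ q) y) =
      ∑ i ∈ F, P.elemStiffness i p q :=
  P.mesh.setIntegral_interior_biUnion_cell F
    (fun i y hy => by rw [P.gradient_φ_eq i p hy, P.gradient_φ_eq i q hy])
    fun i => integrableOn_gradient_inner _ _ (P.mesh.isCompact_cell i)

lemma integral_mul_eq_sum (F : Finset (Fin P.mesh.numElem)) (p q : P.Idx) :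
    ∫ y in interior (⋃ i ∈ F, P.mesh.cell i), P.φ p y * P.φ q y = ∑ i ∈ F, P.elemMass i p q :=
  P.mesh.setIntegral_interior_biUnion_cell F
    (fun i y hy => by rw [P.φ_eq i p (interior_subset hy), P.φ_eq i q (interior_subset hy)])
    fun i => integrableOn_polyFun_mul _ _ (P.mesh.isCompact_cell i)

lemma stiffness_eq_sum : P.stiffness = ∑ i, P.elemStiffness i := by
  ext p q
  rw [stiffness, Mesh.Ω_eq, integral_gradient_eq_sum, Matrix.sum_apply]

lemma mass_eq_sum : P.mass = ∑ i, P.elemMass i := by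
  ext p q
  rw [mass, Mesh.Ω_eq, integral_mul_eq_sum, Matrix.sum_apply]

lemma Dk_eq_sum (k : ℝ) :
    P.Dk k = (∑ i, (P.elemStiffness i + k ^ 2 • P.elemMass i)).map fun t => (t : ℂ) := by
  rw [Dk, stiffness_eq_sum, mass_eq_sum, Finset.sum_add_distrib, Finset.smul_sum]

end ElementMatrices

section BoundaryMatrices

lemma measurableSet_locBdry (l : Fin P.N) : MeasurableSet (P.locBdry l) :=
  isClosed_frontier.measurableSet.diff P.mesh.isClosed_ΓD.measurableSet

lemma locBdry_subset (l : Fin P.N) :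
    P.locBdry l ⊆ ⋃ i ∈ P.sub l, frontier (P.mesh.cell i) :=
  Set.sdiff_subset.trans (P.mesh.frontier_interior_biUnion_cell_subset _)

lemma locBdry_subset_closure_Ω (l : Fin P.N) : P.locBdry l ⊆ closure P.mesh.Ω := fun _ hy =>
  closure_mono (P.Ωl_subset l) hy.1.1

lemma hausdorff_locBdry_ne_top (hd : 1 ≤ d) (l : Fin P.N) :
    (μHE[d - 1] : Measure (E d)) (P.locBdry l) ≠ ⊤ := by
  obtain ⟨C, -, hC⟩ := exists_hausdorff_frontier_cellOf_le hd
  exact measure_ne_top_of_subset (P.locBdry_subset l) (measure_biUnion_lt_top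
    (P.sub l).finite_toSet fun i _ => (hC (P.mesh.elem i)).trans_lt ENNReal.ofReal_lt_top).ne

lemma continuousOn_feFun (x : P.Idx → ℝ) : ContinuousOn (P.feFun x) (closure P.mesh.Ω) :=
  continuousOn_finsetSum _ fun p _ => continuousOn_const.mul (P.φ_poly p).1

lemma integrableOn_locBdry (hd : 1 ≤ d) (l : Fin P.N) {f : E d → ℝ}
    (hf : ContinuousOn f (closure P.mesh.Ω)) : IntegrableOn f (P.locBdry l) μHE[d - 1] :=
  hf.integrableOn_of_subset_isCompact P.mesh.isCompact_closure_Ω (P.measurableSet_locBdry l)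
    (P.locBdry_subset_closure_Ω l) (P.hausdorff_locBdry_ne_top hd l)

lemma rform_bdryMass (hd : 1 ≤ d) (l : Fin P.N) {w : E d → ℝ}
    (hw : ContinuousOn w (closure P.mesh.Ω)) (x x' : P.Idx → ℝ) :
    rform (P.bdryMass l w) x x' =
      ∫ y in P.locBdry l, w y * (P.feFun x' y * P.feFun x y) ∂(μHE[d - 1]) := by
  refine (rform_integral (fun _ _ => rfl) (fun p q => P.integrableOn_locBdry hd l
    (hw.mul ((P.φ_poly p).1.mul (P.φ_poly q).1))) x x').trans
      (integral_congr_ae (.of_forall fun y => ?_))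
  simp only [feFun, Pi.mul_apply]
  rw [Finset.sum_mul_sum, Finset.mul_sum]
  refine Finset.sum_congr rfl fun p _ => (Finset.mul_sum _ _ _).trans ?_ |>.symm
  exact Finset.sum_congr rfl fun q _ => by ring

lemma posSemidef_bdryMass (hd : 1 ≤ d) (l : Fin P.N) {w : E d → ℝ}
    (hw : ContinuousOn w (closure P.mesh.Ω)) (hw0 : ∀ y ∈ closure P.mesh.Ω, 0 ≤ w y) :
    (P.bdryMass l w).PosSemidef := by
  refine posSemidef_of_rform_nonneg (fun p q => ?_) fun x => ?_
  · simp only [bdryMass, mul_comm (P.φ p _)]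
  · rw [P.rform_bdryMass hd l hw]
    exact setIntegral_nonneg (P.measurableSet_locBdry l) fun y hy =>
      mul_nonneg (hw0 y (P.locBdry_subset_closure_Ω l hy)) (mul_self_nonneg _)

end BoundaryMatrices

section Localisation

variable {P} {l : Fin P.N}

lemma exists_cell_of_mem_ΓI_of_notMem_locBdry {y : E d} (hy : y ∈ P.mesh.ΓI)
    (hyl : y ∉ P.locBdry l) : ∃ i ∉ P.sub l, y ∈ P.mesh.cell i := by
  obtain ⟨⟨hycl, hyΩ⟩, hyD⟩ := hy
  obtain ⟨i, hi⟩ := Set.mem_iUnion.1 (P.mesh.closure_Ω_subset hycl)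
  rw [P.mesh.isOpen_Ω.interior_eq] at hyΩ
  refine ⟨i, fun hil => hyl ⟨⟨P.cell_subset_closure_Ωl hil hi, fun h => ?_⟩, hyD⟩, hi⟩
  exact hyΩ (P.Ωl_subset l (interior_subset h))

lemma exists_cell_of_mem_locBdry_of_notMem_ΓI {y : E d} (hy : y ∈ P.locBdry l)
    (hyI : y ∉ P.mesh.ΓI) : ∃ i ∉ P.sub l, y ∈ P.mesh.cell i := by
  have hyl : y ∉ P.Ωl l := fun h => hy.1.2 ((P.isOpen_Ωl l).interior_eq.symm ▸ h)
  refine P.exists_cell_of_notMem_Ωl (by_contra fun h => hyI ⟨⟨?_, ?_⟩, hy.2⟩) hyl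
  · exact P.locBdry_subset_closure_Ω l hy
  · rwa [P.mesh.isOpen_Ω.interior_eq]

lemma setIntegral_ΓI_eq_of_vanish {f : E d → ℝ}
    (hf : ∀ i ∉ P.sub l, ∀ y ∈ P.mesh.cell i, f y = 0) (μ : Measure (E d)) :
    ∫ y in P.mesh.ΓI, f y ∂μ = ∫ y in P.locBdry l, f y ∂μ := by
  rw [← integral_indicator P.mesh.measurableSet_ΓI, ← integral_indicator
    (P.measurableSet_locBdry l)]
  congr 1 with y
  by_cases hI : y ∈ P.mesh.ΓI <;> by_cases hl : y ∈ P.locBdry l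
  · simp [hI, hl]
  · obtain ⟨i, hi, hyi⟩ := exists_cell_of_mem_ΓI_of_notMem_locBdry hI hl
    rw [Set.indicator_of_mem hI, Set.indicator_of_notMem hl, hf i hi y hyi]
  · obtain ⟨i, hi, hyi⟩ := exists_cell_of_mem_locBdry_of_notMem_ΓI hl hI
    rw [Set.indicator_of_notMem hI, Set.indicator_of_mem hl, hf i hi y hyi]
  · simp [hI, hl]

/-- The matrix of the local problem on `Ω_ℓ`, with the indices of all nodes. -/
def locMatrix (P : Setup d r X) (k ε : ℝ) (η : ℂ) (l : Fin P.N) : Matrix P.Idx P.Idx ℂ :=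
  fun p q => helmholtzForm (P.Ωl l) (P.locBdry l) k ε η (P.φ q) (P.φ p)

lemma helmholtzForm_eq_sum (F : Finset (Fin P.mesh.numElem)) (G : Set (E d)) (k ε : ℝ) (η : ℂ)
    (p q : P.Idx) :
    helmholtzForm (interior (⋃ i ∈ F, P.mesh.cell i)) G k ε η (P.φ q) (P.φ p) =
      ((∑ i ∈ F, P.elemStiffness i p q : ℝ) : ℂ) -
        ((k : ℂ) ^ 2 + Complex.I * ε) * ((∑ i ∈ F, P.elemMass i p q : ℝ) : ℂ) -
        Complex.I * η * ((∫ y in G, P.φ q y * P.φ p y ∂(μHE[d - 1]) : ℝ) : ℂ) := by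
  simp only [helmholtzForm, ← integral_gradient_eq_sum, ← integral_mul_eq_sum,
    real_inner_comm (gradient (P.φ p) _), mul_comm (P.φ q _)]

lemma χ_mul_A (hX : IsReferenceNodeSet (r - 1) X) (k ε : ℝ) (η : ℂ) (l : Fin P.N) (p q : P.Idx) :
    (P.χ l p : ℂ) * P.A k ε η p q = P.χ l p * P.locMatrix k ε η l p q := by
  by_cases hp : P.χ l p = 0
  · simp [hp]
  have hvan (i) (hi : i ∉ P.sub l) : P.φPoly i p = 0 := φPoly_eq_zero_of_χ_ne_zero hX hp hi
  have hS (i) (hi : i ∉ P.sub l) : P.elemStiffness i p q = 0 := by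
    simp [elemStiffness, hvan i hi, gradient_polyFun_zero]
  have hM (i) (hi : i ∉ P.sub l) : P.elemMass i p q = 0 := by
    simp [elemMass, hvan i hi, polyFun_zero]
  have hB : ∀ i ∉ P.sub l, ∀ y ∈ P.mesh.cell i, P.φ q y * P.φ p y = 0 := fun i hi y hy => by
    rw [P.φ_eq i p hy, hvan i hi, polyFun_zero, Pi.zero_apply, mul_zero]
  rw [A, locMatrix, Mesh.Ω_eq, Ωl, helmholtzForm_eq_sum, helmholtzForm_eq_sum,
    setIntegral_ΓI_eq_of_vanish hB,
    Finset.sum_subset (Finset.subset_univ (P.sub l)) fun i _ => hS i,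
    Finset.sum_subset (Finset.subset_univ (P.sub l)) fun i _ => hM i]

end Localisation

end Setup

/-! ### Estimates for the partition of unity -/

lemma Mesh.ShapeRegular.exists_hasInball {d : ℕ} (hd : 1 ≤ d) {T : Mesh d} {K : ℝ} (hK : 0 ≤ K)
    (hT : T.ShapeRegular K) (i : Fin T.numElem) : ∃ ρ, HasInball K (T.elem i) ρ := by
  obtain ⟨x₀, ρ, hball, hdiam⟩ := hT i
  have hpos : 0 < K * ρ := (diam_cellOf_pos (T.elem i) hd).trans_le hdiam
  exact ⟨ρ, pos_of_mul_pos_right hpos hK, hdiam, x₀, hball⟩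

lemma Mesh.diam_cell_le_h {d : ℕ} (T : Mesh d) (i : Fin T.numElem) :
    Metric.diam (T.cell i) ≤ T.h :=
  le_ciSup (f := fun i => Metric.diam (T.cell i)) (Set.finite_range _).bddAbove i

namespace Setup

variable {d r : ℕ} {X : Finset (Fin d → ℝ)} {P : Setup d r X} {K : ℝ}

lemma abs_χ_sub_le_of_regular (hK : 0 ≤ K) (hP : P.Regular K) (hδ : 0 < P.δ) (l : Fin P.N)
    {i : Fin P.mesh.numElem} {x y : E d} (hx : x ∈ P.mesh.cell i) (hy : y ∈ P.mesh.cell i) :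
    |P.χ l x - P.χ l y| ≤ K / P.δ * Metric.diam (P.mesh.cell i) := by
  refine P.abs_χ_sub_le (fun z hz => (hP.2.2.2.2 l i z hz).trans ?_) hx hy
  have : P.δ ≤ P.δl l := ciInf_le (Set.finite_range _).bddBelow l
  gcongr

lemma nodallyLE_weight_sub (hX : IsReferenceNodeSet (r - 1) X) (hK : 0 ≤ K) (hP : P.Regular K)
    (hδ : 0 < P.δ) (l : Fin P.N) {i : Fin P.mesh.numElem} {z : E d} (hz : z ∈ P.mesh.cell i)
    (x : P.Idx → ℝ) :
    NodallyLE X (P.mesh.elem i) (K / P.δ * Metric.diam (P.mesh.cell i))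
      (P.fePoly i fun p => (P.χ l p - P.χ l z) * x p) (P.fePoly i x) := by
  intro ξ hξ
  have hmem : refPoint (P.mesh.elem i) ξ ∈ P.mesh.cell i :=
    refPoint_mem_cellOf _ ξ (hX.1 ξ hξ).1 (hX.1 ξ hξ).2
  rw [← P.feFun_eq i _ hmem, ← P.feFun_eq i _ hmem,
    P.feFun_weight_refPoint i hξ fun y => P.χ l y - P.χ l z, abs_mul]
  exact mul_le_mul_of_nonneg_right (abs_χ_sub_le_of_regular hK hP hδ l hmem hz) (abs_nonneg _)

/-- The energy seminorm of an element. -/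
def elemSeminorm (P : Setup d r X) (k : ℝ) (i : Fin P.mesh.numElem) : Seminorm ℝ (P.Idx → ℂ) :=
  energySeminorm (P.posSemidef_elemStiffness i) (P.posSemidef_elemMass i) k

lemma rform_elemStiffness_self (i : Fin P.mesh.numElem) (x : P.Idx → ℝ) :
    rform (P.elemStiffness i) x x =
      ∫ y in P.mesh.cell i, ‖gradient (polyFun (P.fePoly i x)) y‖ ^ 2 := by
  simp only [rform_elemStiffness, real_inner_self_eq_norm_sq]

lemma rform_elemMass_self (i : Fin P.mesh.numElem) (x : P.Idx → ℝ) :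
    rform (P.elemMass i) x x = ∫ y in P.mesh.cell i, polyFun (P.fePoly i x) y ^ 2 := by
  simp only [rform_elemMass, pow_two]

lemma exists_rform_energy_le_of_nodallyLE (hX : IsReferenceNodeSet (r - 1) X) (hK : 0 ≤ K) :
    ∃ C : ℝ, 0 < C ∧ ∀ (P : Setup d r X) (k : ℝ) (i : Fin P.mesh.numElem) (ρ : ℝ),
      HasInball K (P.mesh.elem i) ρ → ∀ (x x' : P.Idx → ℝ) (θ : ℝ), 0 ≤ θ →
        NodallyLE X (P.mesh.elem i) θ (P.fePoly i x') (P.fePoly i x) →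
          rform (P.elemStiffness i + k ^ 2 • P.elemMass i) x' x' ≤
            C * ((θ / ρ) ^ 2 + (k * θ) ^ 2) * rform (P.elemMass i) x x := by
  obtain ⟨C₁, hC₁, hgrad⟩ := exists_integral_gradient_sq_le_of_nodallyLE hX hK
  obtain ⟨C₂, hC₂, hmass⟩ := exists_integral_sq_le_of_nodallyLE hX hK
  refine ⟨C₁ + C₂, by positivity, fun P k i ρ hρ x x' θ hθ hnodal => ?_⟩
  have hS := hgrad _ _ hρ _ _ (P.totalDegree_fePoly i _) (P.totalDegree_fePoly i x) θ hθ hnodal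
  have hM := hmass _ _ hρ _ _ (P.totalDegree_fePoly i _) (P.totalDegree_fePoly i x) θ hθ hnodal
  have hI := rform_nonneg (P.posSemidef_elemMass i) x
  rw [rform_add_mat, rform_smul_mat, rform_elemStiffness_self, P.rform_elemMass_self i x']
  rw [← Mesh.cell, ← P.rform_elemMass_self i x] at hS hM
  calc _ ≤ C₁ * (θ / ρ) ^ 2 * rform (P.elemMass i) x x +
        k ^ 2 * (C₂ * θ ^ 2 * rform (P.elemMass i) x x) := by gcongr
    _ = (C₁ * (θ / ρ) ^ 2 + C₂ * (k * θ) ^ 2) * rform (P.elemMass i) x x := by ring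
    _ ≤ ((C₁ + C₂) * (θ / ρ) ^ 2 + (C₁ + C₂) * (k * θ) ^ 2) * rform (P.elemMass i) x x := by
      gcongr <;> linarith
    _ = (C₁ + C₂) * ((θ / ρ) ^ 2 + (k * θ) ^ 2) * rform (P.elemMass i) x x := by ring

lemma exists_elemSeminorm_weight_sub_le (hd : 1 ≤ d) (hX : IsReferenceNodeSet (r - 1) X)
    (hK : 0 < K) :
    ∃ C : ℝ, 0 < C ∧ ∀ (P : Setup d r X) (k : ℝ), 0 < k → P.Regular K → 0 < P.δ →
      k * P.mesh.h ≤ K → ∀ l i, ∀ z ∈ P.mesh.cell i, ∀ V,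
        P.elemSeminorm k i (weightMap (fun p : P.Idx => P.χ l p) V - P.χ l z • V) ≤
          C / (k * P.δ) * P.elemSeminorm k i V := by
  obtain ⟨C, hC, henergy⟩ := exists_rform_energy_le_of_nodallyLE (d := d) (r := r) hX hK.le
  refine ⟨√(2 * C) * K ^ 2, by positivity, fun P k hk hP hδ hkh l i z hz =>
    formSeminorm_weightMap_sub_le ((P.posSemidef_elemStiffness i).add
      ((P.posSemidef_elemMass i).smul (sq_nonneg k))) (by positivity) fun x => ?_⟩
  obtain ⟨ρ, hρ⟩ := hP.1.exists_hasInball hd hK.le i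
  set θ := K / P.δ * Metric.diam (P.mesh.cell i)
  have hθ : 0 ≤ θ := mul_nonneg (by positivity) Metric.diam_nonneg
  have hθρ0 : 0 ≤ θ / ρ := div_nonneg hθ hρ.pos.le
  have hθρ : θ / ρ ≤ K ^ 2 / P.δ := by
    rw [div_le_iff₀ hρ.pos]
    calc θ ≤ K / P.δ * (K * ρ) := mul_le_mul_of_nonneg_left hρ.diam_le (by positivity)
      _ = K ^ 2 / P.δ * ρ := by ring
  have hkθ : k * θ ≤ K ^ 2 / P.δ := by
    calc k * θ = K / P.δ * (k * Metric.diam (P.mesh.cell i)) := by ring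
      _ ≤ K / P.δ * K := by grw [P.mesh.diam_cell_le_h i, hkh]
      _ = K ^ 2 / P.δ := by ring
  have hS := rform_nonneg (P.posSemidef_elemStiffness i) x
  have hM := rform_nonneg (P.posSemidef_elemMass i) x
  calc _ ≤ C * ((θ / ρ) ^ 2 + (k * θ) ^ 2) * rform (P.elemMass i) x x :=
        henergy P k i ρ hρ x _ θ hθ (nodallyLE_weight_sub hX hK.le hP hδ l hz x)
    _ ≤ C * ((K ^ 2 / P.δ) ^ 2 + (K ^ 2 / P.δ) ^ 2) * rform (P.elemMass i) x x := by gcongr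
    _ = (√(2 * C) * K ^ 2 / (k * P.δ)) ^ 2 * (k ^ 2 * rform (P.elemMass i) x x) := by
      rw [div_pow (√(2 * C) * K ^ 2), mul_pow, Real.sq_sqrt (by positivity)]
      field_simp
      ring
    _ ≤ _ := by
      rw [rform_add_mat, rform_smul_mat]
      exact mul_le_mul_of_nonneg_left (le_add_of_nonneg_left hS) (sq_nonneg _)

lemma feFun_weight_sub (l : Fin P.N) (x : P.Idx → ℝ) (z : E d) :
    P.feFun (fun p => (P.χ l p - P.χ l z) * x p) z =
      P.feFun (fun p => P.χ l p * x p) z - P.χ l z * P.feFun x z := by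
  simp only [feFun, Finset.mul_sum, ← Finset.sum_sub_distrib]
  exact Finset.sum_congr rfl fun p _ => by ring

lemma rform_bdryMass_weight_sub (hd : 1 ≤ d) (l : Fin P.N) (x y : P.Idx → ℝ) :
    rform (P.bdryMass l 1) x ((fun p : P.Idx => P.χ l p) * y) - rform (P.bdryMass l (P.χ l)) x y =
      ∫ z in P.locBdry l,
        P.feFun (fun p => (P.χ l p - P.χ l z) * y p) z * P.feFun x z ∂(μHE[d - 1]) := by
  have hcont (x') : ContinuousOn (P.feFun x' * P.feFun x) (closure P.mesh.Ω) :=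
    (P.continuousOn_feFun x').mul (P.continuousOn_feFun x)
  have hone : ContinuousOn (1 : E d → ℝ) (closure P.mesh.Ω) := continuousOn_const
  have hχ := (P.χ_poly l).1
  rw [P.rform_bdryMass hd l hone, P.rform_bdryMass hd l hχ]
  refine (integral_sub (P.integrableOn_locBdry hd l (hone.mul (hcont _)))
    (P.integrableOn_locBdry hd l (hχ.mul (hcont y)))).symm.trans (integral_congr_ae ?_)
  refine .of_forall fun z => ?_
  simp only [feFun_weight_sub, Pi.one_apply, Pi.mul_def]
  ring

lemma exists_abs_feFun_weight_sub_mul_le (hX : IsReferenceNodeSet (r - 1) X) (hK : 0 ≤ K) :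
    ∃ C : ℝ, 0 < C ∧ ∀ P : Setup d r X, P.Regular K → 0 < P.δ → ∀ l i ρ,
      HasInball K (P.mesh.elem i) ρ → ∀ z ∈ P.mesh.cell i, ∀ x y : P.Idx → ℝ,
        |P.feFun (fun p => (P.χ l p - P.χ l z) * y p) z * P.feFun x z| ≤
          C * (K / P.δ * Metric.diam (P.mesh.cell i)) * (ρ ^ d)⁻¹ *
            (√(rform (P.elemMass i) x x) * √(rform (P.elemMass i) y y)) := by
  obtain ⟨C, hC, hbound⟩ := exists_abs_le_of_nodallyLE hX K
  refine ⟨C ^ 2, by positivity, fun P hP hδ l i ρ hρ z hz x y => ?_⟩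
  set θ := K / P.δ * Metric.diam (P.mesh.cell i)
  have hθ : 0 ≤ θ := mul_nonneg (by positivity) Metric.diam_nonneg
  have hρd : 0 ≤ (ρ ^ d)⁻¹ := inv_nonneg.2 (pow_nonneg hρ.pos.le d)
  have hx := hbound _ _ hρ _ _ (P.totalDegree_fePoly i x) (P.totalDegree_fePoly i x) 1
    zero_le_one (fun ξ _ => (one_mul _).ge) z hz
  have hy := hbound _ _ hρ _ _ (P.totalDegree_fePoly i _) (P.totalDegree_fePoly i y) θ hθ
    (nodallyLE_weight_sub hX hK hP hδ l hz y) z hz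
  rw [← Mesh.cell, ← rform_elemMass_self, Real.sqrt_mul hρd, ← P.feFun_eq i _ hz] at hx hy
  rw [abs_mul]
  calc _ ≤ C * θ * (√(ρ ^ d)⁻¹ * √(rform (P.elemMass i) y y)) *
        (C * 1 * (√(ρ ^ d)⁻¹ * √(rform (P.elemMass i) x x))) :=
        mul_le_mul hy hx (abs_nonneg _) (by positivity)
    _ = C ^ 2 * θ * (√(ρ ^ d)⁻¹ * √(ρ ^ d)⁻¹) *
        (√(rform (P.elemMass i) x x) * √(rform (P.elemMass i) y y)) := by ring
    _ = _ := by rw [Real.mul_self_sqrt hρd]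

lemma exists_bdryMass_weight_sub_le (hd : 1 ≤ d) (hX : IsReferenceNodeSet (r - 1) X)
    (hK : 0 < K) :
    ∃ C : ℝ, 0 < C ∧ ∀ P : Setup d r X, P.Regular K → 0 < P.δ → ∀ l, ∀ x y : P.Idx → ℝ,
      |rform (P.bdryMass l 1) x ((fun p : P.Idx => P.χ l p) * y) -
        rform (P.bdryMass l (P.χ l)) x y| ≤
        C / P.δ * ∑ i ∈ P.sub l, √(rform (P.elemMass i) x x) * √(rform (P.elemMass i) y y) := by
  obtain ⟨C, hC, hbound⟩ := exists_abs_feFun_weight_sub_mul_le (d := d) (r := r) hX hK.le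
  obtain ⟨C', hC', harea⟩ := exists_hausdorff_frontier_cellOf_le hd
  refine ⟨C * C' * K ^ (d + 1), by positivity, fun P hP hδ l x y => ?_⟩
  choose ρ hρ using fun i => hP.1.exists_hasInball hd hK.le i
  let D i := Metric.diam (P.mesh.cell i)
  let Q i := √(rform (P.elemMass i) x x) * √(rform (P.elemMass i) y y)
  let b i := C * (K / P.δ * D i) * (ρ i ^ d)⁻¹ * Q i
  have hD i : 0 ≤ D i := Metric.diam_nonneg
  have hρpos i : 0 < ρ i ^ d := pow_pos (hρ i).pos d
  have hQ i : 0 ≤ Q i := mul_nonneg (Real.sqrt_nonneg _) (Real.sqrt_nonneg _)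
  have hb i : 0 ≤ b i := by
    have := hD i; have := hρpos i; have := hQ i
    positivity
  rw [rform_bdryMass_weight_sub hd]
  refine (abs_setIntegral_le_sum (b := b) (P.sub l) (P.locBdry_subset l)
    (P.measurableSet_locBdry l) (fun i _ => isClosed_frontier.measurableSet) (fun i _ => hb i)
    (fun i _ z hz => hbound P hP hδ l i (ρ i) (hρ i) z
      ((P.mesh.isCompact_cell i).isClosed.frontier_subset hz.2) x y)
    (fun i _ => mul_nonneg hC'.le (pow_nonneg (hD i) _))
    fun i _ => harea (P.mesh.elem i)).trans ?_
  rw [Finset.mul_sum]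
  refine Finset.sum_le_sum fun i _ => ?_
  have hDρ : D i * D i ^ (d - 1) ≤ K ^ d * ρ i ^ d := by
    rw [← pow_succ', Nat.sub_add_cancel hd, ← mul_pow]
    exact pow_le_pow_left₀ (hD i) (hρ i).diam_le d
  calc b i * (C' * D i ^ (d - 1))
      = C * C' * (K / P.δ) * (ρ i ^ d)⁻¹ * (D i * D i ^ (d - 1)) * Q i := by ring
    _ ≤ C * C' * (K / P.δ) * (ρ i ^ d)⁻¹ * (K ^ d * ρ i ^ d) * Q i := by
      have := hρpos i; have := hQ i
      gcongr
    _ = C * C' * K ^ (d + 1) / P.δ * Q i := by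
      have := (hρpos i).ne'
      field_simp
      ring

lemma eq_zero_of_elemSeminorm_eq_zero (hd : 1 ≤ d) (hX : IsReferenceNodeSet (r - 1) X)
    (hK : 0 ≤ K) {k : ℝ} (hk : k ≠ 0) (hP : P.Regular K) {i : Fin P.mesh.numElem}
    {V : P.Idx → ℂ} (h : P.elemSeminorm k i V = 0) {p : P.Idx} (hp : (p : E d) ∈ P.mesh.cell i) :
    V p = 0 := by
  obtain ⟨C, -, hbound⟩ := exists_abs_le_of_nodallyLE hX K
  obtain ⟨ρ, hρ⟩ := hP.1.exists_hasInball hd hK i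
  have hreal (x : P.Idx → ℝ) (hx : rform (P.elemMass i) x x = 0) : x p = 0 := by
    rw [rform_elemMass_self] at hx
    have hp0 := hbound _ _ hρ _ _ (P.totalDegree_fePoly i x) (P.totalDegree_fePoly i x) 1
      zero_le_one (fun ξ _ => (one_mul _).ge) p hp
    rwa [← Mesh.cell, hx, mul_zero, Real.sqrt_zero, mul_zero, abs_nonpos_iff, ← P.feFun_eq i x hp,
      P.feFun_node] at hp0
  have hsq := energySeminorm_sq (P.posSemidef_elemStiffness i) (P.posSemidef_elemMass i) (k := k) V
  rw [← elemSeminorm, h, formSeminorm_sq (P.posSemidef_elemMass i)] at hsq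
  have hre := rform_nonneg (P.posSemidef_elemMass i) (Complex.re ∘ V)
  have him := rform_nonneg (P.posSemidef_elemMass i) (Complex.im ∘ V)
  have hsum : rform (P.elemMass i) (Complex.re ∘ V) (Complex.re ∘ V) +
      rform (P.elemMass i) (Complex.im ∘ V) (Complex.im ∘ V) = 0 := by
    have hk2 : 0 < k ^ 2 := by positivity
    nlinarith [sq_nonneg (formSeminorm (P.posSemidef_elemStiffness i) V)]
  have hVp : (Complex.re ∘ V) p = 0 ∧ (Complex.im ∘ V) p = 0 :=
    ⟨hreal _ (by linarith), hreal _ (by linarith)⟩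
  exact Complex.ext hVp.1 hVp.2

end Setup

/-! ### The preconditioner as a sum of local solutions -/

namespace Setup

section LocalProblems

open Matrix

variable {d r : ℕ} {X : Finset (Fin d → ℝ)} (P : Setup d r X)

/-- The form of the impedance problem on `Ω_ℓ`, for coefficient vectors on all nodes. -/
def locForm (k ε : ℝ) (η : ℂ) (l : Fin P.N) : LinearMap.BilinMap ℝ (P.Idx → ℂ) ℂ :=
  localForm (P.sub l) P.elemStiffness P.elemMass (P.bdryMass l 1) (k ^ 2 + Complex.I * ε) η

lemma locMatrix_eq_sum (k ε : ℝ) (η : ℂ) (l : Fin P.N) :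
    P.locMatrix k ε η l =
      ∑ i ∈ P.sub l, ((P.elemStiffness i).map Complex.ofReal -
        ((k : ℂ) ^ 2 + Complex.I * ε) • (P.elemMass i).map Complex.ofReal) -
      (Complex.I * η) • (P.bdryMass l 1).map Complex.ofReal := by
  ext p q
  rw [locMatrix, Ωl, helmholtzForm_eq_sum]
  simp only [bdryMass, Matrix.sub_apply, Matrix.sum_apply, Matrix.smul_apply, Matrix.map_apply,
    Finset.sum_sub_distrib, Complex.ofReal_sum, smul_eq_mul, Finset.mul_sum, Pi.one_apply, one_mul]
  simp only [mul_comm (P.φ p _)]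

lemma dotProduct_locMatrix (k ε : ℝ) (η : ℂ) (l : Fin P.N) (V W : P.Idx → ℂ) :
    star W ⬝ᵥ P.locMatrix k ε η l *ᵥ V = P.locForm k ε η l V W := by
  rw [locMatrix_eq_sum, locForm, localForm_apply]
  simp only [Matrix.sub_mulVec, Matrix.sum_mulVec, Matrix.smul_mulVec, dotProduct_sub,
    dotProduct_sum, dotProduct_smul, smul_eq_mul, volumeForm_apply]
  rfl

open Classical in
/-- Extension by zero of a coefficient vector on the nodes of `closure Ω_ℓ`. -/
def extend (l : Fin P.N) (w : P.LocIdx l → ℂ) : P.Idx → ℂ := fun p =>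
  if h : (p : E d) ∈ closure (P.Ωl l) then w ⟨p, h⟩ else 0

/-- The coefficient vectors supported on the nodes of `closure Ω_ℓ`. -/
def locSpace (l : Fin P.N) : Submodule ℝ (P.Idx → ℂ) where
  carrier := {V | ∀ p : P.Idx, (p : E d) ∉ closure (P.Ωl l) → V p = 0}
  add_mem' := fun hV hW p hp => by rw [Pi.add_apply, hV p hp, hW p hp, add_zero]
  zero_mem' := fun _ _ => rfl
  smul_mem' := fun a V hV p hp => by rw [Pi.smul_apply, hV p hp, smul_zero]

variable {P} {l : Fin P.N}

lemma extend_mem_locSpace (w : P.LocIdx l → ℂ) : P.extend l w ∈ P.locSpace l :=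
  fun _ hp => dif_neg hp

lemma extend_apply (w : P.LocIdx l → ℂ) (p : P.LocIdx l) : P.extend l w (p : P.Idx) = w p :=
  dif_pos p.2

lemma weightMap_mem_locSpace (hX : IsReferenceNodeSet (r - 1) X) (V : P.Idx → ℂ) :
    weightMap (fun p : P.Idx => P.χ l p) V ∈ P.locSpace l := by
  intro p hp
  obtain ⟨i, hi⟩ := P.exists_cell_of_node hX p
  have hχ : P.χ l p = 0 :=
    by_contra fun h => hp (P.χ_support l p (P.mesh.cell_subset_closure_Ω i hi) h)
  simp [weightMap, hχ]

lemma sum_locIdx {f : P.Idx → ℂ} (hf : f ∈ P.locSpace l) :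
    ∑ p : P.LocIdx l, f p = ∑ p, f p :=
  Finset.sum_of_injOn (fun p : P.LocIdx l => (p : P.Idx)) Subtype.val_injective.injOn
    (fun _ _ => Finset.mem_coe.2 (Finset.mem_univ _))
    (fun p _ hp => hf p fun h => hp ⟨⟨p, h⟩, Finset.mem_coe.2 (Finset.mem_univ _), rfl⟩)
    fun _ _ => rfl

lemma Aloc_mulVec_apply (k ε : ℝ) (η : ℂ) (u : P.LocIdx l → ℂ) (p : P.LocIdx l) :
    (P.Aloc k ε η l *ᵥ u) p = (P.locMatrix k ε η l *ᵥ P.extend l u) p := by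
  have hmem : (fun q => P.locMatrix k ε η l p q * P.extend l u q) ∈ P.locSpace l :=
    fun q hq => mul_eq_zero_of_right _ (extend_mem_locSpace u q hq)
  rw [Matrix.mulVec, Matrix.mulVec, dotProduct, dotProduct, ← sum_locIdx hmem]
  exact Finset.sum_congr rfl fun q _ => by rw [extend_apply]; rfl

lemma sum_star_mul_Aloc_mulVec (k ε : ℝ) (η : ℂ) (u : P.LocIdx l → ℂ) {W : P.Idx → ℂ}
    (hW : W ∈ P.locSpace l) :
    ∑ p : P.LocIdx l, star (W p) * (P.Aloc k ε η l *ᵥ u) p =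
      P.locForm k ε η l (P.extend l u) W := by
  have hmem : (fun p => star (W p) * (P.locMatrix k ε η l *ᵥ P.extend l u) p) ∈ P.locSpace l :=
    fun p hp => mul_eq_zero_of_left (star_eq_zero.2 (hW p hp)) _
  simp only [Aloc_mulVec_apply]
  rw [sum_locIdx hmem, ← dotProduct_locMatrix]
  rfl

lemma R_mulVec_apply (V : P.Idx → ℂ) (p : P.LocIdx l) :
    (P.R l *ᵥ V) p = P.χ l ((p : P.Idx) : E d) * V p := by
  simp [Matrix.mulVec, dotProduct, R]

lemma R_transpose_mulVec (u : P.LocIdx l → ℂ) :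
    (P.R l)ᵀ *ᵥ u = weightMap (fun p : P.Idx => P.χ l p) (P.extend l u) := by
  classical
  ext q
  have hmem : (fun p : P.Idx => (if p = q then (P.χ l p : ℂ) else 0) * P.extend l u p) ∈
      P.locSpace l := fun p hp => mul_eq_zero_of_right _ (extend_mem_locSpace u p hp)
  calc ((P.R l)ᵀ *ᵥ u) q
      = ∑ p : P.LocIdx l, (if (p : P.Idx) = q then (P.χ l ((p : P.Idx) : E d) : ℂ) else 0) *
          P.extend l u p :=
        Finset.sum_congr rfl fun p _ => by rw [extend_apply]; rfl
    _ = weightMap (fun p : P.Idx => P.χ l p) (P.extend l u) q := by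
        rw [sum_locIdx hmem]
        simp [weightMap]

variable (P l) in
/-- The solution `A_{ε,ℓ}⁻¹ R_ℓ A_ε V` of the local problem, extended by zero. -/
def localSolution (k ε : ℝ) (η : ℂ) (V : P.Idx → ℂ) : P.Idx → ℂ :=
  P.extend l ((P.Aloc k ε η l)⁻¹ *ᵥ (P.R l *ᵥ (P.A k ε η *ᵥ V)))

lemma Binv_mul_A_mulVec (k ε : ℝ) (η : ℂ) (V : P.Idx → ℂ) :
    (P.Binv k ε η * P.A k ε η) *ᵥ V =
      ∑ l, weightMap (fun p : P.Idx => P.χ l p) (P.localSolution l k ε η V) := by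
  classical
  simp only [← Matrix.mulVec_mulVec, Binv, Matrix.sum_mulVec, localSolution, R_transpose_mulVec]

lemma locForm_localSolution (hX : IsReferenceNodeSet (r - 1) X) {k ε : ℝ} {η : ℂ}
    (hA : IsUnit (P.Aloc k ε η l)) (V : P.Idx → ℂ) {W : P.Idx → ℂ} (hW : W ∈ P.locSpace l) :
    P.locForm k ε η l (P.localSolution l k ε η V) W =
      P.locForm k ε η l V (weightMap (fun p : P.Idx => P.χ l p) W) := by
  classical
  have hmem : (fun p => star (W p) * (P.χ l p * (P.A k ε η *ᵥ V) p)) ∈ P.locSpace l :=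
    fun p hp => mul_eq_zero_of_left (star_eq_zero.2 (hW p hp)) _
  have hχA (p : P.Idx) : (P.χ l p : ℂ) * (P.A k ε η *ᵥ V) p =
      P.χ l p * (P.locMatrix k ε η l *ᵥ V) p := by
    simp only [Matrix.mulVec, dotProduct, Finset.mul_sum, ← mul_assoc, χ_mul_A hX]
  rw [localSolution, ← sum_star_mul_Aloc_mulVec k ε η _ hW, Matrix.mulVec_mulVec,
    Matrix.mul_nonsing_inv _ ((Matrix.isUnit_iff_isUnit_det _).1 hA), Matrix.one_mulVec]
  simp only [R_mulVec_apply]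
  rw [sum_locIdx hmem, ← dotProduct_locMatrix]
  refine Finset.sum_congr rfl fun p _ => ?_
  rw [hχA]
  simp [weightMap, mul_left_comm, mul_assoc]

end LocalProblems
end Setup

/-! ### The field of values -/

namespace Setup

variable {d r : ℕ} {X : Finset (Fin d → ℝ)} {P : Setup d r X} {K k ε : ℝ} {η : ℂ}

lemma innerDk_eq_sum (V W : P.Idx → ℂ) :
    P.innerDk k V W = ∑ i, cform (P.elemStiffness i + k ^ 2 • P.elemMass i) V W := by
  simp only [innerDk, Dk_eq_sum, cform_eq_sum, dotProduct, Matrix.mulVec, Matrix.map_apply,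
    Matrix.sum_apply, Complex.ofReal_sum, Finset.sum_mul, Finset.mul_sum, Pi.star_apply]
  refine (Finset.sum_congr rfl fun p _ => Finset.sum_comm).trans ?_
  exact Finset.sum_comm

lemma posSemidef_elemEnergy (P : Setup d r X) (k : ℝ) (i : Fin P.mesh.numElem) :
    (P.elemStiffness i + k ^ 2 • P.elemMass i).PosSemidef :=
  (P.posSemidef_elemStiffness i).add ((P.posSemidef_elemMass i).smul (sq_nonneg k))

lemma cform_self_eq_elemSeminorm_sq (i : Fin P.mesh.numElem) (V : P.Idx → ℂ) :
    cform (P.elemStiffness i + k ^ 2 • P.elemMass i) V V =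
      ((P.elemSeminorm k i V ^ 2 : ℝ) : ℂ) :=
  cform_self_eq_sq (P.posSemidef_elemEnergy k i) V

lemma normDk_sq (V : P.Idx → ℂ) : P.normDk k V ^ 2 = ∑ i, P.elemSeminorm k i V ^ 2 := by
  have hinner : P.innerDk k V V = ((∑ i, P.elemSeminorm k i V ^ 2 : ℝ) : ℂ) := by
    rw [innerDk_eq_sum, Complex.ofReal_sum]
    exact Finset.sum_congr rfl fun i _ => cform_self_eq_elemSeminorm_sq i V
  rw [normDk, hinner, Complex.ofReal_re,
    Real.sq_sqrt (Finset.sum_nonneg fun _ _ => sq_nonneg _)]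

lemma normDk_sq_pos (hd : 1 ≤ d) (hX : IsReferenceNodeSet (r - 1) X) (hK : 0 ≤ K) (hk : k ≠ 0)
    (hP : P.Regular K) {V : P.Idx → ℂ} (hV : V ≠ 0) : 0 < P.normDk k V ^ 2 := by
  rw [normDk_sq]
  refine (Finset.sum_nonneg fun _ _ => sq_nonneg _).lt_of_ne fun h => hV (funext fun p => ?_)
  obtain ⟨i, hi⟩ := P.exists_cell_of_node hX p
  have hVi := (Finset.sum_eq_zero_iff_of_nonneg fun _ _ => sq_nonneg _).1 h.symm i
    (Finset.mem_univ i)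
  exact eq_zero_of_elemSeminorm_eq_zero hd hX hK hk hP (eq_zero_of_pow_eq_zero hVi) hi

lemma elemSeminorm_weightMap_eq_zero (hX : IsReferenceNodeSet (r - 1) X) {l : Fin P.N}
    {i : Fin P.mesh.numElem} (hi : i ∉ P.sub l) (V : P.Idx → ℂ) :
    P.elemSeminorm k i (weightMap (fun p : P.Idx => P.χ l p) V) = 0 := by
  have hfe (x : P.Idx → ℝ) : P.fePoly i ((fun p : P.Idx => P.χ l p) * x) = 0 :=
    fePoly_weight_eq_zero hX hi x
  have hS (x : P.Idx → ℝ) : rform (P.elemStiffness i) ((fun p : P.Idx => P.χ l p) * x)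
      ((fun p : P.Idx => P.χ l p) * x) = 0 := by
    simp [rform_elemStiffness, hfe, gradient_polyFun_zero]
  have hM (x : P.Idx → ℝ) : rform (P.elemMass i) ((fun p : P.Idx => P.χ l p) * x)
      ((fun p : P.Idx => P.χ l p) * x) = 0 := by
    simp [rform_elemMass, hfe, polyFun_zero]
  refine eq_zero_of_pow_eq_zero (n := 2) ?_
  rw [elemSeminorm, energySeminorm_sq, formSeminorm_sq, formSeminorm_sq]
  simp only [re_comp_weightMap, im_comp_weightMap, hS, hM]
  ring

lemma card_sub_le_Λ (i : Fin P.mesh.numElem) :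
    (Finset.univ.filter fun l => i ∈ P.sub l).card ≤ P.Λ := by
  classical
  obtain h | ⟨l, hl⟩ := (Finset.univ.filter fun l => i ∈ P.sub l).eq_empty_or_nonempty
  · simp [h]
  have hvert := point_mem_cellOf (P.mesh.elem i) 0
  refine (Finset.card_le_card fun l' hl' => ?_).trans (Finset.le_sup (f := fun l : Fin P.N =>
    (Finset.univ.filter fun l' : Fin P.N =>
      (closure (P.Ωl l) ∩ closure (P.Ωl l')).Nonempty).card) (Finset.mem_univ l))
  simp only [Finset.mem_filter, Finset.mem_univ, true_and] at hl hl' ⊢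
  exact ⟨_, P.cell_subset_closure_Ωl hl hvert, P.cell_subset_closure_Ωl hl' hvert⟩

lemma posSemidef_bdryMass_one (hd : 1 ≤ d) (l : Fin P.N) : (P.bdryMass l 1).PosSemidef :=
  P.posSemidef_bdryMass hd l continuousOn_const fun _ _ => zero_le_one

lemma isUnit_Aloc (hd : 1 ≤ d) (hX : IsReferenceNodeSet (r - 1) X) (hK : 0 ≤ K) (hk : 0 < k)
    (hε : ε ≠ 0) (hadm : Admissible P K k ε η) (l : Fin P.N) : IsUnit (P.Aloc k ε η l) := by
  classical
  obtain ⟨hP, -, hεk, hη⟩ := hadm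
  obtain ⟨Θ, hΘ⟩ := exists_isCoercivityMultiplier hk hε hεk hη
  have hγ : 0 < |ε| / (8 * k ^ 2) := div_pos (abs_pos.2 hε) (by positivity)
  rw [← Matrix.mulVec_injective_iff_isUnit, ← Matrix.coe_mulVecLin, injective_iff_map_eq_zero]
  intro u hu
  rw [Matrix.mulVecLin_apply] at hu
  have hform : P.locForm k ε η l (P.extend l u) (P.extend l u) = 0 := by
    rw [← sum_star_mul_Aloc_mulVec k ε η u (extend_mem_locSpace u), hu]
    simp
  have hcoer : |ε| / (8 * k ^ 2) * ∑ i ∈ P.sub l, P.elemSeminorm k i (P.extend l u) ^ 2 ≤ 0 := by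
    rw [← norm_zero (E := ℂ), ← hform]
    exact localForm_coercive P.posSemidef_elemStiffness P.posSemidef_elemMass
      (posSemidef_bdryMass_one hd l) hΘ _
  have hsum : ∑ i ∈ P.sub l, P.elemSeminorm k i (P.extend l u) ^ 2 = 0 :=
    le_antisymm (nonpos_of_mul_nonpos_right hcoer hγ) (Finset.sum_nonneg fun _ _ => sq_nonneg _)
  ext p
  obtain ⟨i, hi, hpi⟩ := Set.mem_iUnion₂.1 (P.closure_Ωl_subset l p.2)
  have hzero := (Finset.sum_eq_zero_iff_of_nonneg fun _ _ => sq_nonneg _).1 hsum i hi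
  rw [← extend_apply u p]
  exact eq_zero_of_elemSeminorm_eq_zero hd hX hK hk.ne' hP (eq_zero_of_pow_eq_zero hzero) hpi

theorem exists_isWeightedLocalForm_locForm (hd : 1 ≤ d) (hX : IsReferenceNodeSet (r - 1) X)
    (hK : 0 < K) :
    ∃ C : ℝ, 0 < C ∧ ∀ (P : Setup d r X) (k ε : ℝ) (η : ℂ), 0 < k → ε ≠ 0 → 0 < P.δ →
      Admissible P K k ε η → ∀ l, IsWeightedLocalForm (P.elemSeminorm k) (P.sub l)
        (weightMap fun p : P.Idx => P.χ l p) (fun i => P.χ l ((P.mesh.elem i).points 0))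
        (P.locForm k ε η l) (C / (k * P.δ)) (|ε| / (8 * k ^ 2)) := by
  obtain ⟨C₁, hC₁, hvolume⟩ := exists_elemSeminorm_weight_sub_le hd hX hK
  obtain ⟨C₂, hC₂, hboundary⟩ := exists_bdryMass_weight_sub_le hd hX hK
  refine ⟨6 * C₁ + 16 * C₂, by positivity, fun P k ε η hk hε hδ hadm l => ?_⟩
  obtain ⟨hP, hkh, hεk, hη⟩ := hadm
  obtain ⟨Θ, hΘ⟩ := exists_isCoercivityMultiplier hk hε hεk hη
  have hz : ‖(k : ℂ) ^ 2 + Complex.I * ε‖ ≤ 2 * k ^ 2 := by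
    grw [norm_add_le]
    simp only [norm_pow, norm_mul, Complex.norm_I, Complex.norm_real, Real.norm_eq_abs, sq_abs,
      one_mul]
    linarith
  have hvert i : (P.mesh.elem i).points 0 ∈ P.mesh.cell i := point_mem_cellOf (P.mesh.elem i) 0
  have hχ y (hy : y ∈ closure P.mesh.Ω) : 0 ≤ P.χ l y := (P.χ_mem l y hy).1
  have hσ : (6 * C₁ + 16 * C₂) / (k * P.δ) = 6 * (C₁ / (k * P.δ)) + 16 * (C₂ / P.δ) / k := by
    field_simp
  rw [hσ]
  exact isWeightedLocalForm_localForm P.posSemidef_elemStiffness P.posSemidef_elemMass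
    (posSemidef_bdryMass_one hd l) (P.posSemidef_bdryMass hd l (P.χ_poly l).1 hχ) hk hz
    (norm_impedance_le hk hεk hη) hΘ (by positivity) (by positivity)
    (fun i => hvolume P k hk hP hδ hkh l i _ (hvert i)) (hboundary P hP hδ l)
    (fun i => hχ _ (P.mesh.cell_subset_closure_Ω i (hvert i)))
    (fun i hi => P.χ_eq_zero hi (hvert i)) fun i hi => elemSeminorm_weightMap_eq_zero hX hi

lemma innerDk_Binv_mul_A (V : P.Idx → ℂ) :
    P.innerDk k V ((P.Binv k ε η * P.A k ε η).mulVec V) =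
      ∑ l, ∑ i, cform (P.elemStiffness i + k ^ 2 • P.elemMass i) V
        (weightMap (fun p : P.Idx => P.χ l p) (P.localSolution l k ε η V)) := by
  rw [innerDk_eq_sum, Binv_mul_A_mulVec, Finset.sum_comm]
  simp only [map_sum]

theorem le_norm_innerDk_Binv_mul_A (hX : IsReferenceNodeSet (r - 1) X) {σ γ : ℝ} (hσ : 0 < σ)
    (hγ : 0 < γ) (hγ1 : γ ≤ 1) (hA : ∀ l, IsUnit (P.Aloc k ε η l))
    (h : ∀ l, IsWeightedLocalForm (P.elemSeminorm k) (P.sub l)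
      (weightMap fun p : P.Idx => P.χ l p) (fun i => P.χ l ((P.mesh.elem i).points 0))
      (P.locForm k ε η l) σ γ) (V : P.Idx → ℂ) :
    (1 / (P.Λ : ℝ) - 3 * (σ / γ) - 4 * P.Λ * (σ / γ) ^ 2) * P.normDk k V ^ 2 ≤
      ‖P.innerDk k V ((P.Binv k ε η * P.A k ε η).mulVec V)‖ := by
  rw [innerDk_Binv_mul_A, normDk_sq]
  exact schwarz_lower_bound (L := P.locSpace)
    (ip := fun i => cform (P.elemStiffness i + k ^ 2 • P.elemMass i) V) hσ hγ hγ1 h card_sub_le_Λ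
    (fun i => P.χ_sum _ (P.mesh.cell_subset_closure_Ω i (point_mem_cellOf (P.mesh.elem i) 0)))
    (fun i W => norm_cform_le (P.posSemidef_elemEnergy k i) V W)
    (fun i => cform_self_eq_elemSeminorm_sq i V)
    (fun l => weightMap_mem_locSpace hX) (fun l => extend_mem_locSpace _)
    fun l W hW => locForm_localSolution hX (hA l) V hW

theorem exists_fieldOfValuesBound (hd : 1 ≤ d) (hX : IsReferenceNodeSet (r - 1) X)
    (hK : 0 < K) :
    ∃ C : ℝ, 0 < C ∧ ∀ (P : Setup d r X) (k ε : ℝ) (η : ℂ), 0 < k → ε ≠ 0 → 0 < P.δ →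
      Admissible P K k ε η → P.FieldOfValuesBound k ε η
        (1 / (P.Λ : ℝ) - C * (k / (|ε| * P.δ)) - C * P.Λ * (k / (|ε| * P.δ)) ^ 2) := by
  classical
  obtain ⟨C, hC, hlocal⟩ := exists_isWeightedLocalForm_locForm hd hX hK
  refine ⟨3 * (8 * C) + 4 * (8 * C) ^ 2, by positivity, fun P k ε η hk hε hδ hadm => ?_⟩
  have hunit := isUnit_Aloc hd hX hK.le hk hε hadm
  refine ⟨fun l => by convert hunit l, fun V hV => ?_⟩
  have hε0 : 0 < |ε| := abs_pos.2 hε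
  have hγ1 : |ε| / (8 * k ^ 2) ≤ 1 := by
    rw [div_le_one (by positivity)]
    linarith [hadm.2.2.1, sq_nonneg k]
  rw [le_div_iff₀ (normDk_sq_pos hd hX hK.le hk.ne' hadm.1 hV)]
  refine le_trans ?_ (le_norm_innerDk_Binv_mul_A hX (by positivity) (by positivity) hγ1 hunit
    (hlocal P k ε η hk hε hδ hadm) V)
  refine mul_le_mul_of_nonneg_right ?_ (sq_nonneg _)
  set θ := k / (|ε| * P.δ) with hθ
  have hratio : C / (k * P.δ) / (|ε| / (8 * k ^ 2)) = 8 * C * θ := by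
    rw [hθ]
    field_simp
  rw [hratio]
  have : 0 ≤ C ^ 2 * θ := by positivity
  have : 0 ≤ C * (P.Λ * θ ^ 2) := by positivity
  nlinarith

end Setup

/-! ### Parameter regimes -/

lemma Setup.FieldOfValuesBound.mono {d r : ℕ} {X : Finset (Fin d → ℝ)} {P : Setup d r X}
    {k ε : ℝ} {η : ℂ} {c c' : ℝ} (h : P.FieldOfValuesBound k ε η c) (hc : c' ≤ max c 0) :
    P.FieldOfValuesBound k ε η c' :=
  ⟨h.1, fun V hV => hc.trans (max_le (h.2 V hV) (div_nonneg (norm_nonneg _) (sq_nonneg _)))⟩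

lemma div_abs_mul_le_rpow {K k ε δ H α β : ℝ} (hK : 0 < K) (hk : 0 < k)
    (hε : k ^ (1 + β) ≤ K * |ε|) (hδ : H ≤ K * δ) (hH : k ^ (-α) ≤ K * H) :
    ε ≠ 0 ∧ 0 < δ ∧ k / (|ε| * δ) ≤ K ^ 3 * k ^ (α - β) := by
  have hkε : 0 < k ^ (1 + β) := Real.rpow_pos_of_pos hk _
  have hkδ : 0 < k ^ (-α) := Real.rpow_pos_of_pos hk _
  have hε0 : 0 < |ε| := pos_of_mul_pos_right (hkε.trans_le hε) hK.le
  have hδ' : k ^ (-α) ≤ K ^ 2 * δ := by nlinarith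
  have hδ0 : 0 < δ := pos_of_mul_pos_right (hkδ.trans_le hδ') (by positivity)
  refine ⟨abs_pos.1 hε0, hδ0, ?_⟩
  rw [div_le_iff₀ (by positivity)]
  have hexp : k = k ^ (α - β) * (k ^ (1 + β) * k ^ (-α)) := by
    rw [← Real.rpow_add hk, ← Real.rpow_add hk]
    ring_nf
    exact (Real.rpow_one k).symm
  calc k = k ^ (α - β) * (k ^ (1 + β) * k ^ (-α)) := hexp
    _ ≤ k ^ (α - β) * ((K * |ε|) * (K ^ 2 * δ)) := by gcongr
    _ = K ^ 3 * k ^ (α - β) * (|ε| * δ) := by ring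

lemma exists_mul_rpow_le_one (a : ℝ) {α β : ℝ} (hαβ : α < β) :
    ∃ k₁ : ℝ, ∀ k, k₁ ≤ k → a * k ^ (α - β) ≤ 1 := by
  have hlim := (tendsto_rpow_neg_atTop (sub_pos.2 hαβ)).const_mul a
  rw [mul_zero, neg_sub] at hlim
  exact Filter.eventually_atTop.1 (hlim.eventually_le_const zero_lt_one)

lemma one_div_sub_rpow_le {C B L k θ α β : ℝ} (hC : 0 ≤ C) (hL : 0 ≤ L) (hk : 0 < k)
    (hθ0 : 0 ≤ θ) (hθ : θ ≤ B * k ^ (α - β)) (hLB : L * B * k ^ (α - β) ≤ 1) :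
    1 / L - (1 + 2 * C * B) * k ^ (α - β) ≤ 1 / L - C * θ - C * L * θ ^ 2 := by
  have hpos : 0 < k ^ (α - β) := Real.rpow_pos_of_pos hk _
  have : 0 ≤ L * (B * k ^ (α - β)) := mul_nonneg hL (hθ0.trans hθ)
  have hquad : L * θ ^ 2 ≤ B * k ^ (α - β) := by
    calc L * θ ^ 2 = L * θ * θ := by ring
      _ ≤ L * (B * k ^ (α - β)) * (B * k ^ (α - β)) := by gcongr
      _ = L * B * k ^ (α - β) * (B * k ^ (α - β)) := by ring
      _ ≤ B * k ^ (α - β) := mul_le_of_le_one_left (hθ0.trans hθ) hLB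
  have := mul_le_mul_of_nonneg_left hθ hC
  have := mul_le_mul_of_nonneg_left hquad hC
  linarith

lemma one_div_natCast_sub_rpow_nonpos {B k α β : ℝ} (L : ℕ) (hB : 0 ≤ B) (hk : 1 ≤ k)
    (hαβ : β ≤ α) : 1 / (L : ℝ) - (1 + B) * k ^ (α - β) ≤ 0 := by
  have hone : 1 ≤ k ^ (α - β) := Real.one_le_rpow hk (sub_nonneg.2 hαβ)
  have hL : 1 / (L : ℝ) ≤ 1 := by
    rw [one_div]
    exact Nat.cast_inv_le_one L
  nlinarith

lemma one_div_two_mul_le {C L : ℝ} (hC : 0 ≤ C) (hL : 0 < L) :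
    1 / (2 * L) ≤ 1 / L - C * (1 / (4 * (L + 1) * (C + 1))) -
      C * L * (1 / (4 * (L + 1) * (C + 1))) ^ 2 := by
  set θ := 1 / (4 * (L + 1) * (C + 1))
  have : 0 < θ := by positivity
  have hlin : C * θ ≤ 1 / (4 * L) := by
    rw [mul_one_div, div_le_div_iff₀ (by positivity) (by positivity)]
    nlinarith
  have hLθ : L * θ ≤ 1 := by
    rw [mul_one_div, div_le_one (by positivity)]
    nlinarith
  have hquad : C * L * θ ^ 2 ≤ 1 / (4 * L) := by
    calc C * L * θ ^ 2 = C * θ * (L * θ) := by ring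
      _ ≤ 1 / (4 * L) * 1 := by gcongr
      _ = 1 / (4 * L) := mul_one _
  have hsplit : 1 / L = 1 / (2 * L) + 2 * (1 / (4 * L)) := by field_simp; norm_num
  linarith

section

variable {d r : ℕ} {X : Finset (Fin d → ℝ)} {K : ℝ}

theorem exists_fieldOfValuesBound_rpow (hd : 1 ≤ d) (hX : IsReferenceNodeSet (r - 1) X)
    (hK : 0 < K) (α β : ℝ) :
    ∃ C : ℝ, 0 < C ∧ ∀ L : ℕ, ∃ k₀ : ℝ, 0 < k₀ ∧
      ∀ (P : Setup d r X) (k ε : ℝ) (η : ℂ), Admissible P K k ε η → P.Λ = L → k₀ ≤ k →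
        Comparable K |ε| (k ^ (1 + β)) → Comparable K P.δ P.H → Comparable K P.H (k ^ (-α)) →
        P.FieldOfValuesBound k ε η (1 / (L : ℝ) - C * k ^ (α - β)) := by
  obtain ⟨C, hC, hbound⟩ := Setup.exists_fieldOfValuesBound hd hX hK
  refine ⟨1 + 2 * C * K ^ 3, by positivity, fun L => ?_⟩
  rcases lt_or_ge α β with hαβ | hαβ
  · obtain ⟨k₁, hk₁⟩ := exists_mul_rpow_le_one (L * K ^ 3) hαβ
    refine ⟨max 1 k₁, by positivity, fun P k ε η hadm hΛ hk hε hδ hH => ?_⟩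
    have hk0 : 0 < k := zero_lt_one.trans_le ((le_max_left _ _).trans hk)
    obtain ⟨hε0, hδ0, hθ⟩ := div_abs_mul_le_rpow hK hk0 hε.2 hδ.2 hH.2
    refine (hbound P k ε η hk0 hε0 hδ0 hadm).mono (le_max_of_le_left ?_)
    rw [hΛ]
    exact one_div_sub_rpow_le hC.le L.cast_nonneg hk0 (by positivity) hθ
      (hk₁ k ((le_max_right _ _).trans hk))
  · refine ⟨1, one_pos, fun P k ε η hadm _ hk hε hδ hH => ?_⟩
    have hk0 : 0 < k := zero_lt_one.trans_le hk
    obtain ⟨hε0, hδ0, -⟩ := div_abs_mul_le_rpow hK hk0 hε.2 hδ.2 hH.2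
    exact (hbound P k ε η hk0 hε0 hδ0 hadm).mono
      (le_max_of_le_right (one_div_natCast_sub_rpow_nonpos L (by positivity) hk hαβ))

theorem exists_fieldOfValuesBound_const_mul (hd : 1 ≤ d) (hX : IsReferenceNodeSet (r - 1) X)
    (hK : 0 < K) {δ : ℝ} (hδ : 0 < δ) (L : ℕ) :
    ∃ C k₀ : ℝ, 0 < C ∧ 0 < k₀ ∧
      ∀ (P : Setup d r X) (k ε : ℝ) (η : ℂ), Admissible P K k ε η → P.Λ = L → P.δ = δ →
        |ε| = C * k → k₀ ≤ k → P.FieldOfValuesBound k ε η (1 / (2 * (L : ℝ))) := by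
  obtain ⟨C, hC, hbound⟩ := Setup.exists_fieldOfValuesBound hd hX hK
  refine ⟨4 * (L + 1) * (C + 1) / δ, 1, by positivity, one_pos,
    fun P k ε η hadm hΛ hPδ hε hk => ?_⟩
  have hk0 : 0 < k := zero_lt_one.trans_le hk
  have hε0 : 0 < |ε| := by rw [hε]; positivity
  refine (hbound P k ε η hk0 (abs_pos.1 hε0) (hPδ ▸ hδ) hadm).mono ?_
  rcases L.eq_zero_or_pos with hL | hL
  · exact le_max_of_le_right (by simp [hL])
  have hθ : k / (|ε| * P.δ) = 1 / (4 * (L + 1) * (C + 1)) := by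
    rw [hε, hPδ]
    field_simp
  rw [hΛ, hθ]
  exact le_max_of_le_left (one_div_two_mul_le hC.le (Nat.cast_pos.2 hL))

end

end Helmholtz

end

theorem corollary3p13_general {d : ℕ} (hd : 1 ≤ d) {m : ℕ} {X : Finset (Fin d → ℝ)}
    (hX : Helmholtz.IsReferenceNodeSet m X) {K : ℝ} (hK : 0 < K) :
    (∀ α β : ℝ, ∃ C : ℝ, 0 < C ∧ ∀ L : ℕ, ∃ k₀ : ℝ, 0 < k₀ ∧
        ∀ (P : Helmholtz.Setup d (m + 1) X) (k ε : ℝ) (η : ℂ),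
          Helmholtz.Admissible P K k ε η → P.Λ = L → k₀ ≤ k →
          Helmholtz.Comparable K |ε| (k ^ (1 + β)) →
          Helmholtz.Comparable K P.δ P.H →
          Helmholtz.Comparable K P.H (k ^ (-α)) →
          P.FieldOfValuesBound k ε η (1 / (L : ℝ) - C * k ^ (α - β))) ∧
    (∀ δ : ℝ, 0 < δ → ∀ L : ℕ, ∃ C k₀ : ℝ, 0 < C ∧ 0 < k₀ ∧
        ∀ (P : Helmholtz.Setup d (m + 1) X) (k ε : ℝ) (η : ℂ),
          Helmholtz.Admissible P K k ε η → P.Λ = L → P.δ = δ →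
          |ε| = C * k → k₀ ≤ k →
          P.FieldOfValuesBound k ε η (1 / (2 * (L : ℝ)))) :=
  ⟨Helmholtz.exists_fieldOfValuesBound_rpow (r := m + 1) hd hX hK,
    fun _ hδ => Helmholtz.exists_fieldOfValuesBound_const_mul (r := m + 1) hd hX hK hδ⟩

theorem corollary3p13 (d : ℕ) (hd : d = 2 ∨ d = 3) (r : ℕ) (hr : 2 ≤ r)
    (X : Finset (Fin d → ℝ)) (hX : Helmholtz.IsReferenceNodeSet (r - 1) X)
    (K : ℝ) (hK : 1 ≤ K) :
    (∀ α β : ℝ, 0 < α → α < 1 → 0 < β → β < 1 →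
      ∃ C : ℝ, 0 < C ∧ ∀ L : ℕ, ∃ k₀ : ℝ, 0 < k₀ ∧
        ∀ (P : Helmholtz.Setup d r X) (k ε : ℝ) (η : ℂ),
          Helmholtz.Admissible P K k ε η → P.Λ = L → k₀ ≤ k →
          Helmholtz.Comparable K |ε| (k ^ (1 + β)) →
          Helmholtz.Comparable K P.δ P.H →
          Helmholtz.Comparable K P.H (k ^ (-α)) →
          P.FieldOfValuesBound k ε η (1 / (L : ℝ) - C * k ^ (α - β))) ∧
    (∀ δ : ℝ, 0 < δ → ∀ L : ℕ,
      ∃ C k₀ : ℝ, 0 < C ∧ 0 < k₀ ∧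
        ∀ (P : Helmholtz.Setup d r X) (k ε : ℝ) (η : ℂ),
          Helmholtz.Admissible P K k ε η → P.Λ = L → P.δ = δ →
          |ε| = C * k → k₀ ≤ k →
          P.FieldOfValuesBound k ε η (1 / (2 * (L : ℝ)))) := by
  obtain ⟨m, rfl⟩ : ∃ m, r = m + 1 := ⟨r - 1, by omega⟩
  exact (corollary3p13_general (by omega) hX (zero_lt_one.trans_le hK)).imp_left
    fun h α β _ _ _ _ => h α β
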